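/- Let $k$ be a field and $0\neq\delta\in k$. A *decorated diagram* of type $(n,m)$ is a Temperley–Lieb diagram (non-crossing pairing of $n$ northern and $m$ southern vertices of a rectangle) in which some of the arcs exposed to the western edge carry a blob. Diagrams are concatenated as usual, two blobs on the same arc cancel, a loop with an even number of blobs is replaced by $\delta$, and a loop with an odd number of blobs by $0$. For $n\ge 0$ let $d_n=d_n(\delta)$ be the $k$-algebra with this multiplication on the diagrams of type $(n,n)$ with an even number of blobs in total (so $d_0=k$). Let $D_\infty$ be the undirected graph with vertices $0',0,1,2,\dots$ and edges $0'-1$ and $i-(i+1)$ for $i\ge 0$. For $l\ge 0$ let $D^d_l(n,l)$ be the set of half diagrams, i.e. decorated diagrams of type $(n,l)$ all of whose southern vertices lie on propagating lines (lines joining a northern and a southern vertex), with an even number of blobs; let $D^d_{0'}(n,0')$ be the set of decorated diagrams of type $(n,0)$ with an odd number of blobs. Put $\Lambda_n=\{n,n-2,\dots,1\}$ for $n$ odd, $\Lambda_n=\{n,n-2,\dots,2,0,0'\}$ for $n>0$ even, $\Lambda_0=\{0\}$. For a vertex $v$ of $D_\infty$ let $\Delta_n(v)$ be the left $d_n$-module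 on the half diagrams $D^d_v(n,v)$, with action by concatenation modulo diagrams with fewer propagating lines (in the sense of generators and relations, as is $d_n$). Then: 1. The diagrams of type $(n,n)$ with an even number of blobs form a $k$-basis of $d_n$, and the half diagrams in $D^d_v(n,v)$ form a $k$-basis of $\Delta_n(v)$. 2. The $\Delta_n(\lambda)$, $\lambda\in\Lambda_n$, are the standard modules of $d_n$: there is a complete set of pairwise non-isomorphic simple $d_n$-modules $L_n(\lambda)$, $\lambda\in\Lambda_n$, such that $\Delta_n(\lambda)$ is the largest quotient of the projective cover of $L_n(\lambda)$ all of whose composition factors are of the form $L_n(\mu)$ with $\mu\le\lambda$. Here $\mu<\lambda$ means that the least $m$ with $\mu\in\Lambda_m$ is larger than the least $m$ with $\lambda\in\Lambda_m$. 3. The algebras $d_\bullet=(d_n)_{n\ge 0}$ with the modules $\Delta_n(\lambda)$, $\lambda\in\Lambda_n$, form a $(D_\infty,0)$-tower of algebras (with $N=2$): (N1) adding a propagating line at the eastern end of diagrams defines algebra embeddings $d_n\hookrightarrow d_{n+1}$; (N2) for $\lambda\ne\mu$ in $\Lambda_n$, $\Delta_n(\lambda)\not\cong\Delta_n(\mu)$;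 (N3) $\Lambda_{n}\subseteq\Lambda_{n+2}$, and $\Lambda_n\cap\Lambda_m\neq\emptyset$ implies $n\equiv m$ mod $2$; (N4) for $n\ge1$ and $\lambda\in\Lambda_n$, the restriction of $\Delta_n(\lambda)$ to $d_{n-1}$ has a filtration with sections among the $\Delta_{n-1}(\mu)$, $\mu\in\Lambda_{n-1}$, and the multiplicities of the sections do not depend on the filtration; (N5) $\Lambda_0=\{0\}$, and $\Delta_0(0)$ is simple and one-dimensional; (N6) for $n\ge2$ there are exact functors $F_n$ from $d_n$-modules to $d_{n-2}$-modules (preserving finite generation) such that (N7) for $\lambda\in\Lambda_n$, $F_n(\Delta_n(\lambda))\cong\Delta_{n-2}(\lambda)$ if $\lambda\in\Lambda_{n-2}$, and $F_n(\Delta_n(\lambda))=0$ otherwise; (N8) for $n\ge3$ and $\lambda\in\Lambda_n$ with $F_n(\Delta_n(\lambda))\ne0$, $F_{n-1}(\mathrm{res}\,\Delta_n(\lambda))\cong \mathrm{res}\,F_n(\Delta_n(\lambda))$ as $d_{n-3}$-modules; (N9) the vertex set of $D_\infty$ is $\bigcup_n\Lambda_n$; if $\lambda\in\Lambda_n$ and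 $\lambda-\mu$ is an edge of $D_\infty$ then $\mu\in\Lambda_{n+1}$; and for all $\lambda\in\Lambda_n$, $\mu\in\Lambda_{n+1}$ the multiplicity of $\Delta_n(\lambda)$ in the restriction of $\Delta_{n+1}(\mu)$ to $d_n$ is the number of edges ($0$ or $1$) from $\lambda$ to $\mu$ in $D_\infty$. 4. The sets $D^d_v(n,v)$ form a Pascal $(D_\infty,0)$-array: $D^d_v(0,v)$ is in bijection with the set of paths of length $0$ from $0$ to $v$, and there are injective edge maps $\psi_{v,w}:D^d_v(n,v)\to D^d_w(n+1,w)$, one for each oriented edge $(v,w)$ of $D_\infty$ and each $n\geq 0$, such that $D^d_w(n+1,w)$ is the disjoint union of the images of the maps $\psi_{v,w}$. The edge maps can be taken as follows: $\psi_{i,i+1}$ adds an undecorated propagating line at the eastern end; $\psi_{i+1,i}$ bends the easternmost propagating line over onto a new northern vertex at the eastern end; $\psi_{0',1}$ adds a propagating line with a blob; $\psi_{1,0'}$ bends the propagating line over and puts one more blob on it (cancelling a blob that is already there). -/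

import Mathlib

open CategoryTheory

universe u

/-! ### Graphs, paths and Pascal arrays -/

/-- A graph with vertex set `V`: a set of (directed) edges with initial and final vertices. -/
structure DirGraph (V : Type*) where
  Edge : Type
  src : Edge → V
  tgt : Edge → V

/-- `G.Path v n w` is the set of paths of length `n` from `v` to `w` in `G`. -/
inductive DirGraph.Path {V : Type*} (G : DirGraph V) (v : V) : ℕ → V → Type _
  | nil : DirGraph.Path G v 0 v
  | snoc {n : ℕ} (e : G.Edge) (p : DirGraph.Path G v n (G.src e)) :
      DirGraph.Path G v (n + 1) (G.tgt e)

/-- The graph of an undirected simply-laced graph: every edge is present in both directions. -/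
def SimpleGraph.toDirGraph {V : Type} (G : SimpleGraph V) : DirGraph V where
  Edge := G.Dart
  src d := d.fst
  tgt d := d.snd

/-- `Y` is a Pascal `(G, v₀)`-array with edge maps `ψ`: layer `0` is in pointwise bijection with
the paths of length `0` from `v₀`, every edge map is injective, and `Y (n + 1) w` is the disjoint
union of the images of the edge maps of all edges ending at `w`. -/
structure IsPascalArray {V : Type*} (G : DirGraph V) (v₀ : V) (Y : ℕ → V → Type*)
    (ψ : ∀ (n : ℕ) (e : G.Edge), Y n (G.src e) → Y (n + 1) (G.tgt e)) : Prop where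
  layer_zero : ∀ w, Nonempty (Y 0 w ≃ G.Path v₀ 0 w)
  injective : ∀ n e, Function.Injective (ψ n e)
  /-- Disjoint union: every element of layer `n + 1` is in the image of the edge map of exactly
  one edge (which then ends at the vertex of the element). -/
  disjoint_union : ∀ n (y : Σ w, Y (n + 1) w),
    ∃! e : G.Edge, ∃ x : Y n (G.src e), (⟨G.tgt e, ψ n e x⟩ : Σ w, Y (n + 1) w) = y

/-! ### Modules with filtrations -/

/-- A filtration of `M` (from `⊥` to `⊤`) with sections in the family `S`;
the `i`-th section is isomorphic to `S (label i)`. -/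
structure DeltaFiltration {R : Type u} [Ring R] {I : Type*} (S : I → ModuleCat.{u} R)
    (M : ModuleCat.{u} R) where
  length : ℕ
  step : Fin (length + 1) → Submodule R M
  mono : Monotone step
  step_zero : step 0 = ⊥
  step_last : step (Fin.last length) = ⊤
  label : Fin length → I
  section_iso : ∀ i : Fin length,
    Nonempty ((↥(step i.succ) ⧸ (step i.castSucc).submoduleOf (step i.succ)) ≃ₗ[R] S (label i))

/-- The multiplicity of `S l` in a filtration. -/
noncomputable def DeltaFiltration.mult {R : Type u} [Ring R] {I : Type*}
    {S : I → ModuleCat.{u} R} {M : ModuleCat.{u} R} (F : DeltaFiltration S M) (l : I) : ℕ :=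
  Nat.card {i : Fin F.length // F.label i = l}

/-- `M` has a filtration with sections in `S`, and the multiplicities do not depend on it. -/
def IsDeltaGood {R : Type u} [Ring R] {I : Type*} (S : I → ModuleCat.{u} R)
    (M : ModuleCat.{u} R) : Prop :=
  Nonempty (DeltaFiltration S M) ∧ ∀ (F F' : DeltaFiltration S M) (l : I), F.mult l = F'.mult l

/-! ### Towers of algebras -/

section Tower

variable (k : Type u) [Field k] {V : Type} (A : ℕ → Type u) [∀ n, Ring (A n)]
  [∀ n, Algebra k (A n)] (ι : ∀ n, A n →ₐ[k] A (n + 1)) (Λ : ℕ → Set V)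
  (Δ : ∀ n, V → ModuleCat.{u} (A n))

/-- Restriction from `A (n + 1)` to `A n`. -/
noncomputable def towerRes (n : ℕ) : ModuleCat.{u} (A (n + 1)) ⥤ ModuleCat.{u} (A n) :=
  ModuleCat.restrictScalars (ι n).toRingHom

/-- Exactness of a functor between module categories. The functor is also required to preserve
finite generation, so that it restricts to an exact functor between the categories of finitely
generated modules. -/
structure IsExactFunctor {R S : Type u} [Ring R] [Ring S]
    (F : ModuleCat.{u} R ⥤ ModuleCat.{u} S) : Prop where
  additive : F.Additive
  left_exact : Limits.PreservesFiniteLimits F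
  right_exact : Limits.PreservesFiniteColimits F
  finite : ∀ M : ModuleCat.{u} R, Module.Finite R M → Module.Finite S (F.obj M)

/-- The algebras `A n` over `k`, with the maps `ι n : A n → A (n + 1)`, the index sets
`Λ n` and the `A n`-modules `Δ n l` for `l ∈ Λ n`, form a `(G, v₀)`-tower of algebras with
period `N`. -/
structure IsGraphTower (N : ℕ) (G : DirGraph V) (v₀ : V) : Prop where
  /-- the maps `ι n` are embeddings of algebras -/
  embedding : ∀ n, Function.Injective (ι n)
  /-- the modules of one layer are pairwise non-isomorphic -/
  not_iso : ∀ n, ∀ l ∈ Λ n, ∀ m ∈ Λ n, l ≠ m → IsEmpty (Δ n l ≅ Δ n m)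
  /-- the index sets increase with step `N` -/
  index_subset : ∀ n, Λ n ⊆ Λ (N + n)
  index_mod : ∀ n m, (Λ n ∩ Λ m).Nonempty → n ≡ m [MOD N]
  /-- restrictions of the modules are good -/
  res_good : ∀ n, ∀ l ∈ Λ (n + 1),
    IsDeltaGood (fun m : Λ n => Δ n m) ((towerRes k A ι n).obj (Δ (n + 1) l))
  /-- layer `0` has one index, and its module is simple and one-dimensional -/
  index_zero : Λ 0 = {v₀}
  simple_zero : IsSimpleModule (A 0) (Δ 0 v₀)
  finrank_zero :
    Module.finrank k ((ModuleCat.restrictScalars (algebraMap k (A 0))).obj (Δ 0 v₀)) = 1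
  /-- there are exact functors `F n` from `A (N + n)`-modules to `A n`-modules, which send the
  given modules to the given modules or to zero, and which commute with restriction on them -/
  functors : ∃ F : ∀ n, ModuleCat.{u} (A (N + n)) ⥤ ModuleCat.{u} (A n),
    (∀ n, IsExactFunctor (F n)) ∧
    (∀ n, ∀ l ∈ Λ (N + n), l ∈ Λ n → Nonempty ((F n).obj (Δ (N + n) l) ≅ Δ n l)) ∧
    (∀ n, ∀ l ∈ Λ (N + n), l ∉ Λ n → Limits.IsZero ((F n).obj (Δ (N + n) l))) ∧
    (∀ n, ∀ l ∈ Λ (N + (n + 1)), ¬ Limits.IsZero ((F (n + 1)).obj (Δ (N + (n + 1)) l)) →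
      Nonempty ((F n).obj ((towerRes k A ι (N + n)).obj (Δ (N + (n + 1)) l)) ≅
        (towerRes k A ι n).obj ((F (n + 1)).obj (Δ (N + (n + 1)) l))))
  /-- the vertices of `G` are the indices -/
  vertices : ∀ v : V, ∃ n, v ∈ Λ n
  /-- the edges from `l` to `m` in `G` correspond, for every `n` with `l ∈ Λ n`, to the arrows from
  `Δ n l` to `Δ (n + 1) m` in the Bratteli diagram, whose number is the multiplicity of `Δ n l`
  in the restriction of `Δ (n + 1) m` -/
  edge_index : ∀ n (e : G.Edge), G.src e ∈ Λ n → G.tgt e ∈ Λ (n + 1)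
  edge_mult : ∀ n (l : Λ n), ∀ m ∈ Λ (n + 1),
    ∀ Φ : DeltaFiltration (fun m : Λ n => Δ n m) ((towerRes k A ι n).obj (Δ (n + 1) m)),
      (Φ.mult l : ℕ∞) = ENat.card {e : G.Edge // G.src e = l ∧ G.tgt e = m}

end Tower

/-! ### Standard modules -/

/-- Every composition factor of `M` is isomorphic to `L j` for some `j` with `P j`. -/
def FactorsIn {R : Type u} [Ring R] {I : Type*} (L : I → ModuleCat.{u} R) (P : I → Prop)
    (M : ModuleCat.{u} R) : Prop :=
  ∀ N₁ N₂ : Submodule R M, N₁ ≤ N₂ → IsSimpleModule R (↥N₂ ⧸ N₁.submoduleOf N₂) →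
    ∃ j, P j ∧ Nonempty ((↥N₂ ⧸ N₁.submoduleOf N₂) ≃ₗ[R] L j)

/-- The modules `Δ i` are the standard modules of `R` for the partial order `le` on the index set
`I`: the simple `R`-modules are, up to isomorphism and without repetition, modules `L i`, `i ∈ I`,
and `Δ i` is the largest quotient of the projective cover `P` of `L i` all of whose composition
factors are of the form `L j` with `j ≤ i`. -/
def IsStandardFamily (R : Type u) [Ring R] {I : Type*} (le : I → I → Prop)
    (Δ : I → ModuleCat.{u} R) : Prop :=
  ∃ L : I → ModuleCat.{u} R,
    (∀ i, IsSimpleModule R (L i)) ∧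
    (∀ i j, i ≠ j → IsEmpty (L i ≃ₗ[R] L j)) ∧
    (∀ M : ModuleCat.{u} R, IsSimpleModule R M → ∃ i, Nonempty (M ≃ₗ[R] L i)) ∧
    ∀ i, ∃ (P : ModuleCat.{u} R) (q : P →ₗ[R] L i) (K : Submodule R P),
      Module.Projective R P ∧ Module.Finite R P ∧ Function.Surjective q ∧
      (∀ N : Submodule R P, N ⊔ LinearMap.ker q = ⊤ → N = ⊤) ∧
      IsLeast {K' : Submodule R P |
        FactorsIn L (fun j => le j i) (ModuleCat.of R (P ⧸ K'))} K ∧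
      Nonempty ((P ⧸ K) ≃ₗ[R] Δ i)

/-! ### The graph `D_∞` -/

/-- The vertices `0', 0, 1, 2, …` of `D_∞`. -/
inductive DVertex : Type
  | prime : DVertex
  | nat (l : ℕ) : DVertex

/-- `D_∞`: the edges are `i — (i+1)` and `0' — 1`. -/
def DInfinity : SimpleGraph DVertex :=
  SimpleGraph.fromRel fun a b =>
    (∃ i : ℕ, a = .nat i ∧ b = .nat (i + 1)) ∨ (a = .prime ∧ b = .nat 1)

/-- The number of propagating lines belonging to a vertex of `D_∞`. -/
def DVertex.lines : DVertex → ℕ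
  | .prime => 0
  | .nat l => l

/-- The index set of layer `n`: `{n, n-2, …, 1}` for odd `n`, `{n, n-2, …, 2, 0, 0'}` for even
`n > 0`, and `{0}` for `n = 0`. -/
def DVertex.layer (n : ℕ) : Set DVertex :=
  {v | match v with
    | .prime => Even n ∧ 2 ≤ n
    | .nat l => l ≤ n ∧ l ≡ n [MOD 2]}

/-- The first layer in which a vertex occurs. -/
def DVertex.level : DVertex → ℕ
  | .prime => 2
  | .nat l => l

/-- The partial order on indices: a vertex that first occurs in a later layer is smaller. -/
def DVertex.StdLe (a b : DVertex) : Prop := a = b ∨ b.level < a.level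

/-! ### Diagrams -/

/-- Underlying data of a decorated diagram with `n` north vertices `Sum.inl i` and `m` south
vertices `Sum.inr j`, both numbered from west to east: `mate x` is the other end of the arc at `x`,
and `blob x` says whether that arc carries a blob. -/
@[ext]
structure RawDiagram (n m : ℕ) where
  mate : Fin n ⊕ Fin m → Fin n ⊕ Fin m
  blob : Fin n ⊕ Fin m → Bool

namespace RawDiagram

/-- Position of a boundary vertex, reading clockwise from the western edge of the rectangle:
the northern vertices from west to east, then the southern ones from east to west. -/
def pos {n m : ℕ} : Fin n ⊕ Fin m → ℕ
  | .inl i => i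
  | .inr j => n + (Fin.rev j : ℕ)

/-- Number of arcs with a blob (every arc is counted at its first end). -/
noncomputable def numBlobs {n m : ℕ} (D : RawDiagram n m) : ℕ :=
  Nat.card {x : Fin n ⊕ Fin m // D.blob x = true ∧ pos x < pos (D.mate x)}

/-- `D` is a Temperley-Lieb diagram (non-crossing pair partition) in which some arcs
exposed to the western edge carry a blob. An arc is exposed to the west exactly if it is not
nested, in the reading order from the west, inside another arc. -/
structure IsDiagram {n m : ℕ} (D : RawDiagram n m) : Prop where
  mate_mate : ∀ x, D.mate (D.mate x) = x
  mate_ne : ∀ x, D.mate x ≠ x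
  noncrossing : ∀ x y,
    ¬ (pos x < pos y ∧ pos y < pos (D.mate x) ∧ pos (D.mate x) < pos (D.mate y))
  blob_mate : ∀ x, D.blob (D.mate x) = D.blob x
  exposed : ∀ x, D.blob x = true → ∀ y, ¬ (pos y < pos x ∧ pos x < pos (D.mate y))

/-- All southern vertices are on propagating lines. -/
def AllPropagating {n m : ℕ} (D : RawDiagram n m) : Prop :=
  ∀ j : Fin m, ∃ i : Fin n, D.mate (.inr j) = .inl i

/-- The diagram with `n` undecorated vertical lines. -/
def idDiagram (n : ℕ) : RawDiagram n n where
  mate := Sum.swap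
  blob _ := false

/-- Adding a propagating line at the eastern end, with a blob if `b = true`. -/
def addLine {n m : ℕ} (b : Bool) (D : RawDiagram n m) : RawDiagram (n + 1) (m + 1) where
  mate x := match x with
    | .inl i => Fin.lastCases (motive := fun _ => Fin (n + 1) ⊕ Fin (m + 1))
        (.inr (Fin.last m)) (fun i => (D.mate (.inl i)).map Fin.castSucc Fin.castSucc) i
    | .inr j => Fin.lastCases (motive := fun _ => Fin (n + 1) ⊕ Fin (m + 1))
        (.inl (Fin.last n)) (fun j => (D.mate (.inr j)).map Fin.castSucc Fin.castSucc) j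
  blob x := match x with
    | .inl i => Fin.lastCases (motive := fun _ => Bool) b (fun i => D.blob (.inl i)) i
    | .inr j => Fin.lastCases (motive := fun _ => Bool) b (fun j => D.blob (.inr j)) j

/-- The easternmost southern vertex is moved to the eastern end of the northern edge. -/
def bendPt {n m : ℕ} : Fin n ⊕ Fin (m + 1) → Fin (n + 1) ⊕ Fin m
  | .inl i => .inl i.castSucc
  | .inr j => Fin.lastCases (motive := fun _ => Fin (n + 1) ⊕ Fin m)
      (.inl (Fin.last n)) (fun j => .inr j) j

/-- The inverse of `bendPt`. -/
def unbendPt {n m : ℕ} : Fin (n + 1) ⊕ Fin m → Fin n ⊕ Fin (m + 1)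
  | .inl i => Fin.lastCases (motive := fun _ => Fin n ⊕ Fin (m + 1))
      (.inr (Fin.last m)) (fun i => .inl i) i
  | .inr j => .inr j.castSucc

/-- Bending over the arc at the easternmost southern vertex onto a new northern
vertex. If `b = true`, one more blob is put on this arc (and two blobs cancel). -/
def bend {n m : ℕ} (b : Bool) (D : RawDiagram n (m + 1)) : RawDiagram (n + 1) m where
  mate x := bendPt (D.mate (unbendPt x))
  blob x := xor (D.blob (unbendPt x))
    (b && decide (unbendPt x = .inr (Fin.last m) ∨ D.mate (unbendPt x) = .inr (Fin.last m)))

/-! #### Concatenation -/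

section Concat

variable {n m p : ℕ} (D : RawDiagram n m) (E : RawDiagram m p)

/-- Vertices of the first diagram among the vertices (north, middle, south) of the
concatenated picture. -/
def fstPt : Fin n ⊕ Fin m → Fin n ⊕ (Fin m ⊕ Fin p) := Sum.map id Sum.inl

/-- Vertices of the second diagram among the vertices of the concatenated picture. -/
def sndPt : Fin m ⊕ Fin p → Fin n ⊕ (Fin m ⊕ Fin p) := Sum.inr

/-- Northern and southern vertices of the concatenated picture. -/
def outerPt : Fin n ⊕ Fin p → Fin n ⊕ (Fin m ⊕ Fin p) := Sum.map id Sum.inr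

/-- Two vertices of the concatenated picture are the ends of an arc of one of the diagrams. -/
def Linked (x y : Fin n ⊕ (Fin m ⊕ Fin p)) : Prop :=
  (∃ a, x = fstPt a ∧ y = fstPt (D.mate a)) ∨ (∃ b, x = sndPt b ∧ y = sndPt (E.mate b))

/-- The connected components (arcs and loops) of the concatenated picture. -/
def Component : Type := Quot (Linked D E)

/-- The component of a vertex. -/
def comp (x : Fin n ⊕ (Fin m ⊕ Fin p)) : Component D E := Quot.mk _ x

/-- The number of blobs on a component. -/
noncomputable def blobsOn (c : Component D E) : ℕ :=
  Nat.card {a : Fin n ⊕ Fin m //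
    D.blob a = true ∧ pos a < pos (D.mate a) ∧ comp D E (fstPt a) = c} +
  Nat.card {b : Fin m ⊕ Fin p //
    E.blob b = true ∧ pos b < pos (E.mate b) ∧ comp D E (sndPt b) = c}

/-- A loop is a component without northern or southern vertices. -/
def IsLoop (c : Component D E) : Prop := ∀ x : Fin n ⊕ Fin p, comp D E (outerPt x) ≠ c

/-- The number of loops formed by concatenation. -/
noncomputable def numLoops : ℕ := Nat.card {c : Component D E // IsLoop D E c}

/-- Some loop carries an odd number of blobs. -/
def HasOddLoop : Prop := ∃ c : Component D E, IsLoop D E c ∧ Odd (blobsOn D E c)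

open Classical in
/-- Concatenation, with the southern edge of `D` on the northern edge of `E`, after removal of
all loops and of all pairs of blobs on the same arc. -/
noncomputable def concat : RawDiagram n p where
  mate x :=
    if h : ∃ y, y ≠ x ∧ comp D E (outerPt y) = comp D E (outerPt x) then h.choose else x
  blob x := decide (Odd (blobsOn D E (comp D E (outerPt x))))

end Concat

end RawDiagram

open RawDiagram

/-- The diagrams with `n` northern and `n` southern vertices and an even number of blobs. -/
def DDiagram (n : ℕ) : Type :=
  {D : RawDiagram n n // D.IsDiagram ∧ Even D.numBlobs}

/-- The half diagrams on `n` vertices belonging to the vertex `v` of `D_∞`: all lines to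
the south propagate, and the number of blobs is even, except for `v = 0'`, where it is odd. -/
def HalfDiagram (n : ℕ) (v : DVertex) : Type :=
  {h : RawDiagram n v.lines // h.IsDiagram ∧ h.AllPropagating ∧ (Even h.numBlobs ↔ v ≠ .prime)}

/-! ### The algebra `d_n` and its diagram modules -/

section Algebra

variable (k : Type u) [Field k] (δ : k)

/-- The multiplication rules of diagrams: concatenation with loops replaced by `δ`,
or by `0` if they carry an odd number of blobs; vertical lines form the identity. -/
inductive DRel (n : ℕ) : FreeAlgebra k (DDiagram n) → FreeAlgebra k (DDiagram n) → Prop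
  | one (D : DDiagram n) (h : D.1 = idDiagram n) : DRel n (FreeAlgebra.ι k D) 1
  | mul (D E C : DDiagram n) (h : ¬ HasOddLoop D.1 E.1) (hC : C.1 = concat D.1 E.1) :
      DRel n (FreeAlgebra.ι k D * FreeAlgebra.ι k E)
        (δ ^ numLoops D.1 E.1 • FreeAlgebra.ι k C)
  | mul_zero (D E : DDiagram n) (h : HasOddLoop D.1 E.1) :
      DRel n (FreeAlgebra.ι k D * FreeAlgebra.ι k E) 0

/-- The algebra `d_n`: the `k`-algebra generated by the diagrams with the above multiplication
table. -/
def DAlg (n : ℕ) : Type u := RingQuot (DRel k δ n)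

noncomputable instance (n : ℕ) : Ring (DAlg k δ n) :=
  inferInstanceAs (Ring (RingQuot (DRel k δ n)))

noncomputable instance (n : ℕ) : Algebra k (DAlg k δ n) :=
  inferInstanceAs (Algebra k (RingQuot (DRel k δ n)))

/-- A diagram as an element of `d_n`. -/
noncomputable def DAlg.diag {n : ℕ} (D : DDiagram n) : DAlg k δ n :=
  RingQuot.mkAlgHom k (DRel k δ n) (FreeAlgebra.ι k D)

/-- The rules for the action of diagrams on half diagrams: concatenation, with loops
removed as in `d_n`, modulo diagrams with fewer propagating lines. -/
def stdRel (n : ℕ) (v : DVertex) : Set (HalfDiagram n v →₀ DAlg k δ n) :=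
  {z | ∃ (D : DDiagram n) (h h' : HalfDiagram n v),
      ¬ HasOddLoop D.1 h.1 ∧ h'.1 = concat D.1 h.1 ∧
      z = Finsupp.single h (DAlg.diag k δ D) - δ ^ numLoops D.1 h.1 • Finsupp.single h' 1} ∪
  {z | ∃ (D : DDiagram n) (h : HalfDiagram n v),
      (HasOddLoop D.1 h.1 ∨ ¬ (concat D.1 h.1).AllPropagating) ∧
      z = Finsupp.single h (DAlg.diag k δ D)}

/-- The module `Δ_n(v)`: the `d_n`-module generated by the half diagrams with the above
action. -/
abbrev StdCarrier (n : ℕ) (v : DVertex) : Type u :=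
  (HalfDiagram n v →₀ DAlg k δ n) ⧸ Submodule.span (DAlg k δ n) (stdRel k δ n v)

/-- A half diagram as an element of `Δ_n(v)`. -/
noncomputable def StdCarrier.half {n : ℕ} {v : DVertex} (h : HalfDiagram n v) :
    StdCarrier k δ n v :=
  Submodule.Quotient.mk (Finsupp.single h 1)

/-- `Δ_n(v)` as an object of the category of `d_n`-modules. -/
noncomputable def stdModule (n : ℕ) (v : DVertex) : ModuleCat.{u} (DAlg k δ n) :=
  ModuleCat.of (DAlg k δ n) (StdCarrier k δ n v)

end Algebra

/-! Diagrams are studied through colourings. Colour the boundary vertices by `ZMod 2` so that the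
colour changes along an arc exactly if the arc carries a blob, and let `mat D` be the 0/1 matrix
recording which northern and southern colour sequences fit together. An entry of a product of two
such matrices counts the admissible colourings of the middle vertices: every loop with an even
number of blobs doubles this count, and a loop with an odd number of blobs admits no colouring at
all (`mat_mul`, `mat_mul_of_odd`). So the matrices realise the diagram calculus with 2 in place of
`δ`. Nothing is lost, because `2 ^ r • D.mat` determines both `r` and `D` (`smul_mat_injective`). An
identity between matrices therefore gives the resulting diagram together with the number of loops,
and hence an identity in `d_n` for every `δ` (`concat_of_mat_mul`, `diag_mul_of_mat`).
Associativity, idempotents, Temperley–Lieb relations and the compatibility of products with adding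
and bending lines are all checked on matrices. Only planarity of a product needs a different
argument, a Jordan curve argument modulo 2 (`concat_isDiagram`).

By associativity, `d_n` acts on the space with basis the diagrams, and applying an element to the
identity diagram shows that the presented algebra has not collapsed. The same is done for the
modules of half diagrams.

For the standard modules the vertices are ranked 0, 0', 1, 2, …. For `v` in the layer there is a
half diagram `a` whose reflection composed with `a` is the identity up to `r` loops. As `δ ≠ 0`, the
element `δ⁻ʳ a a*` is an idempotent `e_v`. A product `a* h` with a half diagram `h` is a diagram
between the lines of the two vertices; planarity and the parity of blobs leave very few
possibilities. It follows that `e_v` kills `Δ(w)` for `w` of larger rank, that `e_v Δ(v)` is the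
line spanned by `a`, that `a` generates `Δ(v)`, and that an element killing `a` falls, after
multiplication by `e_v`, into the left ideal belonging to smaller ranks. These facts (`IsCoreData`)
already yield simple heads, projective covers and maximality. The required order is coarser than the
rank in one respect: 0' and 2 are incomparable. That `L(2)` does not occur in `Δ(0')` is a separate
computation (`exists_separating`).

For the tower, half diagrams are sorted by what happens at the last northern vertex. This is the
Pascal array, and the pieces, taken in the right order, filter the restriction with one section per
edge. Multiplicities are well defined because the exact functors `M ↦ e_v M` have unitriangular
dimensions on the modules `Δ`. The functors from `d_{n+2}` to `d_n` are `M ↦ e M` with `e` the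
normalised cup and cap at the eastern end; they commute with restriction because neighbouring
idempotents of this kind are linked by the zigzag relations. -/

namespace RawDiagram

/-! ### Perfect matchings, colourings, and blobs counted modulo 2 -/

/-- The planarity-free part of `IsDiagram`: `D` is a perfect matching with decorated arcs. -/
structure IsPairing {n m : ℕ} (D : RawDiagram n m) : Prop where
  mate_mate : ∀ x, D.mate (D.mate x) = x
  mate_ne : ∀ x, D.mate x ≠ x
  blob_mate : ∀ x, D.blob (D.mate x) = D.blob x

theorem IsDiagram.isPairing {n m : ℕ} {D : RawDiagram n m} (h : D.IsDiagram) : D.IsPairing :=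
  ⟨h.mate_mate, h.mate_ne, h.blob_mate⟩

theorem pos_injective {n m : ℕ} : Function.Injective (pos : Fin n ⊕ Fin m → ℕ) := by
  rintro (i | i) (j | j) h <;> simp only [pos, Fin.val_rev] at h
  · exact congrArg _ (Fin.ext h)
  · omega
  · omega
  · exact congrArg _ (Fin.ext (by omega))

/-- The number of blobs on an arc, modulo `2`. -/
def bit (b : Bool) : ZMod 2 := if b then 1 else 0

@[simp] theorem bit_false : bit false = 0 := rfl

@[simp] theorem bit_true : bit true = 1 := rfl

theorem bit_injective : Function.Injective bit := by
  intro a b h; revert h; cases a <;> cases b <;> simp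

theorem bit_xor (a b : Bool) : bit (xor a b) = bit a + bit b := by
  cases a <;> cases b <;> simp; decide

theorem zmod_two_add_self (a : ZMod 2) : a + a = 0 := CharTwo.add_self_eq_zero a

theorem zmod_two_eq_of_add {a b : ZMod 2} (h : a + b = 0) : a = b :=
  (CharTwo.add_eq_zero).1 h

theorem bit_decide_odd (n : ℕ) : bit (decide (Odd n)) = (n : ZMod 2) := by
  by_cases h : Odd n
  · simp [h, ZMod.natCast_eq_one_iff_odd.2 h]
  · simp [h, ZMod.natCast_eq_zero_iff_even.2 (Nat.not_odd_iff_even.1 h)]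

section Pairing

variable {n m p : ℕ} {D : RawDiagram n m}

theorem IsPairing.mate_injective (hD : D.IsPairing) : Function.Injective D.mate :=
  Function.LeftInverse.injective hD.mate_mate

theorem IsPairing.pos_mate_ne (hD : D.IsPairing) (x) : pos (D.mate x) ≠ pos x :=
  fun h => hD.mate_ne x (pos_injective h)

/-- The involution of a pairing, as a permutation. -/
def IsPairing.perm (hD : D.IsPairing) : Equiv.Perm (Fin n ⊕ Fin m) :=
  ⟨D.mate, D.mate, hD.mate_mate, hD.mate_mate⟩

/-- A sum over vertices is a sum over arcs. -/
theorem IsPairing.sum_eq {M : Type*} [AddCommMonoid M] (hD : D.IsPairing)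
    (f : Fin n ⊕ Fin m → M) :
    ∑ x, f x = ∑ x, if pos x < pos (D.mate x) then f x + f (D.mate x) else 0 := by
  classical
  have h1 : ∑ x, f x = ∑ x, (if pos x < pos (D.mate x) then f x else 0) +
      ∑ x, (if pos x < pos (D.mate x) then 0 else f x) := by
    rw [← Finset.sum_add_distrib]
    refine Finset.sum_congr rfl fun x _ => ?_
    split_ifs <;> simp
  rw [h1, ← Equiv.sum_comp hD.perm fun x => if pos x < pos (D.mate x) then 0 else f x,
    ← Finset.sum_add_distrib]
  refine Finset.sum_congr rfl fun x _ => ?_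
  have := hD.pos_mate_ne x
  simp only [IsPairing.perm, Equiv.coe_fn_mk, hD.mate_mate]
  by_cases h : pos x < pos (D.mate x)
  · rw [if_pos h, if_neg (by omega), if_pos h]
  · rw [if_neg h, if_pos (by omega), if_neg h, add_zero]

/-- A colouring changes along an arc exactly if the arc has a blob. -/
def IsColoring (D : RawDiagram n m) (c : Fin n ⊕ Fin m → ZMod 2) : Prop :=
  ∀ x, c (D.mate x) = c x + bit (D.blob x)

theorem natCast_card_subtype {α R : Type*} [Fintype α] [NonAssocSemiring R] (P : α → Prop)
    [DecidablePred P] : (Nat.card {a // P a} : R) = ∑ a, if P a then 1 else 0 := by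
  rw [Nat.card_eq_fintype_card, Fintype.card_subtype, Finset.natCast_card_filter]

/-- The two ends of an arc contribute `c x + c (D.mate x)`, and modulo 2 this is the blob of the
arc. So summing colours over a union of arcs counts its blobs. -/
theorem IsPairing.card_blobs (hD : D.IsPairing) {c : Fin n ⊕ Fin m → ZMod 2}
    (hc : D.IsColoring c) (Q : Fin n ⊕ Fin m → Prop) [DecidablePred Q]
    (hQ : ∀ x, Q (D.mate x) ↔ Q x) :
    (Nat.card {x // D.blob x = true ∧ pos x < pos (D.mate x) ∧ Q x} : ZMod 2) =
      ∑ x, if Q x then c x else 0 := by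
  classical
  rw [natCast_card_subtype, hD.sum_eq fun x => if Q x then c x else 0]
  refine Finset.sum_congr rfl fun x _ => ?_
  by_cases h : pos x < pos (D.mate x)
  · by_cases h' : Q x
    · have := hc x
      simp only [h, h', hQ, this, and_true, if_true, ← add_assoc, zmod_two_add_self, zero_add]
      cases D.blob x <;> simp
    · simp [h', hQ]
  · simp [h]

/-- Parity of blobs becomes a sum of colours of any one colouring; the parity statements for
products, added lines, bends and reflections all go through this. -/
theorem IsPairing.numBlobs_eq (hD : D.IsPairing) {c : Fin n ⊕ Fin m → ZMod 2}
    (hc : D.IsColoring c) : (D.numBlobs : ZMod 2) = ∑ x, c x := by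
  have := hD.card_blobs hc (fun _ => True) (fun _ => Iff.rfl)
  simpa [numBlobs] using this

theorem IsPairing.even_card (hD : D.IsPairing) (Q : Fin n ⊕ Fin m → Prop) [DecidablePred Q]
    (hQ : ∀ x, Q (D.mate x) ↔ Q x) : (∑ x, if Q x then (1 : ZMod 2) else 0) = 0 := by
  rw [hD.sum_eq]
  refine Finset.sum_eq_zero fun x _ => ?_
  by_cases h' : Q x <;> simp [hQ, h', zmod_two_add_self]

end Pairing

/-! ### Components of a concatenated picture -/

section Comp

variable {n m p : ℕ} {D : RawDiagram n m} {E : RawDiagram m p}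

theorem comp_fst (a) : comp D E (fstPt (D.mate a)) = comp D E (fstPt a) :=
  (Quot.sound (r := Linked D E) (Or.inl ⟨a, rfl, rfl⟩)).symm

theorem comp_snd (b) : comp D E (sndPt (E.mate b)) = comp D E (sndPt b) :=
  (Quot.sound (r := Linked D E) (Or.inr ⟨b, rfl, rfl⟩)).symm

theorem comp_surjective : Function.Surjective (comp D E) := fun c => Quot.exists_rep c

/-- Functions which are constant along arcs are functions on components. -/
theorem eq_of_comp_eq {X : Sort*} (g : Fin n ⊕ (Fin m ⊕ Fin p) → X)
    (h1 : ∀ a, g (fstPt (D.mate a)) = g (fstPt a))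
    (h2 : ∀ b, g (sndPt (E.mate b)) = g (sndPt b)) {x y} (h : comp D E x = comp D E y) :
    g x = g y := by
  have : ∀ x y, Linked D E x y → g x = g y := by
    rintro x y (⟨a, rfl, rfl⟩ | ⟨b, rfl, rfl⟩)
    · exact (h1 a).symm
    · exact (h2 b).symm
  exact congrArg (Quot.lift g this) h

/-- Every middle vertex belongs to both diagrams, so it is counted twice and cancels modulo 2. -/
theorem sum_fst_add_sum_snd (F : Fin n ⊕ (Fin m ⊕ Fin p) → ZMod 2) :
    ∑ a, F (fstPt a) + ∑ b, F (sndPt b) = ∑ x, F (outerPt x) := by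
  simp only [Fintype.sum_sum_type, fstPt, sndPt, outerPt, Sum.map_inl, Sum.map_inr, id]
  have := zmod_two_add_self (∑ x, F (Sum.inr (Sum.inl x)))
  linear_combination this

open Classical in
/-- The colours of the ends of an arc differ by the number of blobs. -/
theorem blobsOn_eq (hD : D.IsPairing) (hE : E.IsPairing) {F : Fin n ⊕ (Fin m ⊕ Fin p) → ZMod 2}
    (h1 : D.IsColoring (F ∘ fstPt)) (h2 : E.IsColoring (F ∘ sndPt)) (K : Component D E) :
    (blobsOn D E K : ZMod 2) = ∑ x, if comp D E (outerPt x) = K then F (outerPt x) else 0 := by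
  have e1 := hD.card_blobs h1 (fun a => comp D E (fstPt a) = K) (fun a => by rw [comp_fst])
  have e2 := hE.card_blobs h2 (fun a => comp D E (sndPt a) = K) (fun a => by rw [comp_snd])
  rw [blobsOn, Nat.cast_add, e1, e2]
  exact sum_fst_add_sum_snd fun z => if comp D E z = K then F z else 0

-- The vertices of a component within each diagram form a union of arcs, hence are even in number,
-- and the middle ones cancel between the two diagrams.
open Classical in
theorem even_outer (hD : D.IsPairing) (hE : E.IsPairing) (K : Component D E) :
    (∑ x, if comp D E (outerPt x) = K then (1 : ZMod 2) else 0) = 0 := by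
  have e1 := hD.even_card (fun a => comp D E (fstPt a) = K) (fun a => by rw [comp_fst])
  have e2 := hE.even_card (fun a => comp D E (sndPt a) = K) (fun a => by rw [comp_snd])
  rw [← sum_fst_add_sum_snd fun z => if comp D E z = K then (1 : ZMod 2) else 0]
  rw [e1, e2, add_zero]

end Comp

end RawDiagram

/-! ### Dihedral orbits: a component that is not a loop has exactly two ends -/

theorem eq_of_dvd_two_mul {L i j : ℤ} (hi : ¬ L ∣ i) (hj : ¬ L ∣ j)
    (h1 : L ∣ 2 * i ∨ L ∣ 2 * i + 1) (h2 : L ∣ 2 * j ∨ L ∣ 2 * j + 1) : L ∣ i - j := by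
  -- A divisor of an odd number is odd, so it can be cancelled against 2. This rules out the mixed
  -- cases; in the case of two even multiples both `i` and `j` are odd multiples of `L / 2`.
  have odd : ∀ {a : ℤ}, L ∣ 2 * a + 1 → ∀ {b : ℤ}, L ∣ 2 * b → L ∣ b := fun {a} ha {b} hb => by
    have : L ∣ (2 * a + 1) * b - a * (2 * b) :=
      dvd_sub (ha.mul_right b) (hb.mul_left a)
    ring_nf at this; exact this
  rcases h1 with h1 | h1 <;> rcases h2 with h2 | h2
  · obtain ⟨a, ha⟩ := h1
    obtain ⟨b, hb⟩ := h2
    have ha' : Odd a := by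
      by_contra h
      obtain ⟨r, rfl⟩ := Int.not_odd_iff_even.1 h
      exact hi ⟨r, by linarith⟩
    have hb' : Odd b := by
      by_contra h
      obtain ⟨r, rfl⟩ := Int.not_odd_iff_even.1 h
      exact hj ⟨r, by linarith⟩
    obtain ⟨r, rfl⟩ := ha'
    obtain ⟨s, rfl⟩ := hb'
    exact ⟨r - s, by linarith⟩
  · exact absurd (odd h2 h1) hi
  · exact absurd (odd h1 h2) hj
  · refine odd h1 (?_ : L ∣ 2 * (i - j))
    have := dvd_sub h1 h2
    ring_nf at this ⊢; exact this

/-- For two involutions `α`, `β` and a fixed point `x` of `β`, the set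
`{(β α)ⁱ x}` is closed under both and contains at most one further fixed point. -/
theorem dihedral_orbit {Z : Type*} {α β : Equiv.Perm Z} (hα : α * α = 1) (hβ : β * β = 1) {x : Z}
    (hx : β x = x) :
    (∀ z, (∃ i : ℤ, z = ((β * α) ^ i) x) ↔ ∃ i : ℤ, α z = ((β * α) ^ i) x) ∧
    (∀ z, (∃ i : ℤ, z = ((β * α) ^ i) x) ↔ ∃ i : ℤ, β z = ((β * α) ^ i) x) ∧
    ∀ y w, (∃ i : ℤ, y = ((β * α) ^ i) x) → (∃ i : ℤ, w = ((β * α) ^ i) x) → y ≠ x → w ≠ x →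
      (α y = y ∨ β y = y) → (α w = w ∨ β w = w) → y = w := by
  have hα' : α⁻¹ = α := inv_eq_of_mul_eq_one_left hα
  have hβ' : β⁻¹ = β := inv_eq_of_mul_eq_one_left hβ
  set τ := β * α with hτ
  -- In the dihedral group generated by two reflections, a reflection inverts the rotation `τ = β
  -- α`.
  have cβ : ∀ i : ℤ, β * τ ^ i = τ ^ (-i) * β := by
    intro i
    have : β * τ * β⁻¹ = τ⁻¹ := by
      rw [hτ, mul_inv_rev, hα', ← mul_assoc, hβ, one_mul, hβ']
    have h2 : β * τ ^ i * β⁻¹ = τ ^ (-i) := by rw [← conj_zpow, this, inv_zpow, zpow_neg]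
    rw [← h2, inv_mul_cancel_right]
  have bx : ∀ i : ℤ, β ((τ ^ i) x) = (τ ^ (-i)) x := fun i => by
    rw [← Equiv.Perm.mul_apply, cβ, Equiv.Perm.mul_apply, hx]
  have ax : ∀ i : ℤ, α ((τ ^ i) x) = (τ ^ (-i - 1)) x := fun i => by
    have e : α = β * τ := by rw [hτ, ← mul_assoc, hβ, one_mul]
    rw [e, Equiv.Perm.mul_apply, ← Equiv.Perm.mul_apply τ, ← zpow_one_add, bx]
    congr 2; ring
  have aa : ∀ z, α (α z) = z := fun z => by rw [← Equiv.Perm.mul_apply, hα]; rfl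
  have bb : ∀ z, β (β z) = z := fun z => by rw [← Equiv.Perm.mul_apply, hβ]; rfl
  refine ⟨fun z => ⟨?_, ?_⟩, fun z => ⟨?_, ?_⟩, ?_⟩
  · rintro ⟨i, rfl⟩; exact ⟨_, ax i⟩
  · rintro ⟨i, h⟩; exact ⟨_, by rw [← aa z, h]; exact ax i⟩
  · rintro ⟨i, rfl⟩; exact ⟨_, bx i⟩
  · rintro ⟨i, h⟩; exact ⟨_, by rw [← bb z, h]; exact bx i⟩
  · rintro _ _ ⟨i, rfl⟩ ⟨j, rfl⟩ hi hj h1 h2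
    have key : ∀ i : ℤ, (τ ^ i) x = x ↔ (Function.minimalPeriod (τ • ·) x : ℤ) ∣ i := fun i =>
      MulAction.zpow_smul_eq_iff_minimalPeriod_dvd (a := τ) (b := x)
    have eq : ∀ i j : ℤ, (τ ^ i) x = (τ ^ j) x ↔ (τ ^ (i - j)) x = x := fun i j => by
      rw [sub_eq_neg_add, zpow_add, Equiv.Perm.mul_apply, zpow_neg, Equiv.Perm.inv_eq_iff_eq]
    -- `β` sends `τⁱ x` to `τ⁻ⁱ x` and `α` sends it to `τ⁻ⁱ⁻¹ x`. A fixed point therefore makes the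
    -- period of `x` divide `2i` or `2i + 1`.
    have d : ∀ i : ℤ, (α ((τ ^ i) x) = (τ ^ i) x ∨ β ((τ ^ i) x) = (τ ^ i) x) →
        (Function.minimalPeriod (τ • ·) x : ℤ) ∣ 2 * i ∨
        (Function.minimalPeriod (τ • ·) x : ℤ) ∣ 2 * i + 1 := by
      rintro i (h | h)
      · rw [ax, eq, key, ← dvd_neg] at h; right; ring_nf at h ⊢; exact h
      · rw [bx, eq, key, ← dvd_neg] at h; left; ring_nf at h ⊢; exact h
    rw [Ne, key] at hi hj
    rw [eq, key]
    exact eq_of_dvd_two_mul hi hj (d i h1) (d j h2)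

namespace RawDiagram

section Outer

variable {n m p : ℕ} {D : RawDiagram n m} {E : RawDiagram m p}

/-- The involution of the first diagram on the vertices of the concatenated picture. -/
def fstMate (D : RawDiagram n m) : Fin n ⊕ (Fin m ⊕ Fin p) → Fin n ⊕ (Fin m ⊕ Fin p)
  | .inl i => fstPt (D.mate (.inl i))
  | .inr (.inl j) => fstPt (D.mate (.inr j))
  | .inr (.inr k) => .inr (.inr k)

/-- The involution of the second diagram on the vertices of the concatenated picture. -/
def sndMate (E : RawDiagram m p) : Fin n ⊕ (Fin m ⊕ Fin p) → Fin n ⊕ (Fin m ⊕ Fin p)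
  | .inl i => .inl i
  | .inr b => sndPt (E.mate b)

theorem fstMate_fstPt (a) : fstMate D (fstPt a) = (fstPt (D.mate a) : Fin n ⊕ (Fin m ⊕ Fin p)) := by
  rcases a with a | a <;> rfl

theorem fstMate_fstMate (hD : D.IsPairing) (z : Fin n ⊕ (Fin m ⊕ Fin p)) :
    fstMate D (fstMate D z) = z := by
  rcases z with i | i | i
  · exact (fstMate_fstPt _).trans (congrArg fstPt (hD.mate_mate _))
  · exact (fstMate_fstPt _).trans (congrArg fstPt (hD.mate_mate _))
  · rfl

theorem sndMate_sndMate (hE : E.IsPairing) (z : Fin n ⊕ (Fin m ⊕ Fin p)) :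
    sndMate E (sndMate E z) = z := by
  rcases z with i | i
  · rfl
  · simp only [sndMate, sndPt, hE.mate_mate]

/-- The two matchings, extended by the identity, are involutions of the set of all vertices, and a
component is an orbit of the dihedral group they generate. Outer vertices are fixed by one of the
involutions, and `dihedral_orbit` leaves room for only one fixed point besides `x`. -/
theorem outer_unique (hD : D.IsPairing) (hE : E.IsPairing) {x y w : Fin n ⊕ Fin p}
    (hy : y ≠ x) (hw : w ≠ x) (h1 : comp D E (outerPt y) = comp D E (outerPt x))
    (h2 : comp D E (outerPt w) = comp D E (outerPt x)) : y = w := by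
  let α : Equiv.Perm (Fin n ⊕ (Fin m ⊕ Fin p)) :=
    ⟨fstMate D, fstMate D, fstMate_fstMate hD, fstMate_fstMate hD⟩
  let β : Equiv.Perm (Fin n ⊕ (Fin m ⊕ Fin p)) :=
    ⟨sndMate E, sndMate E, sndMate_sndMate hE, sndMate_sndMate hE⟩
  have hα : α * α = 1 := Equiv.ext (fstMate_fstMate hD)
  have hβ : β * β = 1 := Equiv.ext (sndMate_sndMate hE)
  have oinj : Function.Injective (outerPt : Fin n ⊕ Fin p → Fin n ⊕ (Fin m ⊕ Fin p)) :=
    Sum.map_injective.2 ⟨Function.injective_id, Sum.inr_injective⟩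
  have fix : ∀ x : Fin n ⊕ Fin p, α (outerPt x) = outerPt x ∨ β (outerPt x) = outerPt x := by
    rintro (i | i)
    · exact Or.inr rfl
    · exact Or.inl rfl
  -- A northern `x` is fixed by the second matching and a southern one by the first, so the roles of
  -- the two involutions are kept interchangeable.
  have main : ∀ (γ δ : Equiv.Perm (Fin n ⊕ (Fin m ⊕ Fin p))), γ * γ = 1 → δ * δ = 1 →
      ((γ = α ∧ δ = β) ∨ (γ = β ∧ δ = α)) → δ (outerPt x) = outerPt x → y = w := by
    intro γ δ hγ hδ hor hx
    obtain ⟨c1, c2, c3⟩ := dihedral_orbit hγ hδ hx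
    have cα : ∀ z, (∃ i : ℤ, z = ((δ * γ) ^ i) (outerPt x)) ↔
        ∃ i : ℤ, α z = ((δ * γ) ^ i) (outerPt x) := by
      rcases hor with ⟨rfl, rfl⟩ | ⟨rfl, rfl⟩
      · exact c1
      · exact c2
    have cβ : ∀ z, (∃ i : ℤ, z = ((δ * γ) ^ i) (outerPt x)) ↔
        ∃ i : ℤ, β z = ((δ * γ) ^ i) (outerPt x) := by
      rcases hor with ⟨rfl, rfl⟩ | ⟨rfl, rfl⟩
      · exact c2
      · exact c1
    have mem : ∀ z, comp D E z = comp D E (outerPt x) →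
        ∃ i : ℤ, z = ((δ * γ) ^ i) (outerPt x) := by
      intro z hz
      have := eq_of_comp_eq (D := D) (E := E)
        (fun z => ∃ i : ℤ, z = ((δ * γ) ^ i) (outerPt x))
        (fun a => by
          rw [← fstMate_fstPt]; exact propext (cα _).symm)
        (fun a => propext (cβ (sndPt a)).symm) hz
      exact this.mpr ⟨0, rfl⟩
    refine oinj (c3 _ _ (mem _ h1) (mem _ h2) (fun h => hy (oinj h)) (fun h => hw (oinj h)) ?_ ?_)
    · rcases hor with ⟨rfl, rfl⟩ | ⟨rfl, rfl⟩
      · exact fix y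
      · exact (fix y).symm
    · rcases hor with ⟨rfl, rfl⟩ | ⟨rfl, rfl⟩
      · exact fix w
      · exact (fix w).symm
  rcases fix x with h | h
  · exact main β α hβ hα (Or.inr ⟨rfl, rfl⟩) h
  · exact main α β hα hβ (Or.inl ⟨rfl, rfl⟩) h

/-- If `x` were the only outer vertex of its component, the number of outer vertices there would be
odd, against `even_outer`. -/
theorem outer_exists (hD : D.IsPairing) (hE : E.IsPairing) (x : Fin n ⊕ Fin p) :
    ∃ y, y ≠ x ∧ comp D E (outerPt y) = comp D E (outerPt x) := by
  classical
  by_contra! h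
  have := even_outer hD hE (comp D E (outerPt x))
  rw [Finset.sum_eq_single x] at this
  · simp at this
  · intro y _ hy; rw [if_neg (h y hy)]
  · simp

theorem concat_mate_spec (hD : D.IsPairing) (hE : E.IsPairing) (x : Fin n ⊕ Fin p) :
    (concat D E).mate x ≠ x ∧
      comp D E (outerPt ((concat D E).mate x)) = comp D E (outerPt x) := by
  have h := outer_exists hD hE x
  simp only [concat, dif_pos h]
  exact h.choose_spec

theorem concat_mate_eq (hD : D.IsPairing) (hE : E.IsPairing) {x y : Fin n ⊕ Fin p} (hy : y ≠ x)
    (h : comp D E (outerPt y) = comp D E (outerPt x)) : (concat D E).mate x = y :=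
  outer_unique hD hE (concat_mate_spec hD hE x).1 hy (concat_mate_spec hD hE x).2 h

theorem concat_isPairing (hD : D.IsPairing) (hE : E.IsPairing) : (concat D E).IsPairing where
  mate_mate x := concat_mate_eq hD hE (concat_mate_spec hD hE x).1.symm
    (concat_mate_spec hD hE x).2.symm
  mate_ne x := (concat_mate_spec hD hE x).1
  blob_mate x := by
    have := (concat_mate_spec hD hE x).2
    simp only [concat] at this ⊢
    rw [this]

end Outer

end RawDiagram

/-! ### Extending colourings over a concatenated picture -/

namespace RawDiagram

section Solve

variable {n m p : ℕ} {D : RawDiagram n m} {E : RawDiagram m p}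

instance : Finite (Component D E) := Quot.finite _

open Classical in
theorem outer_sum (hD : D.IsPairing) (hE : E.IsPairing) (x : Fin n ⊕ Fin p)
    (f : Fin n ⊕ Fin p → ZMod 2) :
    (∑ y, if comp D E (outerPt y) = comp D E (outerPt x) then f y else 0) =
      f x + f ((concat D E).mate x) := by
  rw [← Finset.sum_pair (concat_mate_spec hD hE x).1.symm, ← Finset.sum_filter]
  refine Finset.sum_congr ?_ fun _ _ => rfl
  ext y
  simp only [Finset.mem_filter, Finset.mem_univ, true_and, Finset.mem_insert,
    Finset.mem_singleton]
  constructor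
  · intro h
    by_cases hy : y = x
    · exact Or.inl hy
    · exact Or.inr (concat_mate_eq hD hE hy h).symm
  · rintro (rfl | rfl)
    · rfl
    · exact (concat_mate_spec hD hE x).2

/-- The colours at the two ends of a component differ by the number of blobs on it (`blobsOn_eq`).
-/
theorem isColoring_concat (hD : D.IsPairing) (hE : E.IsPairing)
    {F : Fin n ⊕ (Fin m ⊕ Fin p) → ZMod 2}
    (h1 : D.IsColoring (F ∘ fstPt)) (h2 : E.IsColoring (F ∘ sndPt)) :
    (concat D E).IsColoring (F ∘ outerPt) := by
  classical
  intro x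
  have e := blobsOn_eq hD hE h1 h2 (comp D E (outerPt x))
  rw [outer_sum hD hE x fun y => F (outerPt y)] at e
  have : bit ((concat D E).blob x) = (blobsOn D E (comp D E (outerPt x)) : ZMod 2) :=
    bit_decide_odd _
  rw [this, e, Function.comp_apply, Function.comp_apply, ← add_assoc, zmod_two_add_self, zero_add]

/-- On a loop there are no outer vertices, so the sum in `blobsOn_eq` that computes its number of
blobs is empty. -/
theorem not_hasOddLoop (hD : D.IsPairing) (hE : E.IsPairing)
    {F : Fin n ⊕ (Fin m ⊕ Fin p) → ZMod 2}
    (h1 : D.IsColoring (F ∘ fstPt)) (h2 : E.IsColoring (F ∘ sndPt)) : ¬ HasOddLoop D E := by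
  classical
  rintro ⟨K, hK, hodd⟩
  have e := blobsOn_eq hD hE h1 h2 K
  rw [Finset.sum_eq_zero fun x _ => if_neg (hK x), ZMod.natCast_eq_zero_iff_even] at e
  exact Nat.not_even_iff_odd.2 hodd e

theorem IsPairing.sum_mul_bit (hD : D.IsPairing) (φ : Fin n ⊕ Fin m → ZMod 2) :
    ∑ a, φ a * bit (D.blob a) =
      ∑ a, if D.blob a = true ∧ pos a < pos (D.mate a) then φ a + φ (D.mate a) else 0 := by
  rw [hD.sum_eq]
  refine Finset.sum_congr rfl fun a _ => ?_
  rw [hD.blob_mate]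
  cases D.blob a <;> simp

/-- Summation by parts: the operator `f ↦ f ∘ mate + f` is self-adjoint, because `mate` is an
involution. -/
theorem IsPairing.sum_mul_mate (hD : D.IsPairing) (φ f : Fin n ⊕ Fin m → ZMod 2) :
    ∑ a, φ a * (f (D.mate a) + f a) = ∑ a, (φ a + φ (D.mate a)) * f a := by
  simp only [mul_add, add_mul, Finset.sum_add_distrib]
  rw [add_comm, ← Equiv.sum_comp hD.perm fun x => φ x * f (D.mate x)]
  simp [IsPairing.perm, hD.mate_mate]

/-- A vector outside the range of a linear map is detected by a functional. -/
theorem exists_functional {K ι V : Type*} [Field K] [AddCommGroup V] [Module K V] [Fintype ι]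
    (L : V →ₗ[K] (ι → K)) {t : ι → K} (ht : ∀ v, L v ≠ t) :
    ∃ w : ι → K, (∀ v, ∑ i, w i * L v i = 0) ∧ ∑ i, w i * t i ≠ 0 := by
  classical
  have : t ∉ LinearMap.range L := by rintro ⟨v, hv⟩; exact ht v hv
  obtain ⟨f, hf, hle⟩ := Submodule.exists_le_ker_of_notMem this
  have hfs : ∀ g, f g = ∑ i, f (fun j => if i = j then 1 else 0) * g i := fun g => by
    rw [LinearMap.pi_apply_eq_sum_univ]
    exact Finset.sum_congr rfl fun i _ => by rw [smul_eq_mul, mul_comm]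
  refine ⟨fun i => f fun j => if i = j then 1 else 0, fun v => ?_, ?_⟩
  · rw [← hfs]; exact hle ⟨v, rfl⟩
  · rw [← hfs]; exact hf

open Classical in
theorem sum_component (G : Component D E → ZMod 2) {A : Type*} [Fintype A]
    (q : A → Prop) [DecidablePred q] (f : A → ZMod 2) (κ : A → Component D E) [Fintype (Component D E)] :
    (∑ a, if q a then G (κ a) * f a else 0) =
      ∑ K, G K * ∑ a, if q a ∧ κ a = K then f a else 0 := by
  simp only [Finset.mul_sum]
  rw [Finset.sum_comm]
  refine Finset.sum_congr rfl fun a _ => ?_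
  rw [Finset.sum_eq_single (κ a)]
  · by_cases h : q a <;> simp [h]
  · intro K _ hK
    rw [if_neg fun h => hK h.2.symm, mul_zero]
  · simp

/-- Finding `F` is an inhomogeneous linear system over `ZMod 2`. If it had no solution, some
functional `(φ, χ, ω)` would vanish on the range of the system but not on the right-hand side.
Vanishing on the range forces the functional to come from a function on components. Its value on the
right-hand side is then a sum over components, each term of which vanishes: loops have evenly many
blobs, and `o` is a colouring of the product. -/
theorem exists_coloring (hD : D.IsPairing) (hE : E.IsPairing) (hodd : ¬ HasOddLoop D E)
    {o : Fin n ⊕ Fin p → ZMod 2} (ho : (concat D E).IsColoring o) :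
    ∃ F : Fin n ⊕ (Fin m ⊕ Fin p) → ZMod 2,
      D.IsColoring (F ∘ fstPt) ∧ E.IsColoring (F ∘ sndPt) ∧ F ∘ outerPt = o := by
  classical
  let L : (Fin n ⊕ (Fin m ⊕ Fin p) → ZMod 2) →ₗ[ZMod 2]
      ((Fin n ⊕ Fin m) ⊕ ((Fin m ⊕ Fin p) ⊕ (Fin n ⊕ Fin p)) → ZMod 2) :=
    { toFun := fun F => Sum.elim (fun a => F (fstPt (D.mate a)) + F (fstPt a))
        (Sum.elim (fun b => F (sndPt (E.mate b)) + F (sndPt b)) fun x => F (outerPt x))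
      map_add' := fun F G => by
        funext a; rcases a with a | a | a <;> simp only [Sum.elim_inl, Sum.elim_inr, Pi.add_apply]
        all_goals ring
      map_smul' := fun r F => by
        funext a; rcases a with a | a | a <;>
          simp only [Sum.elim_inl, Sum.elim_inr, Pi.smul_apply, smul_eq_mul, RingHom.id_apply]
        all_goals ring }
  by_contra hno
  have ht : ∀ F, L F ≠ Sum.elim (fun a => bit (D.blob a))
      (Sum.elim (fun b => bit (E.blob b)) o) := by
    intro F hF
    refine hno ⟨F, fun a => ?_, fun b => ?_, funext fun x => congrFun hF (.inr (.inr x))⟩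
    · have := congrFun hF (.inl a)
      simp only [L, LinearMap.coe_mk, AddHom.coe_mk, Sum.elim_inl] at this
      simp only [Function.comp_apply, ← this]
      linear_combination -zmod_two_add_self (F (fstPt a))
    · have := congrFun hF (.inr (.inl b))
      simp only [L, LinearMap.coe_mk, AddHom.coe_mk, Sum.elim_inl, Sum.elim_inr] at this
      simp only [Function.comp_apply, ← this]
      linear_combination -zmod_two_add_self (F (sndPt b))
  obtain ⟨w, hw, hne⟩ := exists_functional L ht
  set φ := fun a => w (.inl a) with hφ
  set χ := fun b => w (.inr (.inl b)) with hχ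
  set ω := fun x => w (.inr (.inr x)) with hω
  have hw' : ∀ F : Fin n ⊕ (Fin m ⊕ Fin p) → ZMod 2,
      ∑ a, (φ a + φ (D.mate a)) * F (fstPt a) + (∑ b, (χ b + χ (E.mate b)) * F (sndPt b) +
        ∑ x, ω x * F (outerPt x)) = 0 := by
    intro F
    have := hw F
    rw [Fintype.sum_sum_type, Fintype.sum_sum_type (α₁ := Fin m ⊕ Fin p)] at this
    rw [← hD.sum_mul_mate φ fun a => F (fstPt a), ← hE.sum_mul_mate χ fun a => F (sndPt a)]
    exact this
  -- Testing on the indicator functions of northern, middle and southern vertices in turn.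
  have s1 : ∀ i, φ (.inl i) + φ (D.mate (.inl i)) = ω (.inl i) := by
    intro i
    have := hw' (Pi.single (.inl i) 1)
    simp [Fintype.sum_sum_type, fstPt, sndPt, outerPt, Pi.single_apply] at this
    exact zmod_two_eq_of_add this
  have s2 : ∀ j, φ (.inr j) + φ (D.mate (.inr j)) = χ (.inl j) + χ (E.mate (.inl j)) := by
    intro i
    have := hw' (Pi.single (.inr (.inl i)) 1)
    simp [Fintype.sum_sum_type, fstPt, sndPt, outerPt, Pi.single_apply] at this
    exact zmod_two_eq_of_add this
  have s3 : ∀ k, χ (.inr k) + χ (E.mate (.inr k)) = ω (.inr k) := by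
    intro i
    have := hw' (Pi.single (.inr (.inr i)) 1)
    simp [Fintype.sum_sum_type, fstPt, sndPt, outerPt, Pi.single_apply] at this
    exact zmod_two_eq_of_add this
  -- By `s1`, `s2`, `s3` the symmetrised functionals agree wherever two of the parts share a vertex,
  -- so they glue to one function, which is constant along all arcs.
  let Φ : Fin n ⊕ (Fin m ⊕ Fin p) → ZMod 2 :=
    Sum.elim (fun i => φ (.inl i) + φ (D.mate (.inl i))) fun b => χ b + χ (E.mate b)
  have Φ1 : ∀ a, Φ (fstPt a) = φ a + φ (D.mate a) := by
    rintro (i | j)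
    · rfl
    · exact (s2 j).symm
  have Φ2 : ∀ b, Φ (sndPt b) = χ b + χ (E.mate b) := fun b => rfl
  have Φ3 : ∀ x, Φ (outerPt x) = ω x := by
    rintro (i | k)
    · exact s1 i
    · exact s3 k
  let Ψ : Component D E → ZMod 2 := fun K => Φ (comp_surjective K).choose
  have hΨ : ∀ z, Ψ (comp D E z) = Φ z := fun z =>
    eq_of_comp_eq Φ (fun a => by rw [Φ1, Φ1, hD.mate_mate, add_comm])
      (fun a => by rw [Φ2, Φ2, hE.mate_mate, add_comm])
      (comp_surjective (D := D) (E := E) (comp D E z)).choose_spec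
  have : Fintype (Component D E) := Fintype.ofFinite _
  -- The value of the functional on the right-hand side of the system, grouped by components.
  have total : ∑ K, Ψ K * ((blobsOn D E K : ZMod 2) +
      ∑ x, if comp D E (outerPt x) = K then o x else 0) ≠ 0 := by
    refine fun h => hne ?_
    rw [Fintype.sum_sum_type, Fintype.sum_sum_type (α₁ := Fin m ⊕ Fin p)]
    simp only [Sum.elim_inl, Sum.elim_inr]
    have e1 := hD.sum_mul_bit φ
    have e2 := hE.sum_mul_bit χ
    simp only [← Φ1, ← Φ2, ← hΨ] at e1 e2
    have e3 := sum_component Ψ (fun _ => True) o fun x => comp D E (outerPt x)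
    simp only [hΨ, Φ3, if_true, true_and] at e3
    have e1' := sum_component Ψ (fun a => D.blob a = true ∧ pos a < pos (D.mate a)) (fun _ => 1)
      (fun a => comp D E (fstPt a))
    have e2' := sum_component Ψ (fun a => E.blob a = true ∧ pos a < pos (E.mate a)) (fun _ => 1)
      (fun a => comp D E (sndPt a))
    simp only [mul_one] at e1' e2'
    rw [e1'] at e1
    rw [e2'] at e2
    change ∑ a, φ a * _ + (∑ b, χ b * _ + ∑ x, ω x * _) = 0
    refine Eq.trans ?_ h
    rw [e1, e2, e3, ← Finset.sum_add_distrib, ← Finset.sum_add_distrib]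
    refine Finset.sum_congr rfl fun K _ => ?_
    rw [blobsOn, Nat.cast_add, natCast_card_subtype, natCast_card_subtype]
    simp only [and_assoc]
    ring
  refine total (Finset.sum_eq_zero fun K _ => ?_)
  by_cases hK : IsLoop D E K
  · have : Even (blobsOn D E K) := by
      by_contra h
      exact hodd ⟨K, hK, Nat.not_even_iff_odd.1 h⟩
    rw [ZMod.natCast_eq_zero_iff_even.2 this, Finset.sum_eq_zero fun x _ => if_neg (hK x)]
    simp
  · obtain ⟨x, rfl⟩ : ∃ x, comp D E (outerPt x) = K :=
      not_forall_not.1 hK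
    rw [outer_sum hD hE, ho x, ← add_assoc (o x), zmod_two_add_self, zero_add]
    rw [show bit ((concat D E).blob x) = (blobsOn D E (comp D E (outerPt x)) : ZMod 2) from
      bit_decide_odd _, zmod_two_add_self, mul_zero]

end Solve

/-! ### Matrices of diagrams -/

section Mat

variable {n m p : ℕ}

open Classical in
/-- The matrix of a diagram: its entry is `1` if the two given sequences of colours form a
colouring of the diagram. -/
noncomputable def mat (D : RawDiagram n m) : Matrix (Fin n → ZMod 2) (Fin m → ZMod 2) ℕ :=
  fun c c' => if D.IsColoring (Sum.elim c c') then 1 else 0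

theorem mat_eq_one {D : RawDiagram n m} {c c'} (h : D.IsColoring (Sum.elim c c')) :
    D.mat c c' = 1 := if_pos h

theorem mat_eq_zero {D : RawDiagram n m} {c c'} (h : ¬ D.IsColoring (Sum.elim c c')) :
    D.mat c c' = 0 := if_neg h

variable {D : RawDiagram n m} {E : RawDiagram m p}

theorem mat_mul_apply (c c'') : (D.mat * E.mat) c c'' =
    Nat.card {c' // D.IsColoring (Sum.elim c c') ∧ E.IsColoring (Sum.elim c' c'')} := by
  classical
  rw [Matrix.mul_apply, ← Nat.cast_id (Nat.card _), natCast_card_subtype]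
  refine Finset.sum_congr rfl fun c' _ => ?_
  simp only [mat, mul_ite, mul_one, mul_zero, ← ite_and]
  exact if_congr and_comm rfl rfl

theorem elim_comp_fstPt (c : Fin n → ZMod 2) (c' : Fin m → ZMod 2) (c'' : Fin p → ZMod 2) :
    Sum.elim c (Sum.elim c' c'') ∘ fstPt = Sum.elim c c' := by
  funext x; rcases x with x | x <;> rfl

theorem elim_comp_outerPt (c : Fin n → ZMod 2) (c' : Fin m → ZMod 2) (c'' : Fin p → ZMod 2) :
    Sum.elim c (Sum.elim c' c'') ∘ outerPt = Sum.elim c c'' := by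
  funext x; rcases x with x | x <;> rfl

theorem mat_mul_of_odd (hD : D.IsPairing) (hE : E.IsPairing) (h : HasOddLoop D E) :
    D.mat * E.mat = 0 := by
  ext c c''
  rw [mat_mul_apply, Matrix.zero_apply, Nat.card_eq_zero]
  left
  refine ⟨?_⟩
  rintro ⟨c', h1, h2⟩
  exact not_hasOddLoop hD hE (F := Sum.elim c (Sum.elim c' c'')) (by rwa [elim_comp_fstPt]) h2 h

/-- Two colourings of the picture with the same outer colours differ by a function that is constant
on components and zero on those with ends. So there is one free choice in `ZMod 2` for every loop.
-/
theorem card_colorings {c c₀ c''}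
    (h1 : D.IsColoring (Sum.elim c c₀)) (h2 : E.IsColoring (Sum.elim c₀ c'')) :
    Nat.card {c' // D.IsColoring (Sum.elim c c') ∧ E.IsColoring (Sum.elim c' c'')} =
      2 ^ numLoops D E := by
  classical
  let G : ({K : Component D E // IsLoop D E K} → ZMod 2) → Fin n ⊕ (Fin m ⊕ Fin p) → ZMod 2 :=
    fun g z => if h : IsLoop D E (comp D E z) then g ⟨_, h⟩ else 0
  have G1 : ∀ g a, G g (fstPt (D.mate a)) = G g (fstPt a) := fun g a => by
    simp only [G, comp_fst]
  have G2 : ∀ g a, G g (sndPt (E.mate a)) = G g (sndPt a) := fun g a => by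
    simp only [G, comp_snd]
  have G3 : ∀ g a, G g (outerPt a) = 0 := fun g a => dif_neg fun h => h a rfl
  let f : ({K : Component D E // IsLoop D E K} → ZMod 2) →
      {c' // D.IsColoring (Sum.elim c c') ∧ E.IsColoring (Sum.elim c' c'')} := fun g =>
    ⟨fun j => c₀ j + G g (.inr (.inl j)), by
      have : Sum.elim c (fun j => c₀ j + G g (.inr (.inl j))) =
          fun a => Sum.elim c c₀ a + G g (fstPt a) := by
        funext a; rcases a with i | j
        · exact (add_zero _).symm.trans (congrArg _ (G3 g (.inl i)).symm)
        · rfl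
      rw [this]
      intro a
      simp only [G1, h1 a]; ring, by
      have : Sum.elim (fun j => c₀ j + G g (.inr (.inl j))) c'' =
          fun a => Sum.elim c₀ c'' a + G g (sndPt a) := by
        funext a; rcases a with i | j
        · rfl
        · exact (add_zero _).symm.trans (congrArg _ (G3 g (.inr j)).symm)
      rw [this]
      intro a
      simp only [G2, h2 a]; ring⟩
  have hf : Function.Bijective f := by
    constructor
    · intro g g' h
      funext ⟨K, hK⟩
      obtain ⟨z, rfl⟩ := comp_surjective K
      have hG : ∀ g, G g z = g ⟨_, hK⟩ := fun g => dif_pos hK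
      rcases z with i | j | k
      · exact absurd rfl (hK (.inl i))
      · have := congrFun (congrArg Subtype.val h) j
        simp only [f] at this
        rw [← hG g, ← hG g']
        exact add_left_cancel this
      · exact absurd rfl (hK (.inr k))
    · rintro ⟨c', h1', h2'⟩
      let d : Fin n ⊕ (Fin m ⊕ Fin p) → ZMod 2 :=
        fun z => Sum.elim c (Sum.elim c₀ c'') z + Sum.elim c (Sum.elim c' c'') z
      have d1 : ∀ a, d (fstPt a) = Sum.elim c c₀ a + Sum.elim c c' a := by
        rintro (a | a) <;> rfl
      have d2 : ∀ a, d (sndPt a) = Sum.elim c₀ c'' a + Sum.elim c' c'' a := by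
        rintro (a | a) <;> rfl
      have d3 : ∀ a, d (outerPt a) = 0 := by
        rintro (a | a) <;> exact zmod_two_add_self _
      have hd : ∀ z z', comp D E z = comp D E z' → d z = d z' := fun z z' =>
        eq_of_comp_eq d
          (fun a => by
            rw [d1, d1, h1, h1']
            linear_combination zmod_two_add_self (bit (D.blob a)))
          (fun a => by
            rw [d2, d2, h2, h2']
            linear_combination zmod_two_add_self (bit (E.blob a)))
      refine ⟨fun K => d (comp_surjective K.1).choose, Subtype.ext (funext fun j => ?_)⟩
      have : G (fun K => d (comp_surjective K.1).choose) (.inr (.inl j)) = d (.inr (.inl j)) := by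
        by_cases h : IsLoop D E (comp D E (.inr (.inl j)))
        · exact (dif_pos h).trans (hd _ _ (comp_surjective (D := D) (E := E)
            (comp D E (.inr (.inl j)))).choose_spec)
        · obtain ⟨x, hx⟩ : ∃ x, comp D E (outerPt x) = comp D E (.inr (.inl j)) :=
            not_forall_not.1 h
          rw [← hd _ _ hx, d3]
          exact dif_neg h
      simp only [f, this]
      change c₀ j + (c₀ j + c' j) = c' j
      rw [← add_assoc, zmod_two_add_self, zero_add]
  rw [← Nat.card_congr (Equiv.ofBijective f hf), Nat.card_fun, Nat.card_zmod, numLoops]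

/-- Matrices of diagrams multiply like diagrams, with loops replaced by `2` or `0`. -/
theorem mat_mul (hD : D.IsPairing) (hE : E.IsPairing) (h : ¬ HasOddLoop D E) :
    D.mat * E.mat = 2 ^ numLoops D E • (concat D E).mat := by
  ext c c''
  rw [mat_mul_apply, Matrix.smul_apply, smul_eq_mul]
  by_cases ho : (concat D E).IsColoring (Sum.elim c c'')
  · obtain ⟨F, f1, f2, f3⟩ := exists_coloring hD hE h ho
    obtain ⟨a, b, d, rfl⟩ : ∃ a b d, F = Sum.elim a (Sum.elim b d) :=
      ⟨F ∘ .inl, F ∘ .inr ∘ .inl, F ∘ .inr ∘ .inr, by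
        funext x; rcases x with x | x | x <;> rfl⟩
    rw [elim_comp_fstPt] at f1
    rw [elim_comp_outerPt] at f3
    obtain rfl : a = c := funext fun i => congrFun f3 (.inl i)
    obtain rfl : d = c'' := funext fun i => congrFun f3 (.inr i)
    rw [mat_eq_one ho, mul_one, card_colorings f1 f2]
  · rw [mat_eq_zero ho, mul_zero, Nat.card_eq_zero]
    left
    refine ⟨?_⟩
    rintro ⟨c', h1, h2⟩
    have := isColoring_concat hD hE (F := Sum.elim c (Sum.elim c' c''))
      (by rwa [elim_comp_fstPt]) h2
    rw [elim_comp_outerPt] at this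
    exact ho this

theorem IsPairing.exists_isColoring (hD : D.IsPairing) : ∃ c, D.IsColoring c := by
  refine ⟨fun x => if pos x < pos (D.mate x) then 0 else bit (D.blob x), fun x => ?_⟩
  have := hD.pos_mate_ne x
  by_cases h : pos x < pos (D.mate x)
  · simp only [hD.mate_mate, hD.blob_mate, if_pos h, zero_add]
    rw [if_neg (by omega)]
  · simp only [hD.mate_mate, if_neg h, zmod_two_add_self]
    rw [if_pos (by omega)]

/-- Two vertices with a constant difference of colours are the ends of an arc. -/
theorem IsPairing.mate_eq_of_coloring (hD : D.IsPairing) {x y : Fin n ⊕ Fin m} {s : Bool}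
    (hxy : y ≠ x) (h : ∀ c, D.IsColoring c → c y = c x + bit s) :
    D.mate x = y ∧ D.blob x = s := by
  classical
  obtain ⟨c, hc⟩ := hD.exists_isColoring
  have key : D.mate x = y := by
    by_contra hne
    -- Switching both colours of the arc at `x` gives another colouring; if `y` is not on this arc,
    -- its colour stays while that of `x` changes.
    have hc' : D.IsColoring fun z => c z + if z = x ∨ z = D.mate x then 1 else 0 := by
      intro z
      have : (D.mate z = x ∨ D.mate z = D.mate x) ↔ (z = x ∨ z = D.mate x) := by
        rw [hD.mate_injective.eq_iff, or_comm]
        refine or_congr_right ⟨fun h => by rw [← h, hD.mate_mate], fun h => by rw [h, hD.mate_mate]⟩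
      simp only [this, hc z]; ring
    have h1 := h _ hc
    have h2 := h _ hc'
    simp only [true_or, if_true] at h2
    rw [if_neg (by rintro (h | h); exacts [hxy h, hne h.symm]), h1] at h2
    have h3 : (1 : ZMod 2) = 0 := by linear_combination -h2
    exact absurd h3 (by decide)
  refine ⟨key, bit_injective ?_⟩
  have h1 := h _ hc
  rw [← key, hc x] at h1
  exact add_left_cancel h1

theorem elim_surj (F : Fin n ⊕ Fin m → ZMod 2) : ∃ a b, F = Sum.elim a b :=
  ⟨F ∘ .inl, F ∘ .inr, by funext x; rcases x with x | x <;> rfl⟩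

theorem IsPairing.mat_ne_zero (hD : D.IsPairing) : D.mat ≠ 0 := by
  obtain ⟨c, hc⟩ := hD.exists_isColoring
  obtain ⟨a, b, rfl⟩ := elim_surj c
  intro h
  have := congrFun (congrFun h a) b
  rw [mat_eq_one hc] at this
  exact one_ne_zero this

theorem mat_apply_eq_one_iff {D : RawDiagram n m} {c c'} :
    D.mat c c' = 1 ↔ D.IsColoring (Sum.elim c c') := by
  by_cases h : D.IsColoring (Sum.elim c c') <;> simp [h, mat_eq_one, mat_eq_zero]

/-- The matrix records the set of colourings, and `mate_eq_of_coloring` reads arcs and blobs off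
that set. -/
theorem mat_injective {D D' : RawDiagram n m} (hD : D.IsPairing) (hD' : D'.IsPairing)
    (h : D.mat = D'.mat) : D = D' := by
  have key : ∀ x, D.mate x = D'.mate x ∧ D.blob x = D'.blob x := fun x =>
    hD.mate_eq_of_coloring (hD'.mate_ne x) fun c hc => by
      obtain ⟨a, b, rfl⟩ := elim_surj c
      rw [← mat_apply_eq_one_iff, h, mat_apply_eq_one_iff] at hc
      exact hc x
  exact RawDiagram.ext (funext fun x => (key x).1) (funext fun x => (key x).2)

/-- Entries are 0 or 1, so an entry at a colouring of `D` isolates the power of 2. Powers of 2 thus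
keep count of loops, which is why results obtained with matrices hold for arbitrary `δ`. -/
theorem smul_mat_injective {D D' : RawDiagram n m} (hD : D.IsPairing) (hD' : D'.IsPairing)
    {a b : ℕ} (h : 2 ^ a • D.mat = 2 ^ b • D'.mat) : a = b ∧ D = D' := by
  have h' : ∀ c c', 2 ^ a * D.mat c c' = 2 ^ b * D'.mat c c' := fun c c' =>
    congrFun (congrFun h c) c'
  have hab : a = b := by
    obtain ⟨c, hc⟩ := hD.exists_isColoring
    obtain ⟨x, y, rfl⟩ := elim_surj c
    have := h' x y
    rw [mat_eq_one hc, mul_one] at this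
    by_cases hc' : D'.IsColoring (Sum.elim x y)
    · rw [mat_eq_one hc', mul_one] at this
      exact Nat.pow_right_injective le_rfl this
    · rw [mat_eq_zero hc', mul_zero] at this
      exact absurd this (by positivity)
  subst hab
  refine ⟨rfl, mat_injective hD hD' ?_⟩
  ext c c'
  exact Nat.eq_of_mul_eq_mul_left (by positivity) (h' c c')

/-- Recognition of a product of diagrams from the matrices. -/
theorem concat_of_mat_mul (hD : D.IsPairing) (hE : E.IsPairing) {C : RawDiagram n p}
    (hC : C.IsPairing) {r : ℕ} (h : D.mat * E.mat = 2 ^ r • C.mat) :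
    ¬ HasOddLoop D E ∧ numLoops D E = r ∧ concat D E = C := by
  have h1 : ¬ HasOddLoop D E := fun ho => by
    rw [mat_mul_of_odd hD hE ho] at h
    refine hC.mat_ne_zero ?_
    ext c c'
    have := (congrFun (congrFun h c) c').symm
    simpa using this
  rw [mat_mul hD hE h1] at h
  exact ⟨h1, smul_mat_injective (concat_isPairing hD hE) hC h⟩

theorem hasOddLoop_of_mat_mul (hD : D.IsPairing) (hE : E.IsPairing) (h : D.mat * E.mat = 0) :
    HasOddLoop D E := by
  by_contra ho
  rw [mat_mul hD hE ho] at h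
  refine (concat_isPairing hD hE).mat_ne_zero ?_
  ext c c'
  have := congrFun (congrFun h c) c'
  simpa using this

theorem hasOddLoop_iff (hD : D.IsPairing) (hE : E.IsPairing) :
    HasOddLoop D E ↔ D.mat * E.mat = 0 :=
  ⟨mat_mul_of_odd hD hE, hasOddLoop_of_mat_mul hD hE⟩

/-- Without odd loops a colouring of the product extends to the whole picture. Blobs are sums of
colours, and the middle colours are counted twice. -/
theorem numBlobs_concat (hD : D.IsPairing) (hE : E.IsPairing) (h : ¬ HasOddLoop D E) :
    ((concat D E).numBlobs : ZMod 2) = D.numBlobs + E.numBlobs := by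
  obtain ⟨o, ho⟩ := (concat_isPairing hD hE).exists_isColoring
  obtain ⟨F, f1, f2, rfl⟩ := exists_coloring hD hE h ho
  rw [hD.numBlobs_eq f1, hE.numBlobs_eq f2, (concat_isPairing hD hE).numBlobs_eq ho]
  exact (sum_fst_add_sum_snd F).symm

end Mat

end RawDiagram

/-! ### Planarity of products -/

namespace RawDiagram

section Planar

variable {n m p : ℕ} {D : RawDiagram n m} {E : RawDiagram m p}

open Classical in
/-- The number modulo `2` of vertices in `q` which precede `x`. -/
noncomputable def depth {n m : ℕ} (q : Fin n ⊕ Fin m → Prop) (x : Fin n ⊕ Fin m) : ZMod 2 :=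
  ∑ u, if q u ∧ pos u < pos x then 1 else 0

/-- An arc in `q` does not cross the arc at `x`, so the numbers of its ends before `x` and before
the mate of `x` have the same parity. -/
theorem IsDiagram.depth_mate (hD : D.IsDiagram) {q : Fin n ⊕ Fin m → Prop}
    (hq : ∀ x, q (D.mate x) ↔ q x) {x} (hx : ¬ q x) : depth q (D.mate x) = depth q x := by
  classical
  refine zmod_two_eq_of_add ?_
  rw [depth, depth, ← Finset.sum_add_distrib, hD.isPairing.sum_eq]
  refine Finset.sum_eq_zero fun u _ => ?_
  rw [hq]
  by_cases hu : q u
  · have h1 : pos u ≠ pos x := fun h => hx (pos_injective h ▸ hu)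
    have h2 : pos u ≠ pos (D.mate x) := fun h => hx ((hq x).1 (pos_injective h ▸ hu))
    have h3 : pos (D.mate u) ≠ pos x := fun h => hx (pos_injective h ▸ (hq u).2 hu)
    have h4 : pos (D.mate u) ≠ pos (D.mate x) := fun h =>
      hx ((hq x).1 (pos_injective h ▸ (hq u).2 hu))
    have c1 := hD.noncrossing u x
    have c2 := hD.noncrossing x u
    have c3 := hD.noncrossing u (D.mate x)
    have c4 := hD.noncrossing (D.mate x) u
    rw [hD.mate_mate] at c3 c4
    simp only [hu, true_and]
    revert h1 h2 h3 h4 c1 c2 c3 c4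
    generalize pos u = a, pos (D.mate u) = b, pos x = c, pos (D.mate x) = d
    intros
    split_ifs <;> first | omega | rfl
  · simp [hu]

/-- No arc passes over an exposed vertex, so every arc in `q` has none or both of its ends before
it. -/
theorem IsDiagram.depth_blob (hD : D.IsDiagram) {q : Fin n ⊕ Fin m → Prop}
    (hq : ∀ x, q (D.mate x) ↔ q x) {x} (hx : ¬ q x) (hb : D.blob x = true) : depth q x = 0 := by
  classical
  rw [depth, hD.isPairing.sum_eq]
  refine Finset.sum_eq_zero fun u _ => ?_
  rw [hq]
  by_cases hu : q u
  · have h1 : pos u ≠ pos x := fun h => hx (pos_injective h ▸ hu)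
    have h3 : pos (D.mate u) ≠ pos x := fun h => hx (pos_injective h ▸ (hq u).2 hu)
    have c1 := hD.exposed x hb u
    simp only [hu, true_and]
    revert h1 h3 c1
    generalize pos u = a, pos (D.mate u) = b, pos x = c
    intros
    split_ifs <;> first | omega | rfl
  · simp [hu]

open Classical in
theorem depth_inl (q : Fin n ⊕ Fin m → Prop) (i : Fin n) :
    depth q (.inl i) = ∑ u : Fin n, if q (.inl u) ∧ u < i then 1 else 0 := by
  classical
  rw [depth, Fintype.sum_sum_type, Finset.sum_eq_zero (s := (Finset.univ : Finset (Fin m))),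
    add_zero]
  · exact Finset.sum_congr rfl fun u _ => if_congr Iff.rfl rfl rfl
  · intro j _
    refine if_neg fun h => ?_
    have := h.2
    simp only [pos] at this
    omega

open Classical in
theorem depth_inr (q : Fin n ⊕ Fin m → Prop) (j : Fin m) :
    depth q (.inr j) = (∑ u : Fin n, if q (.inl u) then 1 else 0) +
      ∑ u : Fin m, if q (.inr u) ∧ j < u then 1 else 0 := by
  classical
  rw [depth, Fintype.sum_sum_type]
  refine congrArg₂ _ (Finset.sum_congr rfl fun u _ => ?_) (Finset.sum_congr rfl fun u _ => ?_)
  · have := u.2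
    refine if_congr ?_ rfl rfl
    simp only [pos]
    exact and_iff_left (by omega)
  · refine if_congr (and_congr_right fun _ => ?_) rfl rfl
    simp only [pos, Fin.val_rev, Fin.lt_def]
    have := u.2
    have := j.2
    omega

theorem even_fst (hD : D.IsPairing) [DecidableEq (Component D E)] (K : Component D E) :
    (∑ u : Fin n, if comp D E (.inl u) = K then (1 : ZMod 2) else 0) =
      ∑ u : Fin m, if comp D E (.inr (.inl u)) = K then 1 else 0 := by
  have := hD.even_card (fun a => comp D E (fstPt a) = K) fun a => by rw [comp_fst]
  rw [Fintype.sum_sum_type] at this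
  exact zmod_two_eq_of_add this

/-- The parity of the number of vertices of a component `K` which precede a given vertex is
constant on the other components. -/
theorem exists_depth (hD : D.IsDiagram) (hE : E.IsDiagram) (K : Component D E) :
    ∃ g : Fin n ⊕ (Fin m ⊕ Fin p) → ZMod 2,
      (∀ z z', comp D E z = comp D E z' → comp D E z ≠ K → g z = g z') ∧
      (∀ x, comp D E (outerPt x) ≠ K →
        g (outerPt x) = depth (fun u => comp D E (outerPt u) = K) x) ∧
      (∀ a, comp D E (fstPt a) ≠ K → D.blob a = true → g (fstPt a) = 0) ∧
      (∀ a, comp D E (sndPt a) ≠ K → E.blob a = true → g (sndPt a) = 0) := by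
  classical
  let qD : Fin n ⊕ Fin m → Prop := fun a => comp D E (fstPt a) = K
  let qE : Fin m ⊕ Fin p → Prop := fun a => comp D E (sndPt a) = K
  have hqD : ∀ x, qD (D.mate x) ↔ qD x := fun x => by simp only [qD, comp_fst]
  have hqE : ∀ x, qE (E.mate x) ↔ qE x := fun x => by simp only [qE, comp_snd]
  -- Depth is measured in the first diagram at northern vertices and in the second diagram
  -- elsewhere; `gD` shows that the two agree on the middle edge.
  let g : Fin n ⊕ (Fin m ⊕ Fin p) → ZMod 2 :=
    Sum.elim (fun i => depth qD (.inl i)) (depth qE)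
  have gE : ∀ b, g (sndPt b) = depth qE b := fun b => rfl
  have gD : ∀ a, comp D E (fstPt a) ≠ K → g (fstPt a) = depth qD a := by
    rintro (i | j) h
    · rfl
    -- Before a middle vertex the second diagram sees the vertices of `K` to its west. The first
    -- one, which reads its southern edge backwards, sees those to its east and all northern ones.
    -- Together these are all northern and middle vertices of `K`, an even number by `even_fst`.
    · change depth qE (.inl j) = _
      rw [depth_inl, depth_inr]
      have e := even_fst (E := E) hD.isPairing K
      change (∑ u : Fin n, if qD (.inl u) then (1 : ZMod 2) else 0) =
        ∑ u : Fin m, if qD (.inr u) then 1 else 0 at e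
      rw [e, ← sub_eq_zero, sub_eq_add_neg, CharTwo.neg_eq, ← Finset.sum_add_distrib,
        ← Finset.sum_add_distrib]
      refine Finset.sum_eq_zero fun u _ => ?_
      change (if qD (.inr u) ∧ _ then (1 : ZMod 2) else 0) + _ = 0
      by_cases hu : qD (.inr u)
      · have : u ≠ j := by rintro rfl; exact h hu
        rcases lt_or_gt_of_ne this with h' | h'
        · simp [hu, h', h'.not_gt]; rfl
        · simp [hu, h', h'.not_gt]; rfl
      · simp [hu]
  refine ⟨g, ?_, ?_, ?_, ?_⟩
  · intro z z' hz hK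
    have := eq_of_comp_eq (D := D) (E := E) (fun z => if comp D E z = K then 0 else g z)
      (fun a => by
        rw [comp_fst]
        split_ifs with h
        · rfl
        · rw [gD _ h, gD _ (by rwa [comp_fst]), hD.depth_mate hqD h])
      (fun a => by
        rw [comp_snd]
        split_ifs with h
        · rfl
        · rw [gE, gE, hE.depth_mate hqE h]) hz
    rwa [if_neg hK, if_neg (hz ▸ hK)] at this
  · rintro (i | k) h
    · change depth qD (.inl i) = _
      rw [depth_inl, depth_inl]
      rfl
    · change depth qE (.inr k) = _
      rw [depth_inr, depth_inr]
      have e := even_fst (E := E) hD.isPairing K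
      refine congrArg₂ _ e.symm rfl
  · intro a h hb
    rw [gD a h, hD.depth_blob hqD h hb]
  · intro a h hb
    rw [gE a, hE.depth_blob hqE h hb]

theorem depth_concat (hD : D.IsPairing) (hE : E.IsPairing) (x y : Fin n ⊕ Fin p) :
    depth (fun u => comp D E (outerPt u) = comp D E (outerPt x)) y =
      (if pos x < pos y then 1 else 0) + if pos ((concat D E).mate x) < pos y then 1 else 0 := by
  classical
  rw [← outer_sum hD hE x fun u => if pos u < pos y then 1 else 0]
  refine Finset.sum_congr rfl fun u _ => ?_
  rw [← ite_and]

theorem comp_ne_of_between (hD : D.IsPairing) (hE : E.IsPairing) {x y : Fin n ⊕ Fin p}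
    (h1 : y ≠ x) (h2 : y ≠ (concat D E).mate x) :
    comp D E (outerPt y) ≠ comp D E (outerPt x) :=
  fun h => h2 (concat_mate_eq hD hE h1 h).symm

/-- A Jordan curve argument modulo 2: the number of ends of one component that precede a vertex has
constant parity along every other component. For crossing components the parities at the two ends of
one of them would differ. A component with an odd number of blobs contains a blobbed arc, where the
parity is zero, whereas an arc lying over one of its ends would make it one. -/
theorem concat_isDiagram (hD : D.IsDiagram) (hE : E.IsDiagram) : (concat D E).IsDiagram where
  mate_mate := (concat_isPairing hD.isPairing hE.isPairing).mate_mate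
  mate_ne := (concat_isPairing hD.isPairing hE.isPairing).mate_ne
  blob_mate := (concat_isPairing hD.isPairing hE.isPairing).blob_mate
  noncrossing x y := by
    rintro ⟨h1, h2, h3⟩
    have hP := concat_isPairing hD.isPairing hE.isPairing
    obtain ⟨g, g1, g2, -, -⟩ := exists_depth hD hE (comp D E (outerPt x))
    have hne := comp_ne_of_between hD.isPairing hE.isPairing (x := x) (y := y)
      (fun h => h1.ne' (congrArg pos h)) (fun h => h2.ne (congrArg pos h))
    have hne' := hne
    rw [← (concat_mate_spec hD.isPairing hE.isPairing y).2] at hne'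
    have e := g1 _ _ (concat_mate_spec hD.isPairing hE.isPairing y).2 hne'
    rw [g2 _ hne, g2 _ hne', depth_concat hD.isPairing hE.isPairing,
      depth_concat hD.isPairing hE.isPairing, if_pos (by omega), if_pos h3, if_pos h1,
      if_neg (by omega)] at e
    exact absurd e (by decide)
  exposed x hb y := by
    rintro ⟨h1, h2⟩
    obtain ⟨g, g1, g2, g3, g4⟩ := exists_depth hD hE (comp D E (outerPt y))
    have hne := comp_ne_of_between hD.isPairing hE.isPairing (x := y) (y := x)
      (fun h => h1.ne' (congrArg pos h)) (fun h => h2.ne (congrArg pos h))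
    have e := g2 _ hne
    rw [depth_concat hD.isPairing hE.isPairing, if_pos h1, if_neg (by omega)] at e
    have hodd : Odd (blobsOn D E (comp D E (outerPt x))) := of_decide_eq_true hb
    have h0 : g (outerPt x) = 0 := by
      by_cases hc : Nat.card {a : Fin n ⊕ Fin m // D.blob a = true ∧ pos a < pos (D.mate a) ∧
          comp D E (fstPt a) = comp D E (outerPt x)} = 0
      · rw [blobsOn, hc, zero_add] at hodd
        obtain ⟨⟨a, ha, -, hac⟩⟩ := (Nat.card_pos_iff.1 hodd.pos).1
        rw [← g1 _ _ hac (hac ▸ hne)]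
        exact g4 a (hac ▸ hne) ha
      · obtain ⟨⟨a, ha, -, hac⟩⟩ := (Nat.card_pos_iff.1 (Nat.pos_of_ne_zero hc)).1
        rw [← g1 _ _ hac (hac ▸ hne)]
        exact g3 a (hac ▸ hne) ha
    rw [h0] at e
    exact absurd e (by decide)

end Planar

/-! ### Propagating lines -/

section Propagating

variable {n m p : ℕ} {D : RawDiagram n m} {E : RawDiagram m p}

/-- An arc of `E` between two southern vertices survives in the product. -/
theorem allPropagating_of_concat (hD : D.IsPairing) (hE : E.IsPairing)
    (h : (concat D E).AllPropagating) : E.AllPropagating := by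
  intro j
  rcases hj : E.mate (.inr j) with i | j'
  · exact ⟨i, rfl⟩
  · exfalso
    have hne : j' ≠ j := by rintro rfl; exact hE.mate_ne _ hj
    have := concat_mate_eq hD hE (x := .inr j) (y := .inr j') (by simpa using hne) (by
      have := comp_snd (D := D) (E := E) (.inr j)
      rw [hj] at this
      exact this)
    obtain ⟨i, hi⟩ := h j
    rw [this] at hi
    simp at hi

theorem concat_allPropagating (hDp : D.IsPairing) (hEp : E.IsPairing) (hD : D.AllPropagating)
    (hE : E.AllPropagating) : (concat D E).AllPropagating := by
  intro j
  rcases hj : (concat D E).mate (.inr j) with i | j'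
  · exact ⟨i, rfl⟩
  · exfalso
    obtain ⟨h1, h2⟩ := concat_mate_spec hDp hEp (.inr j)
    rw [hj] at h1 h2
    -- Each vertex is labelled with the southern vertex that it reaches, directly or through one
    -- line of `D`, if any. The label is constant on components, so no component contains two
    -- southern vertices.
    let gm : Fin m → Option (Fin p) := fun i => (E.mate (.inl i)).getRight?
    let g : Fin n ⊕ (Fin m ⊕ Fin p) → Option (Fin p) :=
      Sum.elim (fun i => (D.mate (.inl i)).elim (fun _ => none) gm) (Sum.elim gm some)
    have e := eq_of_comp_eq (D := D) (E := E) g (by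
      rintro (i | i)
      · rcases hi : D.mate (.inl i) with i' | i'
        · have : D.mate (.inl i') = .inl i := by rw [← hi, hDp.mate_mate]
          simp [fstPt, g, hi, this]
        · simp [fstPt, g, hi]
      · obtain ⟨i', hi⟩ := hD i
        have : D.mate (.inl i') = .inr i := by rw [← hi, hDp.mate_mate]
        simp [fstPt, g, hi, this]) (by
      rintro (i | i)
      · rcases hi : E.mate (.inl i) with i' | i'
        · have : E.mate (.inl i') = .inl i := by rw [← hi, hEp.mate_mate]
          simp [sndPt, g, gm, hi, this]
        · simp [sndPt, g, gm, hi]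
      · obtain ⟨i', hi⟩ := hE i
        have : E.mate (.inl i') = .inr i := by rw [← hi, hEp.mate_mate]
        simp [sndPt, g, gm, hi, this]) h2
    simp only [outerPt, Sum.map_inr, g, Sum.elim_inr, Option.some.injEq] at e
    exact h1 (by rw [e])

theorem AllPropagating.le (h : D.AllPropagating) (hD : D.IsPairing) : m ≤ n := by
  choose f hf using h
  have : Function.Injective f := fun a b hab => by
    have := (hf a).trans ((congrArg Sum.inl hab).trans (hf b).symm)
    exact Sum.inr_injective (hD.mate_injective this)
  simpa using Fintype.card_le_of_injective f this

theorem IsPairing.even_add (hD : D.IsPairing) : Even (n + m) := by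
  have := hD.even_card (fun _ => True) fun _ => Iff.rfl
  simp only [if_true, Finset.sum_const, Finset.card_univ, Fintype.card_sum, Fintype.card_fin,
    nsmul_eq_mul, mul_one] at this
  exact (ZMod.natCast_eq_zero_iff_even).1 this

/-- A planar diagram with `n` northern vertices and `n` propagating lines is made of vertical
lines. -/
theorem AllPropagating.mate_inr {D : RawDiagram n n} (h : D.AllPropagating) (hD : D.IsDiagram)
    (j : Fin n) : D.mate (.inr j) = .inl j := by
  choose f hf using h
  have hf' : ∀ j, D.mate (.inl (f j)) = .inr j := fun j => by rw [← hf, hD.mate_mate]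
  have inj : Function.Injective f := fun a b hab => by
    have := (hf a).trans ((congrArg Sum.inl hab).trans (hf b).symm)
    exact Sum.inr_injective (hD.isPairing.mate_injective this)
  -- Propagating lines in the wrong order would cross; a strictly monotone bijection of `Fin n` is
  -- the identity.
  have mono : StrictMono f := by
    intro a b hab
    by_contra hlt
    have hne : f b < f a := lt_of_le_of_ne (not_lt.1 hlt) fun h => hab.ne' (inj h)
    refine hD.noncrossing (.inl (f b)) (.inl (f a)) ⟨hne, ?_, ?_⟩
    · rw [hf']; simp only [pos]; omega
    · rw [hf', hf']
      simp only [pos, Fin.val_rev]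
      have := b.2
      have : (a : ℕ) < b := hab
      omega
  have : f = id := by
    refine mono.range_inj strictMono_id |>.1 ?_
    rw [Set.range_id, (Finite.injective_iff_surjective.1 inj).range_eq]
  rw [hf, this, id]

theorem AllPropagating.mate_inl {D : RawDiagram n n} (h : D.AllPropagating) (hD : D.IsDiagram)
    (j : Fin n) : D.mate (.inl j) = .inr j := by
  rw [← h.mate_inr hD, hD.mate_mate]

/-- Among vertical lines only the westernmost one is exposed, so there is at most one blob, and
evenness excludes it. -/
theorem AllPropagating.eq_idDiagram {D : RawDiagram n n} (h : D.AllPropagating)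
    (hD : D.IsDiagram) (he : Even D.numBlobs) : D = idDiagram n := by
  have hm : D.mate = Sum.swap := by
    funext x
    rcases x with x | x
    · exact h.mate_inl hD x
    · exact h.mate_inr hD x
  have key : ∀ i : Fin n, D.blob (.inl i) = false := by
    intro i
    by_contra hb
    rw [Bool.not_eq_false] at hb
    have h0 : ∀ k : Fin n, D.blob (.inl k) = true → (k : ℕ) = 0 := by
      intro k hk
      by_contra hk0
      refine hD.exposed _ hk (.inl ⟨0, by omega⟩) ⟨?_, ?_⟩
      · simp only [pos]; omega
      · rw [h.mate_inl hD]; simp only [pos]; omega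
    have : D.numBlobs = 1 := by
      rw [numBlobs, Nat.card_eq_one_iff_unique]
      refine ⟨⟨?_⟩, ⟨⟨.inl i, hb, ?_⟩⟩⟩
      · rintro ⟨x, hx, hx'⟩ ⟨y, hy, hy'⟩
        have hn : ∀ x : Fin n ⊕ Fin n, D.blob x = true → pos x < pos (D.mate x) →
            x = .inl i := by
          rintro (x | x) h1 h2
          · exact congrArg _ (Fin.ext ((h0 x h1).trans (h0 i hb).symm))
          · rw [h.mate_inr hD] at h2
            simp only [pos] at h2
            omega
        rw [Subtype.mk.injEq, hn x hx hx', hn y hy hy']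
      · rw [h.mate_inl hD]; simp only [pos]; omega
    rw [this] at he
    exact absurd he (by decide)
  refine RawDiagram.ext hm (funext fun x => ?_)
  rcases x with x | x
  · exact key x
  · rw [← h.mate_inl hD, hD.blob_mate, key]; rfl

/-- Every middle vertex is joined to the northern edge by `D`, so no component avoids the outer
vertices. -/
theorem numLoops_eq_zero_of_fst (h : D.AllPropagating) :
    numLoops D E = 0 ∧ ¬ HasOddLoop D E := by
  have key : ∀ K, ¬ IsLoop D E K := by
    intro K hK
    obtain ⟨z, rfl⟩ := comp_surjective K
    rcases z with i | j | k
    · exact hK (.inl i) rfl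
    · obtain ⟨i, hi⟩ := h j
      refine hK (.inl i) ?_
      have := comp_fst (D := D) (E := E) (.inr j)
      rw [hi] at this
      exact this
    · exact hK (.inr k) rfl
  refine ⟨?_, fun ⟨K, hK, _⟩ => key K hK⟩
  rw [numLoops, Nat.card_eq_zero]
  exact Or.inl ⟨fun K => key K.1 K.2⟩

end Propagating

end RawDiagram

/-! ### Adding lines, bending lines, reflecting: effect on planarity, matrices and parity -/

namespace RawDiagram

section Operations

variable {n m p : ℕ}

/-! #### Adding a line -/

/-- The vertices of a diagram among the vertices after adding a line at the eastern end. -/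
def incl : Fin n ⊕ Fin m → Fin (n + 1) ⊕ Fin (m + 1) := Sum.map Fin.castSucc Fin.castSucc

theorem incl_injective : Function.Injective (incl : Fin n ⊕ Fin m → _) :=
  Sum.map_injective.2 ⟨Fin.castSucc_injective _, Fin.castSucc_injective _⟩

theorem incl_cases {motive : Fin (n + 1) ⊕ Fin (m + 1) → Prop} (h1 : motive (.inl (Fin.last n)))
    (h2 : motive (.inr (Fin.last m))) (h3 : ∀ x, motive (incl x)) (x) : motive x := by
  rcases x with x | x
  · induction x using Fin.lastCases with
    | last => exact h1
    | cast i => exact h3 (.inl i)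
  · induction x using Fin.lastCases with
    | last => exact h2
    | cast i => exact h3 (.inr i)

/-- In the reading order, the two ends of the new line are inserted at positions `n` and `n + 1`. -/
theorem pos_incl (x : Fin n ⊕ Fin m) :
    pos x < n ∧ pos (incl x) = pos x ∨ n ≤ pos x ∧ pos (incl x) = pos x + 2 := by
  rcases x with x | x
  · exact Or.inl ⟨x.2, rfl⟩
  · right
    simp only [pos, incl, Sum.map_inr, Fin.val_rev, Fin.val_castSucc]
    have := x.2
    omega

theorem pos_inl_last : pos (.inl (Fin.last n) : Fin (n + 1) ⊕ Fin m) = n := rfl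

theorem pos_inr_last : pos (.inr (Fin.last m) : Fin n ⊕ Fin (m + 1)) = n := by
  simp [pos]

variable (b : Bool) (D : RawDiagram n m)

@[simp] theorem addLine_mate_incl (x) : (addLine b D).mate (incl x) = incl (D.mate x) := by
  rcases x with x | x <;> simp [addLine, incl]

@[simp] theorem addLine_blob_incl (x) : (addLine b D).blob (incl x) = D.blob x := by
  rcases x with x | x <;> simp [addLine, incl]

@[simp] theorem addLine_mate_inl_last :
    (addLine b D).mate (.inl (Fin.last n)) = .inr (Fin.last m) := by simp [addLine]

@[simp] theorem addLine_mate_inr_last :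
    (addLine b D).mate (.inr (Fin.last m)) = .inl (Fin.last n) := by simp [addLine]

@[simp] theorem addLine_blob_inl_last : (addLine b D).blob (.inl (Fin.last n)) = b := by
  simp [addLine]

@[simp] theorem addLine_blob_inr_last : (addLine b D).blob (.inr (Fin.last m)) = b := by
  simp [addLine]

variable {b D}

/-- A blob is admitted only for `m = 0`: then no other line reaches the south, and the new line is
exposed to the west. -/
theorem addLine_isDiagram (hD : D.IsDiagram) (hb : b = true → m = 0) :
    (addLine b D).IsDiagram where
  mate_mate x := by
    induction x using incl_cases with
    | h1 => simp
    | h2 => simp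
    | h3 x => simp [hD.mate_mate]
  mate_ne x := by
    induction x using incl_cases with
    | h1 => simp
    | h2 => simp
    | h3 x =>
      rw [addLine_mate_incl]
      exact fun h => hD.mate_ne x (incl_injective h)
  noncrossing x y := by
    induction x using incl_cases with
    | h1 =>
      simp only [addLine_mate_inl_last, pos_inl_last, pos_inr_last]
      omega
    | h2 =>
      simp only [addLine_mate_inr_last, pos_inl_last, pos_inr_last]
      omega
    | h3 x =>
      induction y using incl_cases with
      | h1 =>
        simp only [addLine_mate_inl_last, addLine_mate_incl, pos_inl_last, pos_inr_last]
        have := pos_incl (D.mate x)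
        omega
      | h2 =>
        simp only [addLine_mate_inr_last, addLine_mate_incl, pos_inl_last, pos_inr_last]
        have := pos_incl (D.mate x)
        omega
      | h3 y =>
        simp only [addLine_mate_incl]
        have h1 := pos_incl (D.mate x)
        have h2 := pos_incl (D.mate y)
        have h3 := pos_incl x
        have h4 := pos_incl y
        have := hD.noncrossing x y
        omega
  blob_mate x := by
    induction x using incl_cases with
    | h1 => simp
    | h2 => simp
    | h3 x => simp [hD.blob_mate]
  exposed x hx y := by
    induction x using incl_cases with
    | h1 =>
      rw [addLine_blob_inl_last] at hx
      obtain rfl := hb hx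
      simp only [pos_inl_last]
      induction y using incl_cases with
      | h1 => simp only [addLine_mate_inl_last, pos_inl_last]; omega
      | h2 => simp only [addLine_mate_inr_last, pos_inr_last, pos_inl_last]; omega
      | h3 y =>
        rcases hy : D.mate y with i | i
        · rw [addLine_mate_incl, hy]
          have := pos_incl (Sum.inl i : Fin n ⊕ Fin 0)
          have := i.2
          simp only [pos] at *
          omega
        · exact i.elim0
    | h2 =>
      rw [addLine_blob_inr_last] at hx
      obtain rfl := hb hx
      simp only [pos_inr_last]
      generalize (addLine b D).mate y = z
      rcases z with z | z <;> simp only [pos] <;> omega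
    | h3 x =>
      rw [addLine_blob_incl] at hx
      have h3 := pos_incl x
      induction y using incl_cases with
      | h1 =>
        simp only [addLine_mate_inl_last, pos_inl_last, pos_inr_last]
        omega
      | h2 =>
        simp only [addLine_mate_inr_last, pos_inl_last, pos_inr_last]
        omega
      | h3 y =>
        simp only [addLine_mate_incl]
        have h1 := pos_incl (D.mate y)
        have h2 := pos_incl y
        have := hD.exposed x hx y
        omega

theorem elim_snoc_incl (c : Fin n → ZMod 2) (c' : Fin m → ZMod 2) (a a' : ZMod 2) (x) :
    Sum.elim (Fin.snoc c a : Fin (n + 1) → ZMod 2) (Fin.snoc c' a' : Fin (m + 1) → ZMod 2)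
      (incl x) = Sum.elim c c' x := by
  rcases x with x | x <;> simp [incl]

theorem addLine_isColoring {c : Fin n → ZMod 2} {c' : Fin m → ZMod 2} {a a' : ZMod 2} :
    (addLine b D).IsColoring (Sum.elim (Fin.snoc c a : Fin (n + 1) → ZMod 2)
      (Fin.snoc c' a' : Fin (m + 1) → ZMod 2)) ↔
      a' = a + bit b ∧ D.IsColoring (Sum.elim c c') := by
  constructor
  · intro h
    refine ⟨by simpa using h (.inl (Fin.last n)), fun x => ?_⟩
    have := h (incl x)
    rwa [addLine_mate_incl, addLine_blob_incl, elim_snoc_incl, elim_snoc_incl] at this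
  · rintro ⟨rfl, h⟩ x
    induction x using incl_cases with
    | h1 => simp
    | h2 => simp [add_assoc, zmod_two_add_self]
    | h3 x => rw [addLine_mate_incl, addLine_blob_incl, elim_snoc_incl, elim_snoc_incl, h x]

theorem addLine_mat (c : Fin n → ZMod 2) (c' : Fin m → ZMod 2) (a a' : ZMod 2) :
    (addLine b D).mat (Fin.snoc c a : Fin (n + 1) → ZMod 2)
      (Fin.snoc c' a' : Fin (m + 1) → ZMod 2) = if a' = a + bit b then D.mat c c' else 0 := by
  classical
  simp only [mat, addLine_isColoring, ite_and]

theorem addLine_allPropagating : (addLine b D).AllPropagating ↔ D.AllPropagating := by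
  constructor
  · intro h j
    obtain ⟨i, hi⟩ := h j.castSucc
    change (addLine b D).mate (incl (.inr j)) = _ at hi
    rw [addLine_mate_incl] at hi
    rcases hj : D.mate (.inr j) with i' | j'
    · exact ⟨i', rfl⟩
    · rw [hj] at hi; simp [incl] at hi
  · intro h j
    induction j using Fin.lastCases with
    | last => exact ⟨_, addLine_mate_inr_last b D⟩
    | cast j =>
      obtain ⟨i, hi⟩ := h j
      exact ⟨i.castSucc, by
        change (addLine b D).mate (incl (.inr j)) = _
        rw [addLine_mate_incl, hi]; rfl⟩

theorem addLine_injective {D' : RawDiagram n m} (h : addLine b D = addLine b D') : D = D' := by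
  refine RawDiagram.ext (funext fun x => incl_injective ?_) (funext fun x => ?_)
  · rw [← addLine_mate_incl b, ← addLine_mate_incl b, h]
  · rw [← addLine_blob_incl b, h, addLine_blob_incl]

/-- A diagram with a vertical line at the eastern end is obtained by adding this line. -/
theorem exists_eq_addLine {g : RawDiagram (n + 1) (m + 1)} (hg : g.IsDiagram)
    (h : g.mate (.inl (Fin.last n)) = .inr (Fin.last m)) :
    ∃ D : RawDiagram n m, D.IsDiagram ∧ g = addLine (g.blob (.inl (Fin.last n))) D := by
  have h' : g.mate (.inr (Fin.last m)) = .inl (Fin.last n) := by rw [← h, hg.mate_mate]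
  have : ∀ x : Fin n ⊕ Fin m, ∃ y : Fin n ⊕ Fin m, g.mate (incl x) = incl y := by
    intro x
    generalize hz : g.mate (incl x) = z
    induction z using incl_cases with
    | h1 =>
      have := hg.mate_mate (incl x)
      rw [hz, h] at this
      rcases x with x | x <;> simp [incl] at this
      exact absurd this (Fin.castSucc_lt_last x).ne'
    | h2 =>
      have := hg.mate_mate (incl x)
      rw [hz, h'] at this
      rcases x with x | x <;> simp [incl] at this
      exact absurd this (Fin.castSucc_lt_last x).ne'
    | h3 y => exact ⟨y, rfl⟩
  choose f hf using this
  refine ⟨⟨f, fun x => g.blob (incl x)⟩, ?_, ?_⟩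
  · refine ⟨fun x => incl_injective ?_, fun x hx => ?_, fun x y => ?_, fun x => ?_, fun x hx y => ?_⟩
    · rw [← hf, ← hf, hg.mate_mate]
    · exact hg.mate_ne (incl x) (by rw [hf]; exact congrArg _ hx)
    · have := hg.noncrossing (incl x) (incl y)
      rw [hf, hf] at this
      have h1 := pos_incl x
      have h2 := pos_incl y
      have h3 := pos_incl (f x)
      have h4 := pos_incl (f y)
      simp only
      omega
    · change g.blob (incl (f x)) = _
      rw [← hf, hg.blob_mate]
    · have := hg.exposed (incl x) hx (incl y)
      rw [hf] at this
      have h1 := pos_incl x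
      have h2 := pos_incl y
      have h4 := pos_incl (f y)
      simp only
      omega
  · refine RawDiagram.ext (funext fun x => ?_) (funext fun x => ?_)
    · induction x using incl_cases with
      | h1 => simp [h]
      | h2 => simp [h']
      | h3 x => simp [hf]
    · induction x using incl_cases with
      | h1 => simp
      | h2 => rw [addLine_blob_inr_last, ← h, hg.blob_mate]
      | h3 x => simp

/-! #### Bending a line -/

@[simp] theorem unbendPt_bendPt (x : Fin n ⊕ Fin (m + 1)) : unbendPt (bendPt x) = x := by
  rcases x with x | x
  · simp [bendPt, unbendPt]
  · induction x using Fin.lastCases <;> simp [bendPt, unbendPt]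

@[simp] theorem bendPt_unbendPt (x : Fin (n + 1) ⊕ Fin m) : bendPt (unbendPt x) = x := by
  rcases x with x | x
  · induction x using Fin.lastCases <;> simp [bendPt, unbendPt]
  · simp [bendPt, unbendPt]

theorem bendPt_injective : Function.Injective (bendPt : Fin n ⊕ Fin (m + 1) → _) :=
  Function.LeftInverse.injective unbendPt_bendPt

theorem unbendPt_injective : Function.Injective (unbendPt : Fin (n + 1) ⊕ Fin m → _) :=
  Function.LeftInverse.injective bendPt_unbendPt

theorem bendPt_last : (bendPt (.inr (Fin.last m)) : Fin (n + 1) ⊕ Fin m) = .inl (Fin.last n) := by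
  simp [bendPt]

theorem unbendPt_last :
    (unbendPt (.inl (Fin.last n)) : Fin n ⊕ Fin (m + 1)) = .inr (Fin.last m) := by
  simp [unbendPt]

theorem pos_bendPt (x : Fin n ⊕ Fin (m + 1)) : pos (bendPt x) = pos x := by
  rcases x with x | x
  · rfl
  · induction x using Fin.lastCases with
    | last => simp [bendPt, pos]
    | cast x =>
      simp only [bendPt, pos, Fin.lastCases_castSucc, Fin.val_rev, Fin.val_castSucc]
      have := x.2
      omega

theorem pos_unbendPt (x : Fin (n + 1) ⊕ Fin m) : pos (unbendPt x) = pos x := by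
  rw [← pos_bendPt, bendPt_unbendPt]

/-- The inverse of `bend`. -/
def unbend (b : Bool) (g : RawDiagram (n + 1) m) : RawDiagram n (m + 1) where
  mate x := unbendPt (g.mate (bendPt x))
  blob x := xor (g.blob (bendPt x))
    (b && decide (bendPt x = .inl (Fin.last n) ∨ g.mate (bendPt x) = .inl (Fin.last n)))

theorem bend_unbend (b : Bool) (g : RawDiagram (n + 1) m) : bend b (unbend b g) = g := by
  refine RawDiagram.ext (funext fun x => ?_) (funext fun x => ?_)
  · simp [bend, unbend]
  · simp only [bend, unbend, bendPt_unbendPt, ← unbendPt_last, unbendPt_injective.eq_iff]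
    rw [Bool.xor_assoc, Bool.xor_self, Bool.xor_false]

theorem unbend_bend (b : Bool) (D : RawDiagram n (m + 1)) : unbend b (bend b D) = D := by
  refine RawDiagram.ext (funext fun x => ?_) (funext fun x => ?_)
  · simp [bend, unbend]
  · simp only [bend, unbend, unbendPt_bendPt, ← bendPt_last, bendPt_injective.eq_iff]
    rw [Bool.xor_assoc, Bool.xor_self, Bool.xor_false]

/-- The last vertex lies on an exposed arc. -/
theorem IsDiagram.exposed_last (hD : D.IsDiagram) {z} (hz : ∀ y : Fin n ⊕ Fin m, pos y ≤ pos z)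
    {x} (hx : x = z ∨ D.mate x = z) (y) : ¬ (pos y < pos x ∧ pos x < pos (D.mate y)) := by
  rintro ⟨h1, h2⟩
  rcases hx with rfl | rfl
  · have := hz (D.mate y)
    omega
  · have h3 := hD.noncrossing y x
    have h4 := hz (D.mate y)
    have : D.mate y = D.mate x := pos_injective (by omega)
    have := hD.isPairing.mate_injective this
    rw [this] at h1
    omega

/-- Bending leaves the reading order unchanged (`pos_bendPt`), so planarity carries over verbatim.
For `m = 0` the bent vertex is the last one, hence its arc is exposed and may receive a blob. -/
theorem bend_isDiagram {D : RawDiagram n (m + 1)} (hD : D.IsDiagram) (hb : b = true → m = 0) :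
    (bend b D).IsDiagram where
  mate_mate x := by simp [bend, hD.mate_mate]
  mate_ne x h := hD.mate_ne (unbendPt x) (bendPt_injective (by simpa [bend] using h))
  noncrossing x y := by
    have := hD.noncrossing (unbendPt x) (unbendPt y)
    simpa only [bend, pos_bendPt, pos_unbendPt] using this
  blob_mate x := by
    simp only [bend, unbendPt_bendPt, hD.blob_mate, hD.mate_mate]
    rw [Bool.decide_congr or_comm]
  exposed x hx y := by
    have key : ∀ y, ¬ (pos y < pos (unbendPt x) ∧ pos (unbendPt x) < pos (D.mate y)) := by
      by_cases h : D.blob (unbendPt x) = true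
      · exact hD.exposed _ h
      · simp only [bend, Bool.eq_false_iff.2 h, Bool.false_xor, Bool.and_eq_true,
          decide_eq_true_eq] at hx
        obtain rfl := hb hx.1
        refine hD.exposed_last ?_ hx.2
        rintro (y | y)
        · simp only [pos]; omega
        · simp only [pos]; omega
    have := key (unbendPt y)
    simpa only [bend, pos_bendPt, pos_unbendPt] using this

theorem unbend_isDiagram {g : RawDiagram (n + 1) m} (hg : g.IsDiagram) (hb : b = true → m = 0) :
    (unbend b g).IsDiagram where
  mate_mate x := by simp [unbend, hg.mate_mate]
  mate_ne x h := hg.mate_ne (bendPt x) (unbendPt_injective (by simpa [unbend] using h))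
  noncrossing x y := by
    have := hg.noncrossing (bendPt x) (bendPt y)
    simpa only [unbend, pos_bendPt, pos_unbendPt] using this
  blob_mate x := by
    simp only [unbend, bendPt_unbendPt, hg.blob_mate, hg.mate_mate]
    rw [Bool.decide_congr or_comm]
  exposed x hx y := by
    have key : ∀ y, ¬ (pos y < pos (bendPt x) ∧ pos (bendPt x) < pos (g.mate y)) := by
      by_cases h : g.blob (bendPt x) = true
      · exact hg.exposed _ h
      · simp only [unbend, Bool.eq_false_iff.2 h, Bool.false_xor, Bool.and_eq_true,
          decide_eq_true_eq] at hx
        obtain rfl := hb hx.1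
        refine hg.exposed_last ?_ hx.2
        rintro (y | y)
        · simp only [pos, Fin.val_last]; omega
        · exact y.elim0
    have := key (bendPt y)
    simpa only [unbend, pos_bendPt, pos_unbendPt] using this

/-- An additional blob on the bent arc amounts to shifting the colour of the vertex that moves. -/
theorem bend_isColoring {D : RawDiagram n (m + 1)} (hD : D.IsPairing) {c : Fin n → ZMod 2}
    {c' : Fin m → ZMod 2} {a : ZMod 2} :
    (bend b D).IsColoring (Sum.elim (Fin.snoc c a : Fin (n + 1) → ZMod 2) c') ↔
      D.IsColoring (Sum.elim c (Fin.snoc c' (a + bit b) : Fin (m + 1) → ZMod 2)) := by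
  have e : ∀ x, Sum.elim (Fin.snoc c a : Fin (n + 1) → ZMod 2) c' (bendPt x) =
      Sum.elim c (Fin.snoc c' (a + bit b) : Fin (m + 1) → ZMod 2) x +
        bit (b && decide (x = .inr (Fin.last m))) := by
    rintro (x | x)
    · simp [bendPt]
    · induction x using Fin.lastCases with
      | last => simp [bendPt, add_assoc, zmod_two_add_self]
      | cast x => simp [bendPt, (Fin.castSucc_lt_last x).ne]
  have key : ∀ x, (Sum.elim (Fin.snoc c a : Fin (n + 1) → ZMod 2) c'
      ((bend b D).mate (bendPt x)) = Sum.elim (Fin.snoc c a : Fin (n + 1) → ZMod 2) c' (bendPt x) +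
        bit ((bend b D).blob (bendPt x))) ↔
      (Sum.elim c (Fin.snoc c' (a + bit b) : Fin (m + 1) → ZMod 2) (D.mate x) =
        Sum.elim c (Fin.snoc c' (a + bit b) : Fin (m + 1) → ZMod 2) x + bit (D.blob x)) := by
    intro x
    simp only [bend, unbendPt_bendPt, e, bit_xor]
    -- The two alternatives exclude each other since `mate` has no fixed points, so the disjunction
    -- is a sum modulo 2.
    have h : bit (b && decide (x = .inr (Fin.last m) ∨ D.mate x = .inr (Fin.last m))) =
        bit (b && decide (x = .inr (Fin.last m))) +
          bit (b && decide (D.mate x = .inr (Fin.last m))) := by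
      rw [← bit_xor, ← Bool.and_xor_distrib_left]
      congr 2
      by_cases h1 : x = .inr (Fin.last m)
      · have := hD.mate_ne x
        rw [h1] at this
        simp [h1, this]
      · simp [h1]
    rw [h]
    have h2 := zmod_two_add_self (bit (b && decide (x = .inr (Fin.last m))))
    constructor
    · intro h; linear_combination h + h2
    · intro h; linear_combination h - h2
  constructor
  · intro h x
    exact (key x).1 (h (bendPt x))
  · intro h x
    have := (key (unbendPt x)).2 (h _)
    rwa [bendPt_unbendPt] at this

theorem bend_mat {D : RawDiagram n (m + 1)} (hD : D.IsPairing) (c : Fin n → ZMod 2)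
    (c' : Fin m → ZMod 2) (a : ZMod 2) :
    (bend b D).mat (Fin.snoc c a : Fin (n + 1) → ZMod 2) c' =
      D.mat c (Fin.snoc c' (a + bit b) : Fin (m + 1) → ZMod 2) := by
  classical
  simp only [mat, bend_isColoring hD]

theorem bend_allPropagating {D : RawDiagram n (m + 1)} (h : D.AllPropagating) :
    (bend b D).AllPropagating := by
  intro j
  obtain ⟨i, hi⟩ := h j.castSucc
  exact ⟨i.castSucc, by simp [bend, unbendPt, hi, bendPt]⟩

theorem unbend_allPropagating {g : RawDiagram (n + 1) m} (hg : g.IsPairing)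
    (h : g.AllPropagating) {i : Fin n} (hi : g.mate (.inl (Fin.last n)) = .inl i.castSucc) :
    (unbend b g).AllPropagating := by
  intro j
  induction j using Fin.lastCases with
  | last => exact ⟨i, by simp [unbend, bendPt_last, hi, unbendPt]⟩
  | cast j =>
    obtain ⟨k, hk⟩ := h j
    induction k using Fin.lastCases with
    | last =>
      have := hg.mate_mate (.inr j)
      rw [hk, hi] at this
      simp at this
    | cast k => exact ⟨k, by simp [unbend, bendPt, hk, unbendPt]⟩

/-! #### Reflection -/

/-- Reflection in a horizontal line. -/
def flip (D : RawDiagram n m) : RawDiagram m n where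
  mate x := (D.mate x.swap).swap
  blob x := D.blob x.swap

theorem pos_swap (x : Fin n ⊕ Fin m) : pos x + pos x.swap + 1 = n + m := by
  rcases x with x | x
  · rw [Sum.swap_inl]; simp only [pos, Fin.val_rev]; omega
  · rw [Sum.swap_inr]; simp only [pos, Fin.val_rev]; omega

theorem flip_isDiagram (hD : D.IsDiagram) : (flip D).IsDiagram where
  mate_mate x := by simp [flip, hD.mate_mate]
  mate_ne x h := hD.mate_ne x.swap (by
    have := congrArg Sum.swap h
    simpa [flip] using this)
  noncrossing x y := by
    have h1 := pos_swap x
    have h2 := pos_swap y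
    have h3 := pos_swap (D.mate x.swap)
    have h4 := pos_swap (D.mate y.swap)
    have := hD.noncrossing (D.mate y.swap) (D.mate x.swap)
    simp only [hD.mate_mate] at this
    simp only [flip]
    omega
  blob_mate x := by simp [flip, hD.blob_mate]
  exposed x hx y := by
    have h1 := pos_swap x
    have h2 := pos_swap y
    have h4 := pos_swap (D.mate y.swap)
    have := hD.exposed x.swap hx (D.mate y.swap)
    simp only [hD.mate_mate] at this
    simp only [flip]
    omega

theorem flip_mat : (flip D).mat = D.mat.transpose := by
  classical
  ext c c'
  rw [Matrix.transpose_apply]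
  simp only [mat]
  have e : ∀ x, Sum.elim c c' x = Sum.elim c' c x.swap := by rintro (x | x) <;> rfl
  refine if_congr ⟨fun h x => ?_, fun h x => ?_⟩ rfl rfl
  · have := h x.swap
    simpa [e, flip] using this
  · have := h x.swap
    simpa [e, flip] using this

theorem idDiagram_isDiagram (n : ℕ) : (idDiagram n).IsDiagram where
  mate_mate x := by simp [idDiagram]
  mate_ne x := by rcases x with x | x <;> simp [idDiagram]
  noncrossing x y := by
    have h1 := pos_swap x
    have h2 := pos_swap y
    simp only [idDiagram]
    omega
  blob_mate x := rfl
  exposed x hx := by simp [idDiagram] at hx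

theorem idDiagram_mat (n : ℕ) : (idDiagram n).mat = 1 := by
  ext c c'
  by_cases h : c = c'
  · subst h
    rw [Matrix.one_apply_eq, mat_eq_one]
    rintro (x | x) <;> simp [idDiagram]
  · rw [Matrix.one_apply_ne h, mat_eq_zero]
    refine fun h' => h (funext fun i => ?_)
    have := h' (.inr i)
    simpa [idDiagram] using this

theorem idDiagram_allPropagating (n : ℕ) : (idDiagram n).AllPropagating := fun j => ⟨j, rfl⟩

theorem idDiagram_numBlobs (n : ℕ) : (idDiagram n).numBlobs = 0 := by
  rw [numBlobs, Nat.card_eq_zero]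
  exact Or.inl ⟨fun x => by simpa [idDiagram] using x.2.1⟩

/-! #### Parity of the number of blobs -/

theorem addLine_numBlobs (hD : D.IsDiagram) (hb : b = true → m = 0) :
    ((addLine b D).numBlobs : ZMod 2) = D.numBlobs + bit b := by
  obtain ⟨c, hc⟩ := hD.isPairing.exists_isColoring
  obtain ⟨x, y, rfl⟩ := elim_surj c
  rw [hD.isPairing.numBlobs_eq hc, (addLine_isDiagram hD hb).isPairing.numBlobs_eq
    (addLine_isColoring.2 ⟨rfl, hc⟩ : (addLine b D).IsColoring (Sum.elim (Fin.snoc x 0) _))]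
  simp [Fintype.sum_sum_type, Fin.sum_univ_castSucc, add_assoc]

theorem bend_numBlobs {D : RawDiagram n (m + 1)} (hD : D.IsDiagram) (hb : b = true → m = 0) :
    ((bend b D).numBlobs : ZMod 2) = D.numBlobs + bit b := by
  obtain ⟨c, hc⟩ := hD.isPairing.exists_isColoring
  obtain ⟨x, y, rfl⟩ := elim_surj c
  -- The last colour is written as a shift by `bit b` to match the right-hand side of
  -- `bend_isColoring`.
  have hy : y = Fin.snoc (Fin.init y) ((y (Fin.last m) + bit b) + bit b) := by
    rw [add_assoc, zmod_two_add_self, add_zero, Fin.snoc_init_self]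
  rw [hy] at hc
  rw [hD.isPairing.numBlobs_eq hc, (bend_isDiagram hD hb).isPairing.numBlobs_eq
    ((bend_isColoring hD.isPairing).2 hc)]
  simp only [Fintype.sum_sum_type, Fin.sum_univ_castSucc, Sum.elim_inl, Sum.elim_inr,
    Fin.snoc_castSucc, Fin.snoc_last]
  linear_combination -zmod_two_add_self (bit b)

theorem flip_numBlobs (hD : D.IsDiagram) : ((flip D).numBlobs : ZMod 2) = D.numBlobs := by
  obtain ⟨c, hc⟩ := hD.isPairing.exists_isColoring
  obtain ⟨x, y, rfl⟩ := elim_surj c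
  have : (flip D).IsColoring (Sum.elim y x) := by
    rw [← mat_apply_eq_one_iff, flip_mat, Matrix.transpose_apply, mat_apply_eq_one_iff]
    exact hc
  rw [hD.isPairing.numBlobs_eq hc, (flip_isDiagram hD).isPairing.numBlobs_eq this]
  simp only [Fintype.sum_sum_type, Sum.elim_inl, Sum.elim_inr]
  exact add_comm _ _

/-! #### Products of matrices -/

theorem sum_snoc {M : Type*} [AddCommMonoid M] (f : (Fin (n + 1) → ZMod 2) → M) :
    ∑ c, f c = ∑ c : Fin n → ZMod 2, ∑ a : ZMod 2, f (Fin.snoc c a : Fin (n + 1) → ZMod 2) := by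
  rw [← Equiv.sum_comp (Fin.snocEquiv fun _ => ZMod 2), Fintype.sum_prod_type, Finset.sum_comm]
  rfl

theorem snoc_surj (c : Fin (n + 1) → ZMod 2) :
    ∃ (d : Fin n → ZMod 2) (a : ZMod 2), c = (Fin.snoc d a : Fin (n + 1) → ZMod 2) :=
  ⟨Fin.init c, c (Fin.last n), (Fin.snoc_init_self c).symm⟩

/-- Adding a line tensors the matrix with that of a single line, the identity or the swap according
to the blob. The factor `r` is arbitrary so that `r = 0` covers odd loops. -/
theorem addLine_mat_mul {E : RawDiagram m p} {C : RawDiagram n p} {r : ℕ}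
    (h : D.mat * E.mat = r • C.mat) (b b' : Bool) :
    (addLine b D).mat * (addLine b' E).mat = r • (addLine (xor b b') C).mat := by
  ext c c''
  obtain ⟨c, a, rfl⟩ := snoc_surj c
  obtain ⟨c'', a'', rfl⟩ := snoc_surj c''
  have h1 := congrFun (congrFun h c) c''
  rw [Matrix.mul_apply, Matrix.smul_apply] at h1
  rw [Matrix.mul_apply, Matrix.smul_apply, addLine_mat, smul_ite, smul_zero, ← h1, sum_snoc]
  simp only [addLine_mat, bit_xor, ← add_assoc, ite_mul, zero_mul, Finset.sum_ite_eq',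
    Finset.mem_univ, if_true]
  split_ifs
  · rfl
  · simp

/-- Bending turns a column index into a row index, and the undecorated line added to `D` acts on
this index as the identity. -/
theorem addLine_mat_mul_bend {E : RawDiagram m (p + 1)} {C : RawDiagram n (p + 1)} {r : ℕ}
    (hE : E.IsPairing) (hC : C.IsPairing) (h : D.mat * E.mat = r • C.mat) (b : Bool) :
    (addLine false D).mat * (bend b E).mat = r • (bend b C).mat := by
  ext c c''
  obtain ⟨c, a, rfl⟩ := snoc_surj c
  have h1 := congrFun (congrFun h c) (Fin.snoc c'' (a + bit b))
  rw [Matrix.mul_apply, Matrix.smul_apply] at h1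
  rw [Matrix.mul_apply, Matrix.smul_apply, bend_mat hC, ← h1, sum_snoc]
  simp only [addLine_mat, bend_mat hE, bit_false, add_zero, ite_mul, zero_mul,
    Finset.sum_ite_eq', Finset.mem_univ, if_true]

end Operations

end RawDiagram

/-! ### Associativity of concatenation -/

namespace RawDiagram

section Assoc

variable {n m p q : ℕ} {D : RawDiagram n m} {E : RawDiagram m p} {F : RawDiagram p q}

theorem smul_eq_zero_iff_of_pow {α β : Type*} {A : Matrix α β ℕ} {r : ℕ} : 2 ^ r • A = 0 ↔ A = 0 := by
  constructor
  · intro h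
    ext i j
    have := congrFun (congrFun h i) j
    simpa using this
  · rintro rfl; simp

theorem hasOddLoop_concat_right (hD : D.IsPairing) (hE : E.IsPairing) (hF : F.IsPairing)
    (h1 : HasOddLoop D E) (h2 : ¬ HasOddLoop E F) : HasOddLoop D (concat E F) := by
  rw [hasOddLoop_iff hD (concat_isPairing hE hF)]
  rw [← smul_eq_zero_iff_of_pow (r := numLoops E F), ← Matrix.mul_smul, ← mat_mul hE hF h2,
    ← Matrix.mul_assoc, mat_mul_of_odd hD hE h1, Matrix.zero_mul]

theorem hasOddLoop_concat_left (hD : D.IsPairing) (hE : E.IsPairing) (hF : F.IsPairing)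
    (h1 : ¬ HasOddLoop D E) (h2 : HasOddLoop E F) : HasOddLoop (concat D E) F := by
  rw [hasOddLoop_iff (concat_isPairing hD hE) hF]
  rw [← smul_eq_zero_iff_of_pow (r := numLoops D E), ← Matrix.smul_mul, ← mat_mul hD hE h1,
    Matrix.mul_assoc, mat_mul_of_odd hE hF h2, Matrix.mul_zero]

theorem hasOddLoop_concat_iff (hD : D.IsPairing) (hE : E.IsPairing) (hF : F.IsPairing)
    (h1 : ¬ HasOddLoop D E) (h2 : ¬ HasOddLoop E F) :
    HasOddLoop (concat D E) F ↔ HasOddLoop D (concat E F) := by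
  rw [hasOddLoop_iff (concat_isPairing hD hE) hF, hasOddLoop_iff hD (concat_isPairing hE hF),
    ← smul_eq_zero_iff_of_pow (r := numLoops D E), ← Matrix.smul_mul, ← mat_mul hD hE h1,
    Matrix.mul_assoc, mat_mul hE hF h2, Matrix.mul_smul, smul_eq_zero_iff_of_pow]

/-- Both bracketings have the same product of three matrices, which determines the diagram and the
total number of loops. -/
theorem concat_assoc (hD : D.IsPairing) (hE : E.IsPairing) (hF : F.IsPairing)
    (h1 : ¬ HasOddLoop D E) (h2 : ¬ HasOddLoop E F) (h3 : ¬ HasOddLoop (concat D E) F) :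
    numLoops D E + numLoops (concat D E) F = numLoops E F + numLoops D (concat E F) ∧
      concat (concat D E) F = concat D (concat E F) := by
  have h4 := (not_congr (hasOddLoop_concat_iff hD hE hF h1 h2)).1 h3
  refine smul_mat_injective (concat_isPairing (concat_isPairing hD hE) hF)
    (concat_isPairing hD (concat_isPairing hE hF)) ?_
  rw [pow_add, mul_smul, ← mat_mul (concat_isPairing hD hE) hF h3, ← Matrix.smul_mul,
    ← mat_mul hD hE h1, pow_add, mul_smul, ← mat_mul hD (concat_isPairing hE hF) h4,
    ← Matrix.mul_smul, ← mat_mul hE hF h2, Matrix.mul_assoc]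

theorem concat_idDiagram (hE : E.IsPairing) :
    ¬ HasOddLoop (idDiagram m) E ∧ numLoops (idDiagram m) E = 0 ∧ concat (idDiagram m) E = E :=
  concat_of_mat_mul (idDiagram_isDiagram m).isPairing hE hE (by rw [idDiagram_mat]; simp)

theorem concat_idDiagram_right (hD : D.IsPairing) :
    ¬ HasOddLoop D (idDiagram m) ∧ numLoops D (idDiagram m) = 0 ∧ concat D (idDiagram m) = D :=
  concat_of_mat_mul hD (idDiagram_isDiagram m).isPairing hD (by rw [idDiagram_mat]; simp)

instance : Finite (RawDiagram n m) :=
  Finite.of_injective (fun D => (D.mate, D.blob)) fun _ _ h =>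
    RawDiagram.ext (congrArg Prod.fst h) (congrArg Prod.snd h)

theorem even_numBlobs_iff (D : RawDiagram n m) : Even D.numBlobs ↔ (D.numBlobs : ZMod 2) = 0 :=
  ZMod.natCast_eq_zero_iff_even.symm

theorem even_concat (hD : D.IsPairing) (hE : E.IsPairing) (h : ¬ HasOddLoop D E)
    (he : Even D.numBlobs) : Even (concat D E).numBlobs ↔ Even E.numBlobs := by
  rw [even_numBlobs_iff, even_numBlobs_iff, numBlobs_concat hD hE h,
    (even_numBlobs_iff D).1 he, zero_add]

end Assoc

end RawDiagram

instance (n : ℕ) : Finite (DDiagram n) := by unfold DDiagram; infer_instance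

instance (n : ℕ) (v : DVertex) : Finite (HalfDiagram n v) := by unfold HalfDiagram; infer_instance

theorem DDiagram.isPairing {n : ℕ} (D : DDiagram n) : D.1.IsPairing := D.2.1.isPairing

theorem HalfDiagram.isPairing {n : ℕ} {v : DVertex} (h : HalfDiagram n v) : h.1.IsPairing :=
  h.2.1.isPairing

/-- The identity diagram. -/
def DDiagram.id (n : ℕ) : DDiagram n :=
  ⟨idDiagram n, idDiagram_isDiagram n, by rw [idDiagram_numBlobs]; exact Even.zero⟩

/-- The product of two diagrams without odd loops. -/
noncomputable def DDiagram.mul {n : ℕ} (D E : DDiagram n) (h : ¬ HasOddLoop D.1 E.1) :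
    DDiagram n :=
  ⟨concat D.1 E.1, concat_isDiagram D.2.1 E.2.1,
    (even_concat D.isPairing E.isPairing h D.2.2).2 E.2.2⟩

/-! ### Representations on diagrams, and the bases of the algebras and modules -/

section Algebra

variable (k : Type u) [Field k] (δ : k)

section Rep

variable {n m : ℕ} (P : RawDiagram n m → Prop)

/-- `P` defines a quotient of the space of diagrams on which `d_n` acts: if `P` holds after
concatenation with a diagram then it holds before. -/
def IsStable : Prop := ∀ (D : DDiagram n) (h : RawDiagram n m), h.IsDiagram →
  ¬ HasOddLoop D.1 h → P (concat D.1 h) → P h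

open Classical in
/-- The image of a basis element under the action of a diagram. -/
noncomputable def actSingle (D : DDiagram n) (h : {h : RawDiagram n m // h.IsDiagram ∧ P h}) :
    {h : RawDiagram n m // h.IsDiagram ∧ P h} →₀ k :=
  if hh : ¬ HasOddLoop D.1 h.1 ∧ P (concat D.1 h.1) then
    Finsupp.single ⟨concat D.1 h.1, concat_isDiagram D.2.1 h.2.1, hh.2⟩ (δ ^ numLoops D.1 h.1)
  else 0

/-- The action of a diagram. -/
noncomputable def act (D : DDiagram n) :
    Module.End k ({h : RawDiagram n m // h.IsDiagram ∧ P h} →₀ k) :=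
  Finsupp.linearCombination k (actSingle k δ P D)

theorem act_single (D : DDiagram n) (h : {h : RawDiagram n m // h.IsDiagram ∧ P h}) (c : k) :
    act k δ P D (Finsupp.single h c) = c • actSingle k δ P D h :=
  Finsupp.linearCombination_single ..

variable {P}

theorem actSingle_of {D : DDiagram n} {h h' : {h : RawDiagram n m // h.IsDiagram ∧ P h}}
    (h1 : ¬ HasOddLoop D.1 h.1) (h2 : concat D.1 h.1 = h'.1) :
    actSingle k δ P D h = Finsupp.single h' (δ ^ numLoops D.1 h.1) := by
  rw [actSingle, dif_pos ⟨h1, h2 ▸ h'.2.2⟩]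
  congr 1
  exact Subtype.ext h2

theorem actSingle_zero {D : DDiagram n} {h : {h : RawDiagram n m // h.IsDiagram ∧ P h}}
    (h1 : HasOddLoop D.1 h.1 ∨ ¬ P (concat D.1 h.1)) : actSingle k δ P D h = 0 := by
  rw [actSingle, dif_neg]
  rintro ⟨h2, h3⟩
  rcases h1 with h1 | h1
  · exact h2 h1
  · exact h1 h3

/-- This is `concat_assoc` with a case distinction on odd loops. Stability of `P` is needed when `E`
already moves `h` out of the space: then the product of `D` and `E` must kill `h` too. -/
theorem act_mul (hP : IsStable P) (D E : DDiagram n)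
    (h : {h : RawDiagram n m // h.IsDiagram ∧ P h}) :
    (∀ hDE : ¬ HasOddLoop D.1 E.1, act k δ P D (actSingle k δ P E h) =
      δ ^ numLoops D.1 E.1 • actSingle k δ P (D.mul E hDE) h) ∧
    (HasOddLoop D.1 E.1 → act k δ P D (actSingle k δ P E h) = 0) := by
  have hp := h.2.1.isPairing
  by_cases h1 : HasOddLoop E.1 h.1
  · rw [actSingle_zero k δ (Or.inl h1), map_zero]
    refine ⟨fun hDE => ?_, fun _ => rfl⟩
    rw [actSingle_zero k δ (Or.inl (hasOddLoop_concat_left D.isPairing E.isPairing hp hDE h1)),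
      smul_zero]
  by_cases h2 : P (concat E.1 h.1)
  · obtain ⟨e, he⟩ : ∃ e : {h : RawDiagram n m // h.IsDiagram ∧ P h}, concat E.1 h.1 = e.1 :=
      ⟨⟨_, concat_isDiagram E.2.1 h.2.1, h2⟩, rfl⟩
    rw [actSingle_of k δ h1 he, act_single]
    constructor
    · intro hDE
      by_cases h3 : HasOddLoop (concat D.1 E.1) h.1
      · have h4 := (hasOddLoop_concat_iff D.isPairing E.isPairing hp hDE h1).1 h3
        rw [he] at h4
        rw [actSingle_zero k δ (Or.inl h4), actSingle_zero k δ (Or.inl h3), smul_zero, smul_zero]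
      · have h4 := (not_congr (hasOddLoop_concat_iff D.isPairing E.isPairing hp hDE h1)).1 h3
        obtain ⟨h5, h6⟩ := concat_assoc D.isPairing E.isPairing hp hDE h1 h3
        rw [he] at h4 h5 h6
        by_cases h7 : P (concat D.1 e.1)
        · obtain ⟨f, hf⟩ : ∃ f : {h : RawDiagram n m // h.IsDiagram ∧ P h},
              concat D.1 e.1 = f.1 := ⟨⟨_, concat_isDiagram D.2.1 e.2.1, h7⟩, rfl⟩
          rw [actSingle_of k δ h4 hf, actSingle_of k δ (D := D.mul E hDE) (h := h) h3 (h6.trans hf),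
            Finsupp.smul_single, Finsupp.smul_single, smul_eq_mul, smul_eq_mul, ← pow_add,
            ← pow_add, ← h5]
          rfl
        · rw [actSingle_zero k δ (Or.inr h7), actSingle_zero k δ (D := D.mul E hDE) (h := h)
            (Or.inr (by rw [← h6] at h7; exact h7)), smul_zero, smul_zero]
    · intro hDE
      have := hasOddLoop_concat_right D.isPairing E.isPairing hp hDE h1
      rw [he] at this
      rw [actSingle_zero k δ (Or.inl this), smul_zero]
  · rw [actSingle_zero k δ (Or.inr h2), map_zero]
    refine ⟨fun hDE => ?_, fun _ => rfl⟩
    by_cases h3 : HasOddLoop (concat D.1 E.1) h.1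
    · rw [actSingle_zero k δ (D := D.mul E hDE) (h := h) (Or.inl h3), smul_zero]
    · have h4 := (not_congr (hasOddLoop_concat_iff D.isPairing E.isPairing hp hDE h1)).1 h3
      have h6 := (concat_assoc D.isPairing E.isPairing hp hDE h1 h3).2
      rw [actSingle_zero k δ (D := D.mul E hDE) (h := h), smul_zero]
      exact Or.inr fun h7 => h2 (hP D _ (concat_isDiagram E.2.1 h.2.1) h4 (h6 ▸ h7))

/-- The representation of `d_n` on the space of diagrams defined by a stable property. -/
noncomputable def rep (hP : IsStable P) :
    DAlg k δ n →ₐ[k] Module.End k ({h : RawDiagram n m // h.IsDiagram ∧ P h} →₀ k) :=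
  RingQuot.liftAlgHom k ⟨FreeAlgebra.lift k (act k δ P), by
    intro x y hxy
    induction hxy with
    | one D h =>
      rw [FreeAlgebra.lift_ι_apply, map_one]
      refine Finsupp.lhom_ext fun e c => ?_
      obtain ⟨h1, h2, h3⟩ := concat_idDiagram e.2.1.isPairing
      rw [← h] at h1 h2 h3
      rw [act_single, actSingle_of k δ h1 h3, h2, pow_zero, Finsupp.smul_single, smul_eq_mul,
        mul_one]
      rfl
    | mul D E C h hC =>
      rw [map_mul, map_smul, FreeAlgebra.lift_ι_apply, FreeAlgebra.lift_ι_apply,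
        FreeAlgebra.lift_ι_apply]
      obtain rfl : C = D.mul E h := Subtype.ext hC
      refine Finsupp.lhom_ext fun e c => ?_
      rw [Module.End.mul_apply, LinearMap.smul_apply, act_single, act_single, map_smul,
        (act_mul k δ hP D E e).1 h, smul_comm]
    | mul_zero D E h =>
      rw [map_mul, map_zero, FreeAlgebra.lift_ι_apply, FreeAlgebra.lift_ι_apply]
      refine Finsupp.lhom_ext fun e c => ?_
      rw [Module.End.mul_apply, act_single, map_smul, (act_mul k δ hP D E e).2 h, smul_zero]
      rfl⟩

theorem rep_diag (hP : IsStable P) (D : DDiagram n) : rep k δ hP (DAlg.diag k δ D) = act k δ P D := by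
  rw [rep, DAlg.diag]
  refine (RingQuot.liftAlgHom_mkAlgHom_apply ..).trans ?_
  exact FreeAlgebra.lift_ι_apply ..

end Rep

section Basis

variable {n : ℕ}

theorem diag_id {D : DDiagram n} (h : D.1 = idDiagram n) : DAlg.diag k δ D = 1 := by
  refine (RingQuot.mkAlgHom_rel k (DRel.one (δ := δ) D h)).trans ?_
  exact map_one _

theorem diag_mul {D E C : DDiagram n} (h : ¬ HasOddLoop D.1 E.1) (hC : C.1 = concat D.1 E.1) :
    DAlg.diag k δ D * DAlg.diag k δ E = δ ^ numLoops D.1 E.1 • DAlg.diag k δ C := by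
  have := RingQuot.mkAlgHom_rel k (DRel.mul (δ := δ) D E C h hC)
  rw [map_mul, map_smul] at this
  exact this

theorem diag_mul_zero {D E : DDiagram n} (h : HasOddLoop D.1 E.1) :
    DAlg.diag k δ D * DAlg.diag k δ E = 0 := by
  have := RingQuot.mkAlgHom_rel k (DRel.mul_zero (δ := δ) D E h)
  rw [map_mul, map_zero] at this
  exact this

/-- The transfer principle: a matrix identity with loop value 2 becomes an identity in the algebra
with loop value `δ`. -/
theorem diag_mul_of_mat {D E C : DDiagram n} {r : ℕ} (h : D.1.mat * E.1.mat = 2 ^ r • C.1.mat) :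
    DAlg.diag k δ D * DAlg.diag k δ E = δ ^ r • DAlg.diag k δ C := by
  obtain ⟨h1, rfl, h3⟩ := concat_of_mat_mul D.isPairing E.isPairing C.isPairing h
  exact diag_mul k δ h1 h3.symm

theorem diag_mul_of_mat_zero {D E : DDiagram n} (h : D.1.mat * E.1.mat = 0) :
    DAlg.diag k δ D * DAlg.diag k δ E = 0 :=
  diag_mul_zero k δ (hasOddLoop_of_mat_mul D.isPairing E.isPairing h)

/-- A diagram matrix is nonzero, so the given product of matrices excludes odd loops at both stages.
-/
theorem diag_mul_mul_of_mat {D E F C : DDiagram n} {r : ℕ}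
    (h : D.1.mat * E.1.mat * F.1.mat = 2 ^ r • C.1.mat) :
    DAlg.diag k δ D * DAlg.diag k δ E * DAlg.diag k δ F = δ ^ r • DAlg.diag k δ C := by
  have h1 : ¬ HasOddLoop D.1 E.1 := fun h1 => by
    rw [mat_mul_of_odd D.isPairing E.isPairing h1, Matrix.zero_mul] at h
    exact C.isPairing.mat_ne_zero (smul_eq_zero_iff_of_pow.1 h.symm)
  rw [diag_mul k δ h1 (C := D.mul E h1) rfl]
  rw [mat_mul D.isPairing E.isPairing h1] at h
  have h2 : ¬ HasOddLoop (D.mul E h1).1 F.1 := fun h2 => by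
    rw [Matrix.smul_mul] at h
    change 2 ^ _ • ((D.mul E h1).1.mat * _) = _ at h
    rw [mat_mul_of_odd (D.mul E h1).isPairing F.isPairing h2, smul_zero] at h
    exact C.isPairing.mat_ne_zero (smul_eq_zero_iff_of_pow.1 h.symm)
  rw [Matrix.smul_mul] at h
  change 2 ^ _ • ((D.mul E h1).1.mat * _) = _ at h
  rw [mat_mul (D.mul E h1).isPairing F.isPairing h2, ← mul_smul, ← pow_add] at h
  obtain ⟨rfl, h4⟩ := smul_mat_injective
    (concat_isPairing (D.mul E h1).isPairing F.isPairing) C.isPairing h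
  rw [smul_mul_assoc, diag_mul k δ h2 h4.symm, ← mul_smul, ← pow_add]

theorem diag_mul_comm_of_mat {D E : DDiagram n} (h : D.1.mat * E.1.mat = E.1.mat * D.1.mat) :
    DAlg.diag k δ D * DAlg.diag k δ E = DAlg.diag k δ E * DAlg.diag k δ D := by
  by_cases h1 : HasOddLoop D.1 E.1
  · have h2 := h.symm
    rw [mat_mul_of_odd D.isPairing E.isPairing h1] at h2
    rw [diag_mul_zero k δ h1, diag_mul_of_mat_zero k δ h2]
  · rw [diag_mul k δ h1 (C := D.mul E h1) rfl, diag_mul_of_mat k δ (C := D.mul E h1)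
      (r := numLoops D.1 E.1) (by rw [← h, mat_mul D.isPairing E.isPairing h1]; rfl)]

theorem span_diag : ⊤ ≤ Submodule.span k (Set.range (DAlg.diag k δ (n := n))) := by
  rintro x -
  obtain ⟨y, rfl⟩ := RingQuot.mkAlgHom_surjective k (DRel k δ n) x
  induction y using FreeAlgebra.induction with
  | grade0 r =>
    rw [AlgHom.commutes, Algebra.algebraMap_eq_smul_one]
    refine Submodule.smul_mem _ _ (Submodule.subset_span ⟨DDiagram.id n, ?_⟩)
    exact diag_id k δ rfl
  | grade1 D => exact Submodule.subset_span ⟨D, rfl⟩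
  | mul a b ha hb =>
    rw [map_mul]
    have hle : Submodule.span k (Set.range (DAlg.diag k δ (n := n))) *
        Submodule.span k (Set.range (DAlg.diag k δ (n := n))) ≤
        Submodule.span k (Set.range (DAlg.diag k δ (n := n))) := by
      rw [Submodule.span_mul_span, Submodule.span_le]
      rintro _ ⟨_, ⟨D, rfl⟩, _, ⟨E, rfl⟩, rfl⟩
      by_cases h : HasOddLoop D.1 E.1
      · simp only [diag_mul_zero k δ h]; exact Submodule.zero_mem _
      · simp only [diag_mul k δ h (C := D.mul E h) rfl]
        exact Submodule.smul_mem _ _ (Submodule.subset_span ⟨_, rfl⟩)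
    exact hle (Submodule.mul_mem_mul ha hb)
  | add a b ha hb => rw [map_add]; exact Submodule.add_mem _ ha hb

/-- The resulting representation is the left regular one. -/
theorem isStable_even : IsStable (n := n) fun h : RawDiagram n n => Even h.numBlobs :=
  fun D _ hh h1 h2 => (even_concat D.isPairing hh.isPairing h1 D.2.2).1 h2

/-- Acting on the identity diagram sends each diagram to the corresponding basis vector. -/
theorem linearIndependent_diag : LinearIndependent k (DAlg.diag k δ (n := n)) := by
  let ev : DAlg k δ n →ₗ[k] DDiagram n →₀ k :=
    (LinearMap.applyₗ (Finsupp.single (DDiagram.id n) (1 : k))).comp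
      (rep k δ (isStable_even (n := n))).toLinearMap
  have h : ev ∘ DAlg.diag k δ (n := n) = fun D => Finsupp.single D 1 := by
    funext D
    change rep k δ (isStable_even (n := n)) (DAlg.diag k δ D) (Finsupp.single (DDiagram.id n) 1) = _
    rw [rep_diag]
    obtain ⟨h1, h2, h3⟩ := concat_idDiagram_right D.isPairing
    refine (act_single ..).trans ?_
    rw [one_smul]
    refine (actSingle_of k δ (h := DDiagram.id n) (h' := D) h1 h3).trans ?_
    change Finsupp.single D (δ ^ numLoops D.1 (idDiagram n)) = _
    rw [h2, pow_zero]
  refine LinearIndependent.of_comp ev ?_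
  rw [h]
  exact Finsupp.linearIndependent_single_one k _

/-- The basis of diagrams of `d_n`. -/
noncomputable def diagBasis (n : ℕ) : Module.Basis (DDiagram n) k (DAlg k δ n) :=
  Module.Basis.mk (linearIndependent_diag k δ) (span_diag k δ)

@[simp] theorem diagBasis_apply (D : DDiagram n) : diagBasis k δ n D = DAlg.diag k δ D :=
  Module.Basis.mk_apply ..

instance : Module.Finite k (DAlg k δ n) := Module.Finite.of_basis (diagBasis k δ n)

end Basis

/-! ### The presented modules of half diagrams -/

section Std

variable {n : ℕ} {v : DVertex}

/-- Multiplication by a diagram can lose propagating lines but not create them. -/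
theorem isStable_half : IsStable (n := n) (m := v.lines)
    fun h => h.AllPropagating ∧ (Even h.numBlobs ↔ v ≠ .prime) :=
  fun D _ hh h1 h2 => ⟨allPropagating_of_concat D.isPairing hh.isPairing h2.1,
    (even_concat D.isPairing hh.isPairing h1 D.2.2).symm.trans h2.2⟩

/-- The product of a diagram and a half diagram, if it is a half diagram. -/
noncomputable def HalfDiagram.smul (D : DDiagram n) (h : HalfDiagram n v)
    (h1 : ¬ HasOddLoop D.1 h.1) (h2 : (concat D.1 h.1).AllPropagating) : HalfDiagram n v :=
  ⟨concat D.1 h.1, concat_isDiagram D.2.1 h.2.1, h2,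
    (even_concat D.isPairing h.isPairing h1 D.2.2).trans h.2.2.2⟩

theorem diag_smul_half {D : DDiagram n} {h h' : HalfDiagram n v} (h1 : ¬ HasOddLoop D.1 h.1)
    (h2 : h'.1 = concat D.1 h.1) : DAlg.diag k δ D • StdCarrier.half k δ h =
      δ ^ numLoops D.1 h.1 • StdCarrier.half k δ h' := by
  rw [StdCarrier.half, StdCarrier.half, ← Submodule.Quotient.mk_smul, ← Submodule.Quotient.mk_smul,
    Submodule.Quotient.eq]
  refine Submodule.subset_span (Or.inl ⟨D, h, h', h1, h2, ?_⟩)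
  rw [Finsupp.smul_single, smul_eq_mul, mul_one]

theorem diag_smul_half_zero {D : DDiagram n} {h : HalfDiagram n v}
    (h1 : HasOddLoop D.1 h.1 ∨ ¬ (concat D.1 h.1).AllPropagating) :
    DAlg.diag k δ D • StdCarrier.half k δ h = 0 := by
  rw [StdCarrier.half, ← Submodule.Quotient.mk_smul, Submodule.Quotient.mk_eq_zero]
  refine Submodule.subset_span (Or.inr ⟨D, h, h1, ?_⟩)
  rw [Finsupp.smul_single, smul_eq_mul, mul_one]

theorem diag_smul_half_of_mat {D : DDiagram n} {h h' : HalfDiagram n v} {r : ℕ}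
    (hm : D.1.mat * h.1.mat = 2 ^ r • h'.1.mat) :
    DAlg.diag k δ D • StdCarrier.half k δ h = δ ^ r • StdCarrier.half k δ h' := by
  obtain ⟨h1, rfl, h3⟩ := concat_of_mat_mul D.isPairing h.isPairing h'.isPairing hm
  exact diag_smul_half k δ h1 h3.symm

theorem diag_smul_half_of_mat_zero {D : DDiagram n} {h : HalfDiagram n v}
    (hm : D.1.mat * h.1.mat = 0) : DAlg.diag k δ D • StdCarrier.half k δ h = 0 :=
  diag_smul_half_zero k δ (Or.inl (hasOddLoop_of_mat_mul D.isPairing h.isPairing hm))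

theorem diag_smul_half_of_mat_not {D : DDiagram n} {h : HalfDiagram n v} {r : ℕ}
    {g : RawDiagram n v.lines} (hg : g.IsPairing) (hg' : ¬ g.AllPropagating)
    (hm : D.1.mat * h.1.mat = 2 ^ r • g.mat) :
    DAlg.diag k δ D • StdCarrier.half k δ h = 0 := by
  obtain ⟨h1, rfl, h3⟩ := concat_of_mat_mul D.isPairing h.isPairing hg hm
  exact diag_smul_half_zero k δ (Or.inr (h3 ▸ hg'))

/-- The universal property of `Δ_n(v)`. -/
theorem StdCarrier.exists_lift {M : Type*} [AddCommGroup M] [Module (DAlg k δ n) M]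
    (f : HalfDiagram n v → M)
    (h1 : ∀ (D : DDiagram n) (h h' : HalfDiagram n v), ¬ HasOddLoop D.1 h.1 →
      h'.1 = concat D.1 h.1 →
      DAlg.diag k δ D • f h = algebraMap k (DAlg k δ n) (δ ^ numLoops D.1 h.1) • f h')
    (h2 : ∀ (D : DDiagram n) (h : HalfDiagram n v),
      HasOddLoop D.1 h.1 ∨ ¬ (concat D.1 h.1).AllPropagating → DAlg.diag k δ D • f h = 0) :
    ∃ φ : StdCarrier k δ n v →ₗ[DAlg k δ n] M, ∀ h, φ (StdCarrier.half k δ h) = f h := by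
  refine ⟨Submodule.liftQ _ (Finsupp.linearCombination (DAlg k δ n) f) ?_, fun h => ?_⟩
  · rw [Submodule.span_le]
    rintro _ (⟨D, h, h', h3, h4, rfl⟩ | ⟨D, h, h3, rfl⟩)
    · simp only [SetLike.mem_coe, LinearMap.mem_ker, map_sub, Finsupp.linearCombination_single,
        Finsupp.smul_single, h1 D h h' h3 h4]
      rw [Algebra.smul_def, mul_one, sub_self]
    · simp only [SetLike.mem_coe, LinearMap.mem_ker, Finsupp.linearCombination_single, h2 D h h3]
  · exact (Finsupp.linearCombination_single ..).trans (one_smul _ _)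

/-- By its universal property the presented module maps onto the concrete module spanned by half
diagrams, where the generators become basis vectors. -/
theorem linearIndependent_half : LinearIndependent k (StdCarrier.half k δ (n := n) (v := v)) := by
  let ρ : DAlg k δ n →ₐ[k] Module.End k (HalfDiagram n v →₀ k) :=
    rep k δ (isStable_half (n := n) (v := v))
  let : Module (DAlg k δ n) (HalfDiagram n v →₀ k) :=
    Module.compHom (HalfDiagram n v →₀ k) ρ.toRingHom
  have smul_def : ∀ (a : DAlg k δ n) (x : HalfDiagram n v →₀ k), a • x = ρ a x := fun _ _ => rfl
  have ρ_diag : ∀ D, ρ (DAlg.diag k δ D) = act k δ _ D := rep_diag k δ isStable_half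
  have alg : ∀ (c : k) (x : HalfDiagram n v →₀ k), algebraMap k (DAlg k δ n) c • x = c • x := by
    intro c x
    rw [smul_def, AlgHom.commutes]
    rfl
  obtain ⟨φ, hφ⟩ := StdCarrier.exists_lift k δ (n := n) (v := v)
    (fun h => Finsupp.single h (1 : k))
    (fun D h h' h1 h2 => by
      rw [alg, smul_def, ρ_diag]
      refine (act_single ..).trans ?_
      rw [one_smul]
      refine (actSingle_of k δ h1 h2.symm).trans ?_
      rw [Finsupp.smul_single, smul_eq_mul, mul_one]
      rfl)
    (fun D h h1 => by
      rw [smul_def, ρ_diag]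
      refine (act_single ..).trans ?_
      rw [one_smul]
      exact actSingle_zero k δ (h1.imp_right fun h h' => h h'.1))
  let φ' : StdCarrier k δ n v →ₗ[k] (HalfDiagram n v →₀ k) :=
    { toFun := φ
      map_add' := map_add φ
      map_smul' := fun c x => by
        rw [← algebraMap_smul (DAlg k δ n) c x, map_smul, alg]; rfl }
  refine LinearIndependent.of_comp φ' ?_
  rw [show φ' ∘ StdCarrier.half k δ (n := n) (v := v) = fun h => Finsupp.single h 1 from funext hφ]
  exact Finsupp.linearIndependent_single_one k _

theorem span_half : ⊤ ≤ Submodule.span k (Set.range (StdCarrier.half k δ (n := n) (v := v))) := by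
  rintro x -
  obtain ⟨y, rfl⟩ := Submodule.Quotient.mk_surjective _ x
  induction y using Finsupp.induction_linear with
  | zero => exact Submodule.zero_mem _
  | add a b ha hb => exact Submodule.add_mem _ ha hb
  | single h a =>
    have e : (Submodule.Quotient.mk (Finsupp.single h a) : StdCarrier k δ n v) =
        a • StdCarrier.half k δ h := by
      rw [StdCarrier.half, ← Submodule.Quotient.mk_smul, Finsupp.smul_single, smul_eq_mul, mul_one]
    rw [e]
    clear e
    have := span_diag k δ (n := n) (Submodule.mem_top (x := a))
    induction this using Submodule.span_induction with
    | mem a ha =>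
      obtain ⟨D, rfl⟩ := ha
      by_cases h1 : HasOddLoop D.1 h.1 ∨ ¬ (concat D.1 h.1).AllPropagating
      · rw [diag_smul_half_zero k δ h1]; exact Submodule.zero_mem _
      · rw [not_or, not_not] at h1
        rw [diag_smul_half k δ h1.1 (h' := h.smul D h1.1 h1.2) rfl]
        exact Submodule.smul_mem _ _ (Submodule.subset_span ⟨_, rfl⟩)
    | zero => rw [zero_smul]; exact Submodule.zero_mem _
    | add a b _ _ ha hb => rw [add_smul]; exact Submodule.add_mem _ ha hb
    | smul c a _ ha => rw [smul_assoc]; exact Submodule.smul_mem _ _ ha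

/-- The basis of half diagrams of `Δ_n(v)`. -/
noncomputable def halfBasis (n : ℕ) (v : DVertex) :
    Module.Basis (HalfDiagram n v) k (StdCarrier k δ n v) :=
  Module.Basis.mk (linearIndependent_half k δ) (span_half k δ)

@[simp] theorem halfBasis_apply (h : HalfDiagram n v) :
    halfBasis k δ n v h = StdCarrier.half k δ h :=
  Module.Basis.mk_apply ..

instance : Module.Finite k (StdCarrier k δ n v) := Module.Finite.of_basis (halfBasis k δ n v)

end Std

end Algebra

/-! ### Half diagrams at the eastern end -/

namespace RawDiagram

variable {n m : ℕ}

/-- The last northern vertex of a diagram whose lines to the south propagate is joined to a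
northern vertex or to the last southern vertex. -/
theorem AllPropagating.mate_last {g : RawDiagram (n + 1) m} (h : g.AllPropagating)
    (hg : g.IsDiagram) : (∃ i : Fin n, g.mate (.inl (Fin.last n)) = .inl i.castSucc) ∨
      ∃ j : Fin m, g.mate (.inl (Fin.last n)) = .inr j ∧ (j : ℕ) + 1 = m := by
  rcases hz : g.mate (.inl (Fin.last n)) with i | j
  · left
    induction i using Fin.lastCases with
    | last => exact absurd hz (hg.mate_ne _)
    | cast i => exact ⟨i, rfl⟩
  · right
    refine ⟨j, rfl, ?_⟩
    by_contra hj
    have := j.2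
    -- Otherwise the line at the last southern vertex starts further west and crosses the line at
    -- the last northern vertex.
    obtain ⟨i, hi⟩ := h ⟨m - 1, by omega⟩
    have hi' : g.mate (.inl i) = .inr ⟨m - 1, by omega⟩ := by rw [← hi, hg.mate_mate]
    have hin : i ≠ Fin.last n := by
      rintro rfl
      rw [hz] at hi'
      have := congrArg Fin.val (Sum.inr_injective hi')
      simp only at this
      omega
    have hlt : (i : ℕ) < n := Fin.val_lt_last hin
    refine hg.noncrossing (.inl i) (.inl (Fin.last n)) ⟨?_, ?_, ?_⟩
    · simpa only [pos, Fin.val_last] using hlt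
    · rw [hi']; simp only [pos, Fin.val_last]; omega
    · rw [hi', hz]; simp only [pos, Fin.val_rev]; omega

theorem AllPropagating.mate_last_succ {g : RawDiagram (n + 1) (m + 1)} (h : g.AllPropagating)
    (hg : g.IsDiagram) : (∃ i : Fin n, g.mate (.inl (Fin.last n)) = .inl i.castSucc) ∨
      g.mate (.inl (Fin.last n)) = .inr (Fin.last m) := by
  refine (h.mate_last hg).imp_right ?_
  rintro ⟨j, hj, hjm⟩
  rw [hj]
  exact congrArg _ (Fin.ext (by simpa using hjm))

/-- Only the westernmost propagating line can carry a blob. -/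
theorem AllPropagating.eq_zero_of_blob {g : RawDiagram (n + 1) (m + 1)} (h : g.AllPropagating)
    (hg : g.IsDiagram) (hl : g.mate (.inl (Fin.last n)) = .inr (Fin.last m))
    (hb : g.blob (.inl (Fin.last n)) = true) : m = 0 := by
  by_contra hm
  obtain ⟨i, hi⟩ := h ⟨0, by omega⟩
  have hi' : g.mate (.inl i) = .inr ⟨0, by omega⟩ := by rw [← hi, hg.mate_mate]
  have hin : i ≠ Fin.last n := by
    rintro rfl
    rw [hl] at hi'
    have := congrArg Fin.val (Sum.inr_injective hi')
    simp only [Fin.val_last] at this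
    omega
  refine hg.exposed _ hb (.inl i) ⟨?_, ?_⟩
  · simpa only [pos, Fin.val_last] using Fin.val_lt_last hin
  · rw [hi']; simp only [pos, Fin.val_last, Fin.val_rev]; omega

theorem numBlobs_zero (D : RawDiagram 0 0) : D.numBlobs = 0 := by
  rw [numBlobs, Nat.card_eq_zero]
  exact Or.inl ⟨fun x => x.1.elim (fun i => i.elim0) fun i => i.elim0⟩

instance : Subsingleton (RawDiagram 0 0) :=
  ⟨fun _ _ => RawDiagram.ext
    (funext fun x => x.elim (fun i => i.elim0) fun i => i.elim0)
    (funext fun x => x.elim (fun i => i.elim0) fun i => i.elim0)⟩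

end RawDiagram

namespace HalfDiagram

variable {n : ℕ}

/-- The diagram underlying a half diagram with `l` lines. -/
def natRaw {l : ℕ} (h : HalfDiagram n (.nat l)) : RawDiagram n l := h.1

/-- The diagram underlying a half diagram which belongs to `0'`. -/
def primeRaw (h : HalfDiagram n .prime) : RawDiagram n 0 := h.1

theorem natRaw_isDiagram {l : ℕ} (h : HalfDiagram n (.nat l)) : h.natRaw.IsDiagram := h.2.1

theorem primeRaw_isDiagram (h : HalfDiagram n .prime) : h.primeRaw.IsDiagram := h.2.1

theorem natRaw_allPropagating {l : ℕ} (h : HalfDiagram n (.nat l)) : h.natRaw.AllPropagating :=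
  h.2.2.1

theorem primeRaw_allPropagating (h : HalfDiagram n .prime) : h.primeRaw.AllPropagating := h.2.2.1

theorem natRaw_injective {l : ℕ} {h h' : HalfDiagram n (.nat l)} (e : h.natRaw = h'.natRaw) :
    h = h' := Subtype.ext e

theorem primeRaw_injective {h h' : HalfDiagram n .prime} (e : h.primeRaw = h'.primeRaw) :
    h = h' := Subtype.ext e

theorem natRaw_numBlobs {l : ℕ} (h : HalfDiagram n (.nat l)) : (h.natRaw.numBlobs : ZMod 2) = 0 :=
  (even_numBlobs_iff _).1 (h.2.2.2.2 (by simp))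

theorem primeRaw_numBlobs (h : HalfDiagram n .prime) : (h.primeRaw.numBlobs : ZMod 2) = 1 :=
  ZMod.natCast_eq_one_iff_odd.2 (Nat.not_even_iff_odd.1 fun he => h.2.2.2.1 he rfl)

/-- A half diagram with an even number of blobs. -/
def ofEven {l : ℕ} (g : RawDiagram n l) (hg : g.IsDiagram) (hp : g.AllPropagating)
    (he : (g.numBlobs : ZMod 2) = 0) : HalfDiagram n (.nat l) :=
  ⟨g, hg, hp, iff_of_true ((even_numBlobs_iff _).2 he) (by simp)⟩

/-- A half diagram without lines to the south and with an odd number of blobs. -/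
def ofOdd (g : RawDiagram n 0) (hg : g.IsDiagram)
    (he : (g.numBlobs : ZMod 2) = 1) : HalfDiagram n .prime :=
  ⟨g, hg, fun j => j.elim0, iff_of_false
    (fun h => absurd (((even_numBlobs_iff g).1 h).symm.trans he) (by decide)) (by simp)⟩

@[simp] theorem natRaw_ofEven {l : ℕ} (g : RawDiagram n l) (hg hp he) :
    (ofEven g hg hp he).natRaw = g := rfl

/-- Outside the layer there are no half diagrams, so `Δ_n(v)` is zero there. For 0' the case `n = 0`
is excluded because the empty diagram has no blob. -/
theorem mem_layer {v : DVertex} (h : HalfDiagram n v) : v ∈ DVertex.layer n := by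
  have h1 := h.isPairing.even_add
  have h2 := h.2.2.1.le h.isPairing
  cases v with
  | prime =>
    change Even n ∧ 2 ≤ n
    change Even (n + 0) at h1
    refine ⟨h1, ?_⟩
    have : n ≠ 0 := by
      rintro rfl
      have := h.primeRaw_numBlobs
      rw [numBlobs_zero h.primeRaw] at this
      exact absurd this (by decide)
    obtain ⟨r, hr⟩ := h1
    omega
  | nat l =>
    change l ≤ n ∧ l % 2 = n % 2
    change Even (n + l) at h1
    change l ≤ n at h2
    obtain ⟨r, hr⟩ := h1
    omega

end HalfDiagram

/-! ### The edge maps and the Pascal array -/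

/-- The oriented edges of `D_∞`. -/
inductive DEdge : DVertex → DVertex → Type
  | up (l : ℕ) : DEdge (.nat l) (.nat (l + 1))
  | down (l : ℕ) : DEdge (.nat (l + 1)) (.nat l)
  | upPrime : DEdge .prime (.nat 1)
  | downPrime : DEdge (.nat 1) .prime

namespace DEdge

theorem adj {v w : DVertex} (e : DEdge v w) : DInfinity.Adj v w := by
  cases e <;> simp [DInfinity]

theorem nonempty_of_adj {v w : DVertex} (h : DInfinity.Adj v w) : Nonempty (DEdge v w) := by
  rw [DInfinity, SimpleGraph.fromRel_adj] at h
  obtain ⟨-, (⟨i, rfl, rfl⟩ | ⟨rfl, rfl⟩) | (⟨i, rfl, rfl⟩ | ⟨rfl, rfl⟩)⟩ := h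
  · exact ⟨up i⟩
  · exact ⟨upPrime⟩
  · exact ⟨down i⟩
  · exact ⟨downPrime⟩

instance (v w : DVertex) : Subsingleton (DEdge v w) := ⟨fun x y => by
  cases x <;> cases y <;> rfl⟩

/-- The edge maps between sets of half diagrams. -/
def map {n : ℕ} : ∀ {v w : DVertex}, DEdge v w → HalfDiagram n v → HalfDiagram (n + 1) w
  | _, _, up _, h => HalfDiagram.ofEven (addLine false h.natRaw)
      (addLine_isDiagram h.natRaw_isDiagram (fun h => by cases h))
      (addLine_allPropagating.2 h.natRaw_allPropagating) (by
        rw [addLine_numBlobs h.natRaw_isDiagram (fun h => by cases h), h.natRaw_numBlobs]; rfl)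
  | _, _, down _, h => HalfDiagram.ofEven (bend false h.natRaw)
      (bend_isDiagram h.natRaw_isDiagram (fun h => by cases h))
      (bend_allPropagating h.natRaw_allPropagating) (by
        rw [bend_numBlobs h.natRaw_isDiagram (fun h => by cases h), h.natRaw_numBlobs]; rfl)
  | _, _, upPrime, h => HalfDiagram.ofEven (addLine true h.primeRaw)
      (addLine_isDiagram h.primeRaw_isDiagram fun _ => rfl)
      (addLine_allPropagating.2 h.primeRaw_allPropagating) (by
        rw [addLine_numBlobs h.primeRaw_isDiagram (fun _ => rfl), h.primeRaw_numBlobs]; rfl)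
  | _, _, downPrime, h => HalfDiagram.ofOdd (bend true h.natRaw)
      (bend_isDiagram h.natRaw_isDiagram fun _ => rfl) (by
        rw [bend_numBlobs h.natRaw_isDiagram (fun _ => rfl), h.natRaw_numBlobs]; rfl)

theorem map_injective {n : ℕ} {v w : DVertex} (e : DEdge v w) :
    Function.Injective (e.map (n := n)) := by
  intro x y h
  cases e with
  | up l => exact HalfDiagram.natRaw_injective (addLine_injective (congrArg HalfDiagram.natRaw h))
  | upPrime =>
    exact HalfDiagram.primeRaw_injective (addLine_injective (congrArg HalfDiagram.natRaw h))
  | down l =>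
    exact HalfDiagram.natRaw_injective (Function.LeftInverse.injective (unbend_bend false)
      (congrArg HalfDiagram.natRaw h))
  | downPrime =>
    exact HalfDiagram.natRaw_injective (Function.LeftInverse.injective (unbend_bend true)
      (congrArg HalfDiagram.primeRaw h))

/-- An edge pointing away from the vertices `0`, `0'`. -/
def IsUp : ∀ {v w : DVertex}, DEdge v w → Prop
  | _, _, up _ => True
  | _, _, upPrime => True
  | _, _, down _ => False
  | _, _, downPrime => False

/-- Whether the last northern vertex is on a propagating line reveals the direction of the edge from
which a half diagram comes. -/
theorem isRight_mate_map {n : ℕ} {v w : DVertex} (e : DEdge v w) (x : HalfDiagram n v) :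
    ((e.map x).1.mate (.inl (Fin.last n))).isRight = true ↔ e.IsUp := by
  cases e with
  | up l => exact iff_of_true (by
      change ((addLine false x.natRaw).mate (.inl (Fin.last n))).isRight = true
      rw [addLine_mate_inl_last]; rfl) trivial
  | upPrime => exact iff_of_true (by
      change ((addLine true x.primeRaw).mate (.inl (Fin.last n))).isRight = true
      rw [addLine_mate_inl_last]; rfl) trivial
  | down l =>
    refine iff_of_false ?_ id
    obtain ⟨i, hi⟩ := x.natRaw_allPropagating (Fin.last l)
    change ¬ (bendPt (x.natRaw.mate (unbendPt (.inl (Fin.last n))))).isRight = true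
    rw [unbendPt_last, hi]
    simp [bendPt]
  | downPrime =>
    refine iff_of_false ?_ id
    obtain ⟨i, hi⟩ := x.natRaw_allPropagating (Fin.last 0)
    change ¬ (bendPt (x.natRaw.mate (unbendPt (.inl (Fin.last n))))).isRight = true
    rw [unbendPt_last, hi]
    simp [bendPt]

/-- The images of the edge maps of two edges with the same target are disjoint. -/
theorem eq_of_map_eq {n : ℕ} {v v' w : DVertex} (e : DEdge v w) (e' : DEdge v' w)
    {x : HalfDiagram n v} {x' : HalfDiagram n v'} (h : e.map x = e'.map x') : v = v' := by
  have hu : e.IsUp ↔ e'.IsUp := by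
    rw [← isRight_mate_map e x, ← isRight_mate_map e' x', h]
  cases e <;> cases e' <;> simp only [IsUp, iff_true, iff_false, not_true] at hu <;> try rfl
  -- The upward edges from 0 and 0' both end at 1; the blob on the last line tells them apart.
  · have := congrArg (fun y => y.1.blob (.inl (Fin.last n))) h
    change (addLine false x.natRaw).blob (.inl (Fin.last n)) =
      (addLine true x'.primeRaw).blob (.inl (Fin.last n)) at this
    rw [addLine_blob_inl_last, addLine_blob_inl_last] at this
    cases this
  · have := congrArg (fun y => y.1.blob (.inl (Fin.last n))) h
    change (addLine true x.primeRaw).blob (.inl (Fin.last n)) =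
      (addLine false x'.natRaw).blob (.inl (Fin.last n)) at this
    rw [addLine_blob_inl_last, addLine_blob_inl_last] at this
    cases this

/-- Every half diagram with at least one northern vertex is in the image of an edge map. -/
theorem exists_map_eq {n : ℕ} {w : DVertex} (y : HalfDiagram (n + 1) w) :
    ∃ (v : DVertex) (e : DEdge v w) (x : HalfDiagram n v), e.map x = y := by
  have south : ∀ {m : ℕ} (b : Bool) (g : RawDiagram (n + 1) m), g.IsDiagram →
      (b = true → m = 0) → ((unbend b g).numBlobs : ZMod 2) = g.numBlobs + bit b := by
    intro m b g hg hb
    have := bend_numBlobs (unbend_isDiagram hg hb) hb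
    rw [bend_unbend] at this
    rw [this, add_assoc, zmod_two_add_self, add_zero]
  cases w with
  | prime =>
    rcases y.primeRaw_allPropagating.mate_last y.primeRaw_isDiagram with ⟨i, hi⟩ | ⟨j, -⟩
    · refine ⟨_, downPrime, HalfDiagram.ofEven (unbend true y.primeRaw)
        (unbend_isDiagram y.primeRaw_isDiagram fun _ => rfl)
        (unbend_allPropagating y.isPairing y.primeRaw_allPropagating hi) ?_,
        HalfDiagram.primeRaw_injective (bend_unbend true y.primeRaw)⟩
      rw [south true y.primeRaw y.primeRaw_isDiagram fun _ => rfl, y.primeRaw_numBlobs]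
      decide
    · exact j.elim0
  | nat l =>
    have hdown : (∃ i : Fin n, y.natRaw.mate (.inl (Fin.last n)) = .inl i.castSucc) →
        ∃ (v : DVertex) (e : DEdge v (.nat l)) (x : HalfDiagram n v), e.map x = y := by
      rintro ⟨i, hi⟩
      refine ⟨_, down l, HalfDiagram.ofEven (unbend false y.natRaw)
        (unbend_isDiagram y.natRaw_isDiagram fun h => by cases h)
        (unbend_allPropagating y.isPairing y.natRaw_allPropagating hi) ?_,
        HalfDiagram.natRaw_injective (bend_unbend false y.natRaw)⟩
      rw [south false y.natRaw y.natRaw_isDiagram (fun h => by cases h), y.natRaw_numBlobs]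
      rfl
    cases l with
    | zero =>
      rcases y.natRaw_allPropagating.mate_last y.natRaw_isDiagram with h | ⟨j, -⟩
      · exact hdown h
      · exact j.elim0
    | succ l =>
      rcases y.natRaw_allPropagating.mate_last_succ y.natRaw_isDiagram with h | h
      · exact hdown h
      -- Removing the last line leaves a half diagram for `l` if it has no blob. With a blob the
      -- line must be the only one, and the rest has an odd number of blobs, so it belongs to 0'.
      · obtain ⟨D, hD, hyD⟩ := exists_eq_addLine y.natRaw_isDiagram h
        have hb := y.natRaw_allPropagating.eq_zero_of_blob y.natRaw_isDiagram h
        have hy := y.natRaw_numBlobs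
        have hp := y.natRaw_allPropagating
        rw [hyD] at hy hp
        rw [addLine_numBlobs hD hb] at hy
        rcases hblob : y.natRaw.blob (.inl (Fin.last n)) with _ | _
        · rw [hblob] at hyD hy
          exact ⟨_, up l, HalfDiagram.ofEven D hD (addLine_allPropagating.1 hp)
            (by simpa using hy), HalfDiagram.natRaw_injective hyD.symm⟩
        · obtain rfl := hb hblob
          rw [hblob] at hyD hy
          exact ⟨_, upPrime, HalfDiagram.ofOdd D hD (zmod_two_eq_of_add hy),
            HalfDiagram.natRaw_injective hyD.symm⟩

end DEdge

theorem nonempty_layer_zero_equiv (w : DVertex) :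
    Nonempty (HalfDiagram 0 w ≃ DInfinity.toDirGraph.Path (.nat 0) 0 w) := by
  by_cases hw : w = .nat 0
  · subst hw
    have hs : Subsingleton (HalfDiagram 0 (.nat 0)) :=
      ⟨fun x y => Subtype.ext (Subsingleton.elim (α := RawDiagram 0 0) _ _)⟩
    have hp : Subsingleton (DInfinity.toDirGraph.Path (.nat 0) 0 (.nat 0)) :=
      ⟨fun x y => by cases x; cases y; rfl⟩
    exact ⟨equivOfSubsingletonOfSubsingleton (fun _ => .nil) fun _ =>
      HalfDiagram.ofEven (idDiagram 0) (idDiagram_isDiagram 0) (idDiagram_allPropagating 0)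
        (by rw [idDiagram_numBlobs]; rfl)⟩
  · have h1 : IsEmpty (HalfDiagram 0 w) := ⟨fun h => by
      have := h.mem_layer
      cases w with
      | prime => exact absurd this.2 (by decide)
      | nat l => exact hw (by rw [Nat.le_zero.1 this.1])⟩
    have h2 : IsEmpty (DInfinity.toDirGraph.Path (.nat 0) 0 w) := ⟨fun h => by
      cases h; exact hw rfl⟩
    exact ⟨Equiv.equivOfIsEmpty _ _⟩

theorem exists_pascalArray :
    ∃ ψ : ∀ (n : ℕ) (e : DInfinity.toDirGraph.Edge),
        HalfDiagram n (DInfinity.toDirGraph.src e) → HalfDiagram (n + 1) (DInfinity.toDirGraph.tgt e),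
      IsPascalArray DInfinity.toDirGraph (DVertex.nat 0) HalfDiagram ψ ∧
      (∀ (n i : ℕ) (a : DInfinity.Adj (.nat i) (.nat (i + 1))) (h : HalfDiagram n (.nat i)),
        (ψ n ⟨(.nat i, .nat (i + 1)), a⟩ h).1 = RawDiagram.addLine false h.1) ∧
      (∀ (n i : ℕ) (a : DInfinity.Adj (.nat (i + 1)) (.nat i)) (h : HalfDiagram n (.nat (i + 1))),
        (ψ n ⟨(.nat (i + 1), .nat i), a⟩ h).1 = RawDiagram.bend false h.1) ∧
      (∀ (n : ℕ) (a : DInfinity.Adj .prime (.nat 1)) (h : HalfDiagram n .prime),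
        (ψ n ⟨(.prime, .nat 1), a⟩ h).1 = RawDiagram.addLine true h.1) ∧
      (∀ (n : ℕ) (a : DInfinity.Adj (.nat 1) .prime) (h : HalfDiagram n (.nat 1)),
        (ψ n ⟨(.nat 1, .prime), a⟩ h).1 = RawDiagram.bend true h.1) := by
  let κ : ∀ e : DInfinity.toDirGraph.Edge,
      DEdge (DInfinity.toDirGraph.src e) (DInfinity.toDirGraph.tgt e) := fun e =>
    (DEdge.nonempty_of_adj (SimpleGraph.Dart.adj e)).some
  have hκ : ∀ v w (a : DInfinity.Adj v w) (e : DEdge v w), κ ⟨(v, w), a⟩ = e := fun v w a e =>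
    Subsingleton.elim _ _
  refine ⟨fun n e => (κ e).map, ⟨nonempty_layer_zero_equiv, fun n e => (κ e).map_injective,
    fun n y => ?_⟩, ?_, ?_, ?_, ?_⟩
  · obtain ⟨w, y⟩ := y
    obtain ⟨v, e, x, rfl⟩ := DEdge.exists_map_eq y
    refine ⟨⟨(v, w), e.adj⟩, ⟨x, ?_⟩, ?_⟩
    · exact congrArg (fun e : DEdge v w => (⟨w, e.map x⟩ : Σ w, HalfDiagram (n + 1) w))
        (hκ v w e.adj e)
    · rintro ⟨⟨v', w'⟩, a⟩ ⟨x', hx'⟩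
      obtain ⟨rfl, h2⟩ := Sigma.mk.inj_iff.1 hx'
      have := DEdge.eq_of_map_eq _ _ (eq_of_heq h2)
      refine SimpleGraph.Dart.ext _ _ ?_
      exact Prod.ext this rfl
  · exact fun n i a h => congrArg (fun e => (DEdge.map e h).1) (hκ _ _ a (.up i))
  · exact fun n i a h => congrArg (fun e => (DEdge.map e h).1) (hκ _ _ a (.down i))
  · exact fun n a h => congrArg (fun e => (DEdge.map e h).1) (hκ _ _ a .upPrime)
  · exact fun n a h => congrArg (fun e => (DEdge.map e h).1) (hκ _ _ a .downPrime)

/-! ### Matrices of cups and caps -/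

namespace RawDiagram

variable {n m p : ℕ}

/-- Joining two new northern vertices at the eastern end by an arc. -/
def addCup (g : RawDiagram n m) : RawDiagram (n + 2) m := bend false (addLine false g)

theorem addCup_isDiagram {g : RawDiagram n m} (hg : g.IsDiagram) : (addCup g).IsDiagram :=
  bend_isDiagram (addLine_isDiagram hg (fun h => by cases h)) (fun h => by cases h)

theorem addCup_mat {g : RawDiagram n m} (hg : g.IsDiagram) (c : Fin n → ZMod 2) (a b : ZMod 2)
    (c' : Fin m → ZMod 2) :
    (addCup g).mat (Fin.snoc (Fin.snoc c a : Fin (n + 1) → ZMod 2) b : Fin (n + 2) → ZMod 2) c' =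
      if b = a then g.mat c c' else 0 := by
  rw [addCup, bend_mat (addLine_isDiagram hg (fun h => by cases h)).isPairing, addLine_mat]
  simp only [bit_false, add_zero]

theorem addCup_numBlobs {g : RawDiagram n m} (hg : g.IsDiagram) :
    ((addCup g).numBlobs : ZMod 2) = g.numBlobs := by
  rw [addCup, bend_numBlobs (addLine_isDiagram hg (fun h => by cases h)) (fun h => by cases h),
    addLine_numBlobs hg (fun h => by cases h)]
  simp

theorem addCup_allPropagating {g : RawDiagram n m} (hg : g.IsDiagram) :
    (addCup g).AllPropagating ↔ g.AllPropagating := by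
  refine ⟨fun h => ?_, fun h => bend_allPropagating (addLine_allPropagating.2 h)⟩
  rw [← addLine_allPropagating (b := false), ← unbend_bend false (addLine false g)]
  refine unbend_allPropagating (addCup_isDiagram hg).isPairing h (i := Fin.last n) ?_
  simp only [bend, unbendPt_last, addLine_mate_inr_last]
  rfl

theorem addCup_injective : Function.Injective (addCup : RawDiagram n m → _) := fun _ _ h =>
  addLine_injective (Function.LeftInverse.injective (unbend_bend false) h)

variable (n) in
/-- The matrix of a cup at the eastern end. -/
noncomputable def cupMat : Matrix (Fin (n + 2) → ZMod 2) (Fin n → ZMod 2) ℕ := (addCup (idDiagram n)).mat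

theorem cupMat_apply (c : Fin n → ZMod 2) (a b : ZMod 2) (c' : Fin n → ZMod 2) :
    cupMat n (Fin.snoc (Fin.snoc c a : Fin (n + 1) → ZMod 2) b : Fin (n + 2) → ZMod 2) c' =
      if b = a then (1 : Matrix (Fin n → ZMod 2) (Fin n → ZMod 2) ℕ) c c' else 0 := by
  rw [cupMat, addCup_mat (idDiagram_isDiagram n), idDiagram_mat]

theorem addCup_mat_eq {g : RawDiagram n m} (hg : g.IsDiagram) :
    (addCup g).mat = cupMat n * g.mat := by
  ext c c'
  obtain ⟨c, b, rfl⟩ := snoc_surj c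
  obtain ⟨c, a, rfl⟩ := snoc_surj c
  rw [addCup_mat hg, Matrix.mul_apply]
  simp only [cupMat_apply]
  split_ifs
  · rw [← Matrix.mul_apply, Matrix.one_mul]
  · simp

/-- A cap on a cup closes up to one loop. -/
theorem cupMat_transpose_mul : (cupMat n).transpose * cupMat n = 2 • 1 := by
  ext c c'
  rw [Matrix.mul_apply, sum_snoc, sum_snoc]
  simp only [Matrix.transpose_apply, cupMat_apply, mul_ite, mul_zero,
    Finset.sum_ite_eq', Finset.mem_univ, if_true, Matrix.one_apply, mul_one]
  simp only [Finset.sum_const, Finset.card_univ, ZMod.card, smul_eq_mul]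
  simp [Matrix.one_apply, eq_comm]

/-- A diagram on the western strands slides past a cup at the eastern end. -/
theorem addLine_addLine_mat_mul_cupMat (D : RawDiagram n m) :
    (addLine false (addLine false D)).mat * cupMat m = cupMat n * D.mat := by
  ext c c'
  obtain ⟨c, b, rfl⟩ := snoc_surj c
  obtain ⟨c, a, rfl⟩ := snoc_surj c
  rw [Matrix.mul_apply, Matrix.mul_apply, sum_snoc, sum_snoc]
  simp only [addLine_mat, cupMat_apply, bit_false, add_zero, ite_mul, zero_mul, mul_ite, mul_zero,
    Finset.sum_ite_eq', Finset.mem_univ, if_true]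
  by_cases h : b = a
  · subst h
    simp [Matrix.one_apply]
  · simp [h]

theorem cupMat_transpose_mul_addLine (D : RawDiagram n m) :
    (cupMat n).transpose * (addLine false (addLine false D)).mat =
      D.mat * (cupMat m).transpose := by
  ext c c'
  obtain ⟨c', b, rfl⟩ := snoc_surj c'
  obtain ⟨c', a, rfl⟩ := snoc_surj c'
  rw [Matrix.mul_apply, Matrix.mul_apply, sum_snoc, sum_snoc]
  simp only [addLine_mat, Matrix.transpose_apply, cupMat_apply, bit_false, add_zero, ite_mul,
    zero_mul, mul_ite, mul_zero, Finset.sum_ite_eq, Finset.mem_univ, if_true]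
  by_cases h : b = a
  · subst h
    simp [Matrix.one_apply]
  · simp [h]

theorem addLine_flip_mat (b : Bool) (D : RawDiagram n m) :
    (addLine b (flip D)).mat = (addLine b D).mat.transpose := by
  ext c c'
  obtain ⟨c', a', rfl⟩ := snoc_surj c'
  obtain ⟨c, a, rfl⟩ := snoc_surj c
  rw [Matrix.transpose_apply, addLine_mat, addLine_mat, flip_mat, Matrix.transpose_apply]
  refine if_congr ?_ rfl rfl
  generalize bit b = d
  revert a a' d
  decide

theorem addLine_idDiagram_mat : (addLine false (idDiagram n)).mat = 1 := by
  ext c c'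
  obtain ⟨c', b, rfl⟩ := snoc_surj c'
  obtain ⟨c, a, rfl⟩ := snoc_surj c
  rw [addLine_mat, idDiagram_mat]
  simp only [bit_false, add_zero, Matrix.one_apply, Fin.snoc_inj, ite_and]
  split_ifs <;> simp_all

/-- A cap and a cup on overlapping pairs of strands form a zigzag, which straightens to a line. -/
theorem addLine_addCup_transpose_mul :
    (addLine false (addCup (idDiagram n))).mat.transpose * cupMat (n + 1) = 1 := by
  ext c c'
  obtain ⟨c', b, rfl⟩ := snoc_surj c'
  obtain ⟨c, a, rfl⟩ := snoc_surj c
  rw [Matrix.mul_apply, sum_snoc, sum_snoc, sum_snoc]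
  simp only [Matrix.transpose_apply, addLine_mat, addCup_mat (idDiagram_isDiagram n),
    cupMat_apply, bit_false, add_zero, idDiagram_mat]
  simp only [Matrix.one_apply, Fin.snoc_inj]
  simp only [mul_ite, mul_zero, mul_one, ite_and, Finset.sum_ite_eq', Finset.mem_univ, if_true]
  rw [Finset.sum_eq_single c' (fun x _ hx => by simp [hx]) (by simp),
    Finset.sum_eq_single b (fun x _ hx => by simp [hx]) (by simp),
    Finset.sum_eq_single a (fun x _ hx => by simp [hx.symm]) (by simp)]
  simp only [if_true, eq_comm]
  split_ifs <;> rfl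

end RawDiagram

/-- Adding a vertical line at the eastern end. -/
def DDiagram.addLine {n : ℕ} (D : DDiagram n) : DDiagram (n + 1) :=
  ⟨RawDiagram.addLine false D.1, addLine_isDiagram D.2.1 (fun h => by cases h), by
    rw [even_numBlobs_iff, addLine_numBlobs D.2.1 (fun h => by cases h),
      (even_numBlobs_iff _).1 D.2.2]; rfl⟩

theorem DDiagram.addLine_injective {n : ℕ} :
    Function.Injective (DDiagram.addLine : DDiagram n → DDiagram (n + 1)) := fun _ _ h =>
  Subtype.ext (RawDiagram.addLine_injective (congrArg Subtype.val h))

/-- A cup and a cap at the eastern end. -/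
noncomputable def DDiagram.cupCap (n : ℕ) : DDiagram (n + 2) :=
  ⟨concat (addCup (idDiagram n)) (flip (addCup (idDiagram n))),
    concat_isDiagram (addCup_isDiagram (idDiagram_isDiagram n))
      (flip_isDiagram (addCup_isDiagram (idDiagram_isDiagram n))), by
    have h := addCup_isDiagram (idDiagram_isDiagram n)
    have h1 := (addCup_allPropagating (idDiagram_isDiagram n)).2 (idDiagram_allPropagating n)
    rw [even_numBlobs_iff, numBlobs_concat h.isPairing (flip_isDiagram h).isPairing
      (numLoops_eq_zero_of_fst h1).2, flip_numBlobs h]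
    exact zmod_two_add_self _⟩

theorem DDiagram.cupCap_mat (n : ℕ) :
    (DDiagram.cupCap n).1.mat = cupMat n * (cupMat n).transpose := by
  have h := addCup_isDiagram (idDiagram_isDiagram n)
  have h1 := (addCup_allPropagating (idDiagram_isDiagram n)).2 (idDiagram_allPropagating n)
  have h2 := mat_mul h.isPairing (flip_isDiagram h).isPairing (numLoops_eq_zero_of_fst h1).2
  rw [(numLoops_eq_zero_of_fst h1).1, pow_zero, one_smul, flip_mat] at h2
  exact h2.symm

theorem DDiagram.addLine_cupCap_mat (n : ℕ) : (DDiagram.cupCap n).addLine.1.mat =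
    (RawDiagram.addLine false (addCup (idDiagram n))).mat *
      (RawDiagram.addLine false (addCup (idDiagram n))).mat.transpose := by
  rw [← addLine_flip_mat]
  refine (Eq.trans (addLine_mat_mul (r := 1) (C := (DDiagram.cupCap n).1) ?_ false false) ?_).symm
  · rw [one_smul, DDiagram.cupCap_mat, flip_mat]; rfl
  · rw [one_smul]; rfl

/-! ### The embeddings and the Temperley–Lieb relations for the cup-cap elements -/

section Tower

variable (k : Type u) [Field k] (δ : k)

theorem diag_addLine_mul {n : ℕ} {D E C : DDiagram n} (h : ¬ HasOddLoop D.1 E.1)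
    (hC : C.1 = concat D.1 E.1) : DAlg.diag k δ D.addLine * DAlg.diag k δ E.addLine =
      δ ^ numLoops D.1 E.1 • DAlg.diag k δ C.addLine := by
  refine diag_mul_of_mat k δ ?_
  have := mat_mul D.isPairing E.isPairing h
  rw [← hC] at this
  exact addLine_mat_mul this false false

/-- The embedding `d_n → d_{n+1}` which adds a vertical line at the eastern end. -/
noncomputable def towerMap (n : ℕ) : DAlg k δ n →ₐ[k] DAlg k δ (n + 1) :=
  RingQuot.liftAlgHom k ⟨FreeAlgebra.lift k fun D => DAlg.diag k δ D.addLine, by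
    rintro _ _ (⟨D, h⟩ | ⟨D, E, C, h, hC⟩ | ⟨D, E, h⟩)
    · rw [FreeAlgebra.lift_ι_apply, map_one]
      refine diag_id k δ (mat_injective D.addLine.isPairing (idDiagram_isDiagram _).isPairing ?_)
      change (RawDiagram.addLine false D.1).mat = _
      rw [h, addLine_idDiagram_mat, idDiagram_mat]
    · rw [map_mul, map_smul]
      simp only [FreeAlgebra.lift_ι_apply]
      exact diag_addLine_mul k δ h hC
    · rw [map_mul, map_zero]
      simp only [FreeAlgebra.lift_ι_apply]
      refine diag_mul_of_mat_zero k δ ?_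
      have := addLine_mat_mul (r := 0) (C := concat D.1 E.1)
        ((mat_mul_of_odd D.isPairing E.isPairing h).trans (zero_smul ..).symm) false false
      rw [zero_smul] at this
      exact this⟩

@[simp] theorem towerMap_diag {n : ℕ} (D : DDiagram n) :
    towerMap k δ n (DAlg.diag k δ D) = DAlg.diag k δ D.addLine := by
  rw [towerMap, DAlg.diag]
  refine (RingQuot.liftAlgHom_mkAlgHom_apply ..).trans ?_
  rw [FreeAlgebra.lift_ι_apply]

theorem towerMap_injective (n : ℕ) : Function.Injective (towerMap k δ n) := by
  have h : (towerMap k δ n).toLinearMap ∘ diagBasis k δ n =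
      DAlg.diag k δ ∘ DDiagram.addLine := by
    funext D
    simp
  have h1 : LinearIndependent k ((towerMap k δ n).toLinearMap ∘ diagBasis k δ n) := by
    rw [h]
    exact (linearIndependent_diag k δ).comp _ DDiagram.addLine_injective
  exact LinearMap.injective_of_linearIndependent (diagBasis k δ n).span_eq h1

/-- The idempotent given by the cup and cap at the eastern end. -/
noncomputable def cupIdem (n : ℕ) : DAlg k δ (n + 2) := δ⁻¹ • DAlg.diag k δ (DDiagram.cupCap n)

theorem diag_cupCap_mul_self (n : ℕ) : DAlg.diag k δ (DDiagram.cupCap n) *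
    DAlg.diag k δ (DDiagram.cupCap n) = δ • DAlg.diag k δ (DDiagram.cupCap n) := by
  rw [diag_mul_of_mat k δ (r := 1) (C := DDiagram.cupCap n), pow_one]
  rw [DDiagram.cupCap_mat, Matrix.mul_assoc, ← Matrix.mul_assoc _ (cupMat n), cupMat_transpose_mul,
    Matrix.smul_mul, Matrix.one_mul, Matrix.mul_smul, pow_one]

/-- The smaller algebra acts on the first `n` strands, the cup and cap on the last two. -/
theorem diag_cupCap_comm {n : ℕ} (a : DAlg k δ n) :
    towerMap k δ (n + 1) (towerMap k δ n a) * DAlg.diag k δ (DDiagram.cupCap n) =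
      DAlg.diag k δ (DDiagram.cupCap n) * towerMap k δ (n + 1) (towerMap k δ n a) := by
  have := span_diag k δ (Submodule.mem_top (x := a))
  induction this using Submodule.span_induction with
  | mem a ha =>
    obtain ⟨D, rfl⟩ := ha
    rw [towerMap_diag, towerMap_diag]
    refine diag_mul_comm_of_mat k δ ?_
    rw [DDiagram.cupCap_mat, Matrix.mul_assoc, ← Matrix.mul_assoc]
    exact (congrArg (· * _) (addLine_addLine_mat_mul_cupMat D.1)).trans ((Matrix.mul_assoc ..).trans
      (congrArg _ (cupMat_transpose_mul_addLine D.1).symm))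
  | zero => simp
  | add a b _ _ ha hb => simp only [map_add, add_mul, mul_add, ha, hb]
  | smul c a _ ha => simp only [map_smul, smul_mul_assoc, mul_smul_comm, ha]

/-- Together with the companion relation below, these are the Temperley–Lieb relations between
neighbouring generators; both come from straightening the two zigzags in the middle of the triple
product. -/
theorem diag_cupCap_zigzag (n : ℕ) : towerMap k δ (n + 2) (DAlg.diag k δ (DDiagram.cupCap n)) *
    DAlg.diag k δ (DDiagram.cupCap (n + 1)) *
    towerMap k δ (n + 2) (DAlg.diag k δ (DDiagram.cupCap n)) =
      towerMap k δ (n + 2) (DAlg.diag k δ (DDiagram.cupCap n)) := by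
  rw [towerMap_diag, diag_mul_mul_of_mat k δ (r := 0) (C := (DDiagram.cupCap n).addLine), pow_zero,
    one_smul]
  have h := addLine_addCup_transpose_mul (n := n)
  have h' := congrArg Matrix.transpose h
  rw [Matrix.transpose_mul, Matrix.transpose_transpose, Matrix.transpose_one] at h'
  rw [DDiagram.cupCap_mat, DDiagram.addLine_cupCap_mat, pow_zero, one_smul]
  calc _ = (RawDiagram.addLine false (addCup (idDiagram n))).mat *
      ((RawDiagram.addLine false (addCup (idDiagram n))).mat.transpose * cupMat (n + 1)) *
      ((cupMat (n + 1)).transpose * (RawDiagram.addLine false (addCup (idDiagram n))).mat) *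
      (RawDiagram.addLine false (addCup (idDiagram n))).mat.transpose := by
        simp only [Matrix.mul_assoc]
    _ = _ := by rw [h, h', Matrix.mul_one, Matrix.mul_one]

theorem diag_cupCap_zigzag' (n : ℕ) : DAlg.diag k δ (DDiagram.cupCap (n + 1)) *
    towerMap k δ (n + 2) (DAlg.diag k δ (DDiagram.cupCap n)) *
    DAlg.diag k δ (DDiagram.cupCap (n + 1)) = DAlg.diag k δ (DDiagram.cupCap (n + 1)) := by
  rw [towerMap_diag, diag_mul_mul_of_mat k δ (r := 0) (C := DDiagram.cupCap (n + 1)), pow_zero,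
    one_smul]
  have h := addLine_addCup_transpose_mul (n := n)
  have h' := congrArg Matrix.transpose h
  rw [Matrix.transpose_mul, Matrix.transpose_transpose, Matrix.transpose_one] at h'
  rw [DDiagram.cupCap_mat, DDiagram.addLine_cupCap_mat, pow_zero, one_smul]
  calc _ = cupMat (n + 1) *
      ((cupMat (n + 1)).transpose * (RawDiagram.addLine false (addCup (idDiagram n))).mat) *
      ((RawDiagram.addLine false (addCup (idDiagram n))).mat.transpose * cupMat (n + 1)) *
      (cupMat (n + 1)).transpose := by
        simp only [Matrix.mul_assoc]
    _ = _ := by rw [h, h', Matrix.mul_one, Matrix.mul_one]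

end Tower

/-! ### Functors cutting out the part fixed by an idempotent -/

section Corner

variable {R S : Type u} [Ring R] [Ring S] (f : S →+* R) (e : R) (he : ∀ s, f s * e = e * f s)

/-- The part of a module fixed by an element `e`, as a module over a ring which maps to the
centralizer of `e`. -/
def corner (M : ModuleCat.{u} R) : Submodule S ((ModuleCat.restrictScalars f).obj M) where
  carrier := {x : M | e • x = x}
  add_mem' {x y} (hx : e • (x : M) = x) (hy : e • (y : M) = y) :=
    (smul_add e (x : M) (y : M)).trans (congrArg₂ _ hx hy)
  zero_mem' := (smul_zero e : e • (0 : M) = 0)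
  smul_mem' s x (hx : e • (x : M) = x) := by
    change e • f s • (x : M) = f s • (x : M)
    rw [← mul_smul, ← he, mul_smul, hx]

/-- The functor which sends a module to its part fixed by `e`. -/
noncomputable def cornerFunctor : ModuleCat.{u} R ⥤ ModuleCat.{u} S where
  obj M := ModuleCat.of S (corner f e he M)
  map {M N} φ := ModuleCat.ofHom
    (((ModuleCat.restrictScalars f).map φ).hom.restrict fun x (hx : e • (x : M) = x) => by
      exact (φ.hom.map_smul e x).symm.trans (congrArg φ.hom hx))

-- Taking the part fixed by an idempotent is exact, because a preimage `x` of a fixed element can be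
-- replaced by `e • x`. Finite generation is seen through dimension over `k`.
variable {e} in
theorem cornerFunctor_isExact {k : Type*} [Field k] [Algebra k R] [Algebra k S]
    [Module.Finite k R] (f : S →ₐ[k] R) (he : ∀ s, f.toRingHom s * e = e * f.toRingHom s)
    (hi : e * e = e) : IsExactFunctor (cornerFunctor f.toRingHom e he) := by
  have hadd : (cornerFunctor f.toRingHom e he).Additive := ⟨fun {X Y φ ψ} => rfl⟩
  have hex := ((cornerFunctor f.toRingHom e he).exact_tfae.out 1 3).mp fun T hT => by
    rw [ShortComplex.ShortExact.moduleCat_exact_iff_function_exact] at hT ⊢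
    rintro ⟨y, hy⟩
    constructor
    · intro h
      obtain ⟨x, hx⟩ := (hT y).1 (congrArg Subtype.val h)
      refine ⟨⟨e • x, ?_⟩, Subtype.ext ?_⟩
      · change e • e • x = e • x
        rw [← mul_smul, hi]
      · change T.f.hom (e • x) = y
        rw [map_smul]
        exact (congrArg (e • ·) hx).trans hy
    · rintro ⟨x, hx⟩
      exact Subtype.ext ((hT y).2 ⟨x.1, congrArg Subtype.val hx⟩)
  refine ⟨hadd, hex.1, hex.2, fun M hM => ?_⟩
  -- As `R` is finite over `k`, a finitely generated `M` is finite-dimensional. Its fixed part is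
  -- then a finite-dimensional subspace, and a spanning set over `k` also generates over `S`.
  let : Module k M := Module.compHom M (algebraMap k R)
  have : IsScalarTower k R M := ⟨fun c r x => by
    rw [Algebra.smul_def, mul_smul]; rfl⟩
  have : Module.Finite k M := Module.Finite.trans R M
  let N : Submodule k M :=
    { carrier := {x : M | e • x = x}
      add_mem' := (corner f.toRingHom e he M).add_mem
      zero_mem' := (corner f.toRingHom e he M).zero_mem
      smul_mem' := fun c x hx => by
        have := (corner f.toRingHom e he M).smul_mem (algebraMap k S c) hx
        have h2 : algebraMap k S c • (show (ModuleCat.restrictScalars f.toRingHom).obj M from x) =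
          c • x := by
          change f.toRingHom (algebraMap k S c) • x = _
          rw [AlgHom.toRingHom_eq_coe, RingHom.coe_coe, AlgHom.commutes]
          rfl
        rw [h2] at this
        exact this }
  obtain ⟨s, hs⟩ := (inferInstance : Module.Finite k N)
  refine ⟨Submodule.fg_def.2 ⟨show Set (corner f.toRingHom e he M) from (s : Set N),
    s.finite_toSet, ?_⟩⟩
  rw [eq_top_iff]
  rintro x -
  have hx : (show N from x) ∈ Submodule.span k (s : Set N) := hs ▸ Submodule.mem_top
  have key : ∀ y : N, y ∈ Submodule.span k (s : Set N) →
      (show corner f.toRingHom e he M from y) ∈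
        Submodule.span S (show Set (corner f.toRingHom e he M) from (s : Set N)) := by
    intro y hy
    induction hy using Submodule.span_induction with
    | mem y hy => exact Submodule.subset_span hy
    | zero => exact Submodule.zero_mem _
    | add y z _ _ h1 h2 => exact Submodule.add_mem _ h1 h2
    | smul c y _ h1 =>
      have := Submodule.smul_mem _ (algebraMap k S c) h1
      refine (congrArg (· ∈ Submodule.span S (show Set (corner f.toRingHom e he M) from (s : Set N)))
        (Subtype.ext ?_)).mp this
      change f.toRingHom (algebraMap k S c) • (y : M) = c • (y : M)
      rw [AlgHom.toRingHom_eq_coe, RingHom.coe_coe, AlgHom.commutes]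
      rfl
  exact key x hx

end Corner

/-! ### The functors between layers and their values on the diagram modules -/

section Tower

variable (k : Type u) [Field k] (δ : k)

/-- Adding two vertical lines at the eastern end. -/
noncomputable abbrev towerMap₂ (n : ℕ) : DAlg k δ n →ₐ[k] DAlg k δ (n + 2) :=
  (towerMap k δ (n + 1)).comp (towerMap k δ n)

theorem towerMap₂_comm {n : ℕ} (a : DAlg k δ n) :
    (towerMap₂ k δ n).toRingHom a * cupIdem k δ n = cupIdem k δ n * (towerMap₂ k δ n).toRingHom a := by
  rw [cupIdem, mul_smul_comm, smul_mul_assoc]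
  exact congrArg _ (diag_cupCap_comm k δ a)

/-- The functor from `d_{n+2}`-modules to `d_n`-modules given by the cup and cap at the
eastern end. -/
noncomputable def capFunctor {n : ℕ} : ∀ {m : ℕ}, m = n + 2 →
    (ModuleCat.{u} (DAlg k δ m) ⥤ ModuleCat.{u} (DAlg k δ n))
  | _, rfl => cornerFunctor (towerMap₂ k δ n).toRingHom (cupIdem k δ n) (towerMap₂_comm k δ)

variable {δ}

theorem cupIdem_mul_self (hδ : δ ≠ 0) (n : ℕ) : cupIdem k δ n * cupIdem k δ n = cupIdem k δ n := by
  rw [cupIdem, smul_mul_smul_comm, diag_cupCap_mul_self, smul_smul, mul_assoc, inv_mul_cancel₀ hδ,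
    mul_one]

theorem capFunctor_isExact (hδ : δ ≠ 0) {n m : ℕ} (h : m = n + 2) : IsExactFunctor (capFunctor k δ h) := by
  subst h
  exact cornerFunctor_isExact _ _ (cupIdem_mul_self k hδ n)

end Tower

/-- Adding a cup at the eastern end of a half diagram. -/
def HalfDiagram.addCup {n : ℕ} {v : DVertex} (h : HalfDiagram n v) : HalfDiagram (n + 2) v :=
  ⟨RawDiagram.addCup h.1, addCup_isDiagram h.2.1, (addCup_allPropagating h.2.1).2 h.2.2.1, by
    rw [even_numBlobs_iff, addCup_numBlobs h.2.1, ← even_numBlobs_iff]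
    exact h.2.2.2⟩

theorem HalfDiagram.addCup_injective {n : ℕ} {v : DVertex} :
    Function.Injective (HalfDiagram.addCup : HalfDiagram n v → HalfDiagram (n + 2) v) :=
  fun _ _ h => Subtype.ext (RawDiagram.addCup_injective (congrArg Subtype.val h))

section Tower

variable (k : Type u) [Field k] {δ : k}

theorem diag_cupCap_smul_addCup {n : ℕ} {v : DVertex} (h : HalfDiagram n v) :
    DAlg.diag k δ (DDiagram.cupCap n) • StdCarrier.half k δ h.addCup =
      δ • StdCarrier.half k δ h.addCup := by
  rw [diag_smul_half_of_mat k δ (r := 1) (h' := h.addCup), pow_one]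
  refine (congrArg _ (addCup_mat_eq h.2.1)).trans (Eq.trans ?_ (congrArg _ (addCup_mat_eq h.2.1).symm))
  rw [DDiagram.cupCap_mat, Matrix.mul_assoc, ← Matrix.mul_assoc _ (cupMat n), cupMat_transpose_mul,
    Matrix.smul_mul, Matrix.one_mul, Matrix.mul_smul, pow_one]

/-- The cup and cap at the eastern end act on half diagrams through half diagrams with a cup
there. -/
theorem diag_cupCap_smul_half {n : ℕ} {v : DVertex} (g : HalfDiagram (n + 2) v) :
    DAlg.diag k δ (DDiagram.cupCap n) • StdCarrier.half k δ g = 0 ∨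
    ∃ (h : HalfDiagram n v) (r : ℕ), DAlg.diag k δ (DDiagram.cupCap n) • StdCarrier.half k δ g =
      δ ^ r • StdCarrier.half k δ h.addCup := by
  have hA := addCup_isDiagram (idDiagram_isDiagram n)
  have hA' := flip_isDiagram hA
  by_cases ho : HasOddLoop (flip (addCup (idDiagram n))) g.1
  · left
    refine diag_smul_half_of_mat_zero k δ ?_
    rw [DDiagram.cupCap_mat, Matrix.mul_assoc]
    have := mat_mul_of_odd hA'.isPairing g.isPairing ho
    rw [flip_mat] at this
    exact (congrArg (cupMat n * ·) this).trans (Matrix.mul_zero _)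
  have hd := concat_isDiagram hA' g.2.1
  have hm : (DDiagram.cupCap n).1.mat * g.1.mat =
      2 ^ numLoops (flip (addCup (idDiagram n))) g.1 •
        (RawDiagram.addCup (concat (flip (addCup (idDiagram n))) g.1)).mat := by
    rw [DDiagram.cupCap_mat, Matrix.mul_assoc, addCup_mat_eq hd, ← Matrix.mul_smul,
      ← mat_mul hA'.isPairing g.isPairing ho, flip_mat]
    rfl
  by_cases hp : (concat (flip (addCup (idDiagram n))) g.1).AllPropagating
  · right
    refine ⟨⟨concat (flip (addCup (idDiagram n))) g.1, hd, hp, ?_⟩, _,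
      diag_smul_half_of_mat k δ hm⟩
    rw [even_numBlobs_iff, numBlobs_concat hA'.isPairing g.isPairing ho, flip_numBlobs hA,
      addCup_numBlobs (idDiagram_isDiagram n), idDiagram_numBlobs, Nat.cast_zero, zero_add,
      ← even_numBlobs_iff]
    exact g.2.2.2
  · exact Or.inl (diag_smul_half_of_mat_not k δ (addCup_isDiagram hd).isPairing
      (fun h => hp ((addCup_allPropagating hd).1 h)) hm)

/-- Attaching a cup identifies `Δ_n(v)` with the fixed part of `Δ_{n+2}(v)`: it is injective on
bases, and the idempotent only produces half diagrams with a cup in this place. No condition on `v`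
is needed, as both sides vanish when there are no half diagrams. -/
theorem capFunctor_stdModule (hδ : δ ≠ 0) {n m : ℕ} (h : m = n + 2) (v : DVertex) :
    Nonempty ((capFunctor k δ h).obj (stdModule k δ m v) ≅ stdModule k δ n v) := by
  subst h
  let M := corner (towerMap₂ k δ n).toRingHom (cupIdem k δ n) (towerMap₂_comm k δ)
    (stdModule k δ (n + 2) v)
  let F : HalfDiagram n v → M := fun h => ⟨StdCarrier.half k δ h.addCup, by
    change cupIdem k δ n • StdCarrier.half k δ h.addCup = StdCarrier.half k δ h.addCup
    rw [cupIdem, smul_assoc, diag_cupCap_smul_addCup, smul_smul, inv_mul_cancel₀ hδ, one_smul]⟩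
  let val : M → StdCarrier k δ (n + 2) v := Subtype.val
  have hF : ∀ (D : DDiagram n) (h : HalfDiagram n v), val (DAlg.diag k δ D • F h) = DAlg.diag k δ D.addLine.addLine • StdCarrier.half k δ h.addCup := by
    intro D h
    change (towerMap k δ (n + 1) (towerMap k δ n (DAlg.diag k δ D))) • StdCarrier.half k δ h.addCup = _
    rw [towerMap_diag, towerMap_diag]
  -- The matrix of a half diagram with a cup has the cup as a left factor, so the action of `d_n`
  -- passes through the cup.
  have hm : ∀ (D : DDiagram n) (h : HalfDiagram n v),
      D.addLine.addLine.1.mat * h.addCup.1.mat = cupMat n * (D.1.mat * h.1.mat) := by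
    intro D h
    refine (congrArg _ (addCup_mat_eq h.2.1)).trans ?_
    rw [← Matrix.mul_assoc, ← Matrix.mul_assoc]
    exact congrArg (· * h.1.mat) (addLine_addLine_mat_mul_cupMat D.1)
  obtain ⟨φ, hφ⟩ := StdCarrier.exists_lift k δ F (fun D h h' h1 h2 => by
      refine Subtype.ext ((hF D h).trans ?_)
      change _ = (towerMap₂ k δ n (algebraMap k _ (δ ^ _))) • StdCarrier.half k δ h'.addCup
      rw [AlgHom.commutes, algebraMap_smul]
      refine diag_smul_half_of_mat k δ ?_
      rw [hm, mat_mul D.isPairing h.isPairing h1, Matrix.mul_smul, ← h2]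
      exact congrArg _ (addCup_mat_eq h'.2.1).symm) (fun D h h1 => by
      refine Subtype.ext ((hF D h).trans ?_)
      by_cases ho : HasOddLoop D.1 h.1
      · refine diag_smul_half_of_mat_zero k δ ?_
        rw [hm, mat_mul_of_odd D.isPairing h.isPairing ho, Matrix.mul_zero]
      · have hd := concat_isDiagram D.2.1 h.2.1
        refine diag_smul_half_of_mat_not k δ (g := RawDiagram.addCup (concat D.1 h.1))
          (addCup_isDiagram hd).isPairing
          (fun h2 => (h1.resolve_left ho) ((addCup_allPropagating hd).1 h2)) ?_ (r := numLoops D.1 h.1)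
        rw [hm, mat_mul D.isPairing h.isPairing ho, addCup_mat_eq hd, Matrix.mul_smul])
  let φ' : StdCarrier k δ n v →ₗ[k] StdCarrier k δ (n + 2) v :=
    { toFun := fun x => val (φ x)
      map_add' := fun x y => by rw [map_add]; rfl
      map_smul' := fun c x => by
        rw [← algebraMap_smul (DAlg k δ n) c x, map_smul]
        change towerMap₂ k δ n (algebraMap k _ c) • val (φ x) = c • val (φ x)
        rw [AlgHom.commutes, algebraMap_smul] }
  have hφ' : ∀ h, φ' (StdCarrier.half k δ h) = StdCarrier.half k δ h.addCup :=
    fun h => congrArg Subtype.val (hφ h)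
  have inj : Function.Injective φ' := by
    refine LinearMap.injective_of_linearIndependent (halfBasis k δ n v).span_eq ?_
    have : φ' ∘ halfBasis k δ n v = StdCarrier.half k δ ∘ HalfDiagram.addCup := by
      funext h
      rw [Function.comp_apply, halfBasis_apply, hφ']
      rfl
    rw [this]
    exact (linearIndependent_half k δ).comp _ HalfDiagram.addCup_injective
  have surj : ∀ x : StdCarrier k δ (n + 2) v, cupIdem k δ n • x ∈ LinearMap.range φ' := by
    intro x
    have := span_half k δ (Submodule.mem_top (x := x))
    induction this using Submodule.span_induction with
    | mem x hx =>
      obtain ⟨g, rfl⟩ := hx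
      rw [cupIdem, smul_assoc]
      refine Submodule.smul_mem _ _ ?_
      rcases diag_cupCap_smul_half k (δ := δ) g with h | ⟨h, r, hr⟩
      · rw [h]; exact Submodule.zero_mem _
      · rw [hr, ← hφ']
        exact Submodule.smul_mem _ _ ⟨_, rfl⟩
    | zero => rw [smul_zero]; exact Submodule.zero_mem _
    | add a b _ _ ha hb => rw [smul_add]; exact Submodule.add_mem _ ha hb
    | smul c a _ ha => rw [smul_comm]; exact Submodule.smul_mem _ _ ha
  refine ⟨(LinearEquiv.toModuleIso (LinearEquiv.ofBijective φ ⟨fun x y h =>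
    inj (congrArg Subtype.val h), ?_⟩)).symm⟩
  rintro ⟨x, hx⟩
  obtain ⟨y, hy⟩ := surj x
  exact ⟨y, Subtype.ext (hy.trans hx)⟩

/-- The functors commute with restriction. -/
theorem capFunctor_towerRes (hδ : δ ≠ 0) {n m : ℕ} (h : m = n + 2) (h' : m + 1 = n + 1 + 2)
    (M : ModuleCat.{u} (DAlg k δ (m + 1))) :
    Nonempty ((capFunctor k δ h).obj ((towerRes k (fun n => DAlg k δ n) (towerMap k δ) m).obj M) ≅
      (towerRes k (fun n => DAlg k δ n) (towerMap k δ) n).obj ((capFunctor k δ h').obj M)) := by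
  subst h
  -- `X` and `Y` are neighbouring cup-cap elements, and `e`, `e'` their normalisations. By the
  -- zigzag relations, multiplication by `Y` and by `X` are inverse maps between the parts fixed by
  -- `e` and `e'`. They are linear over `d_n`, which commutes with `Y`.
  let X := towerMap k δ (n + 2) (DAlg.diag k δ (DDiagram.cupCap n))
  let Y := DAlg.diag k δ (DDiagram.cupCap (n + 1))
  let e := towerMap k δ (n + 2) (cupIdem k δ n)
  have he : e = δ⁻¹ • X := map_smul ..
  let e' := cupIdem k δ (n + 1)
  have h1 : X * Y * e = e := by
    rw [he, mul_smul_comm]; exact congrArg _ (diag_cupCap_zigzag k δ n)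
  have h2 : Y * X * e' = e' := (mul_smul_comm ..).trans (congrArg _ (diag_cupCap_zigzag' k δ n))
  have h3 : e * X = X := by
    rw [he, smul_mul_assoc, ← map_mul, diag_cupCap_mul_self, map_smul, smul_smul,
      inv_mul_cancel₀ hδ, one_smul]
  have h4 : e' * Y = Y := by
    refine (smul_mul_assoc ..).trans ?_
    rw [diag_cupCap_mul_self, smul_smul, inv_mul_cancel₀ hδ, one_smul]
  let t : DAlg k δ n → DAlg k δ (n + 3) := fun s =>
    towerMap k δ (n + 2) (towerMap k δ (n + 1) (towerMap k δ n s))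
  have h5 : ∀ s, Y * t s = t s * Y := fun s => (diag_cupCap_comm k δ (towerMap k δ n s)).symm
  let N₁ := corner (towerMap₂ k δ n).toRingHom (cupIdem k δ n) (towerMap₂_comm k δ)
    ((towerRes k (fun n => DAlg k δ n) (towerMap k δ) (n + 2)).obj M)
  let N₂ := (ModuleCat.restrictScalars (towerMap k δ n).toRingHom).obj (ModuleCat.of _
    (corner (towerMap₂ k δ (n + 1)).toRingHom (cupIdem k δ (n + 1)) (towerMap₂_comm k δ) M))
  suffices N₁ ≃ₗ[DAlg k δ n] N₂ from ⟨this.toModuleIso⟩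
  refine
    { toFun := fun x => ⟨Y • (show M from x.1), ?_⟩
      invFun := fun y => ⟨X • (show M from y.1), ?_⟩
      map_add' := fun x y => Subtype.ext (smul_add Y (show M from x.1) (show M from y.1))
      map_smul' := fun s x => Subtype.ext ?_
      left_inv := fun x => Subtype.ext ?_
      right_inv := fun y => Subtype.ext ?_ }
  · change e' • Y • (show M from x.1) = Y • (show M from x.1)
    rw [← mul_smul, h4]
  · change Y • t s • (show M from x.1) = t s • Y • (show M from x.1)
    rw [← mul_smul, ← mul_smul, h5]
  · change e • X • (show M from y.1) = X • (show M from y.1)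
    rw [← mul_smul, h3]
  · have hx : e • (show M from x.1) = x.1 := x.2
    change X • Y • (show M from x.1) = (show M from x.1)
    calc _ = (X * Y * e) • (show M from x.1) := by rw [mul_smul, mul_smul, hx]
      _ = _ := by rw [h1]; exact hx
  · have hy : e' • (show M from y.1) = y.1 := y.2
    change Y • X • (show M from y.1) = (show M from y.1)
    calc _ = (Y * X * e') • (show M from y.1) := by rw [mul_smul, mul_smul, hy]
      _ = _ := by rw [h2]; exact hy

end Tower

/-! ### Factoring diagrams through their propagating lines -/

namespace RawDiagram

variable {n m p : ℕ}

/-- There is an invertible diagram with a single blob. -/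
theorem exists_twist (p : ℕ) : ∃ B : RawDiagram (p + 1) (p + 1), B.IsDiagram ∧ B.AllPropagating ∧
    (B.numBlobs : ZMod 2) = 1 ∧ B.mat * B.mat.transpose = 1 := by
  have step : ∀ (b : Bool) {n : ℕ} (D : RawDiagram n n), D.mat * D.mat.transpose = 1 →
      (addLine b D).mat * (addLine b D).mat.transpose = 1 := by
    intro b n D h
    have := addLine_mat_mul (r := 1) (C := idDiagram n) (E := flip D) (D := D)
      (by rw [flip_mat, h, idDiagram_mat, one_smul]) b b
    rw [Bool.xor_self, one_smul, addLine_idDiagram_mat, addLine_flip_mat] at this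
    exact this
  induction p with
  | zero =>
    have h := idDiagram_isDiagram 0
    refine ⟨addLine true (idDiagram 0), addLine_isDiagram h fun _ => rfl,
      addLine_allPropagating.2 (idDiagram_allPropagating 0), ?_, step _ _ ?_⟩
    · rw [addLine_numBlobs h fun _ => rfl, idDiagram_numBlobs]; rfl
    · rw [idDiagram_mat, Matrix.transpose_one, Matrix.one_mul]
  | succ p ih =>
    obtain ⟨B, h1, h2, h3, h4⟩ := ih
    refine ⟨addLine false B, addLine_isDiagram h1 (fun h => by cases h),
      addLine_allPropagating.2 h2, ?_, step _ _ h4⟩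
    rw [addLine_numBlobs h1 (fun h => by cases h), h3]; rfl

/-- Every diagram is the product of a diagram and a reflected diagram all of whose southern
vertices are on propagating lines. -/
theorem IsDiagram.exists_factorization {C : RawDiagram n m} (hC : C.IsDiagram) :
    ∃ (p : ℕ) (x : RawDiagram n p) (y : RawDiagram m p), x.IsDiagram ∧ x.AllPropagating ∧
      y.IsDiagram ∧ y.AllPropagating ∧ C.mat = x.mat * y.mat.transpose := by
  induction n generalizing m with
  | zero =>
    refine ⟨0, idDiagram 0, flip C, idDiagram_isDiagram 0, idDiagram_allPropagating 0,
      flip_isDiagram hC, fun j => j.elim0, ?_⟩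
    rw [idDiagram_mat, flip_mat, Matrix.transpose_transpose, Matrix.one_mul]
  | succ n ih =>
    -- The last northern vertex is moved to the southern edge, the smaller diagram is factored, and
    -- the vertex is moved back.
    have hC' := unbend_isDiagram hC (b := false) (fun h => by cases h)
    obtain ⟨p, x, y, hx, hx', hy, hy', h⟩ := ih hC'
    have hmat : ∀ c c' a, C.mat (Fin.snoc c a : Fin (n + 1) → ZMod 2) c' =
        ∑ d, x.mat c d * y.mat (Fin.snoc c' a : Fin (m + 1) → ZMod 2) d := by
      intro c c' a
      have h1 := congrFun (congrFun h c) (Fin.snoc c' a)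
      rw [Matrix.mul_apply] at h1
      conv_lhs => rw [← bend_unbend false C]
      rw [bend_mat hC'.isPairing, bit_false, add_zero, h1]
      rfl
    -- If the moved vertex is joined to another southern vertex, its arc becomes a new propagating
    -- line. If it is on the last propagating line, this line, with its blob, is bent over in `x`.
    rcases hy'.mate_last hy with ⟨i, hi⟩ | ⟨j, hj, hj'⟩
    · have hy2 := unbend_isDiagram hy (b := false) (fun h => by cases h)
      refine ⟨p + 1, addLine false x, unbend false y, addLine_isDiagram hx (fun h => by cases h),
        addLine_allPropagating.2 hx', hy2, unbend_allPropagating hy.isPairing hy' hi, ?_⟩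
      ext c c'
      obtain ⟨c, a, rfl⟩ := snoc_surj c
      rw [hmat, Matrix.mul_apply, sum_snoc]
      simp only [addLine_mat, bit_false, add_zero, ite_mul, zero_mul, Finset.sum_ite_eq',
        Finset.mem_univ, if_true, Matrix.transpose_apply]
      refine Finset.sum_congr rfl fun d _ => ?_
      conv_lhs => rw [← bend_unbend false y]
      rw [bend_mat hy2.isPairing, bit_false, add_zero]
    · obtain ⟨q, rfl⟩ : ∃ q, p = q + 1 := ⟨j, hj'.symm⟩
      obtain rfl : j = Fin.last q := Fin.ext (by simpa using hj')
      obtain ⟨y', hy2, hyy⟩ := exists_eq_addLine hy hj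
      have hb := hy'.eq_zero_of_blob hy hj
      generalize y.blob (.inl (Fin.last m)) = b at hyy hb
      subst hyy
      refine ⟨q, bend b x, y', bend_isDiagram hx hb, bend_allPropagating hx', hy2,
        addLine_allPropagating.1 hy', ?_⟩
      ext c c'
      obtain ⟨c, a, rfl⟩ := snoc_surj c
      rw [hmat, Matrix.mul_apply, sum_snoc]
      simp only [addLine_mat, bend_mat hx.isPairing, mul_ite, mul_zero, Finset.sum_ite_eq',
        Finset.mem_univ, if_true, Matrix.transpose_apply]

/-- The two blobs on the resulting loop cancel, so it counts as an ordinary loop. -/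
theorem bend_idDiagram_transpose_mul :
    (bend true (idDiagram 1)).mat.transpose * (bend true (idDiagram 1)).mat = 2 • 1 := by
  have h1 := (idDiagram_isDiagram 1).isPairing
  ext c c'
  obtain rfl : c = c' := Subsingleton.elim _ _
  rw [Matrix.mul_apply, sum_snoc, Finset.sum_comm]
  simp only [Matrix.transpose_apply, bend_mat h1, idDiagram_mat,
    Matrix.one_apply, mul_ite, mul_one, mul_zero, Finset.sum_ite_eq', Finset.mem_univ,
    if_true]
  simp

end RawDiagram

/-! ### The rank of a vertex, and products of half diagrams with reflected ones -/

namespace DVertex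

/-- The parity of the number of blobs on the half diagrams belonging to a vertex. -/
def parity : DVertex → ZMod 2
  | prime => 1
  | nat _ => 0

/-- The vertices in the order in which the standard filtration of `d_n` runs through them. -/
def rank : DVertex → ℕ
  | prime => 1
  | nat 0 => 0
  | nat (l + 1) => l + 2

theorem rank_injective : Function.Injective rank := by
  rintro (_ | _ | l) (_ | _ | l') h <;> simp_all [rank]

theorem rank_lt_of_lines_lt {v w : DVertex} (h : v.lines < w.lines) : v.rank < w.rank := by
  rcases v with _ | _ | l <;> rcases w with _ | _ | l' <;> simp_all [rank, lines]

theorem lines_lt_of_rank_lt {v w : DVertex} (h : v.rank < w.rank) :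
    v.lines < w.lines ∨ v = nat 0 ∧ w = prime := by
  rcases v with _ | _ | l <;> rcases w with _ | _ | l' <;> simp_all [rank, lines]

end DVertex

namespace HalfDiagram

variable {n : ℕ} {v w : DVertex}

theorem numBlobs_eq (h : HalfDiagram n v) : (h.1.numBlobs : ZMod 2) = v.parity := by
  cases v with
  | prime => exact h.primeRaw_numBlobs
  | nat l => exact h.natRaw_numBlobs

/-- A half diagram is given by a diagram with the right parity. -/
theorem of_numBlobs_eq (g : RawDiagram n v.lines) (h : (g.numBlobs : ZMod 2) = v.parity) :
    Even g.numBlobs ↔ v ≠ .prime := by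
  rw [even_numBlobs_iff, h]
  cases v <;> simp [DVertex.parity]

/-- In every layer there is a half diagram which is symmetric to its inverse up to loops. -/
theorem exists_core (hv : v ∈ DVertex.layer n) :
    ∃ (a : HalfDiagram n v) (r : ℕ), a.1.mat.transpose * a.1.mat = 2 ^ r • 1 := by
  -- Start in the first layer containing the vertex, with vertical lines or, for 0', the blobbed
  -- cup. Every further cup contributes one loop.
  have key : ∀ t, ∃ (a : HalfDiagram (v.level + 2 * t) v) (r : ℕ),
      a.1.mat.transpose * a.1.mat = 2 ^ r • 1 := by
    intro t
    induction t with
    | zero =>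
      cases v with
      | prime =>
        have h1 := idDiagram_isDiagram 1
        refine ⟨ofOdd (bend true (idDiagram 1)) (bend_isDiagram h1 fun _ => rfl) ?_, 1, ?_⟩
        · exact (bend_numBlobs h1 fun _ => rfl).trans (by rw [idDiagram_numBlobs]; rfl)
        · exact bend_idDiagram_transpose_mul.trans (by rw [pow_one]; rfl)
      | nat l =>
        refine ⟨ofEven (idDiagram l) (idDiagram_isDiagram l) (idDiagram_allPropagating l)
          ((congrArg _ (idDiagram_numBlobs l)).trans Nat.cast_zero), 0, ?_⟩
        refine (congrArg (fun A : Matrix (Fin l → ZMod 2) (Fin l → ZMod 2) ℕ => A.transpose * A)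
          (idDiagram_mat l)).trans ?_
        rw [Matrix.transpose_one, Matrix.one_mul, pow_zero, one_smul]
        rfl
    | succ t ih =>
      obtain ⟨a, r, h⟩ := ih
      refine ⟨a.addCup, r + 1, ?_⟩
      change (RawDiagram.addCup a.1).mat.transpose * (RawDiagram.addCup a.1).mat = _
      rw [addCup_mat_eq a.2.1, Matrix.transpose_mul, Matrix.mul_assoc, ← Matrix.mul_assoc _ (cupMat _),
        cupMat_transpose_mul, Matrix.smul_mul, Matrix.one_mul, Matrix.mul_smul, h, pow_succ',
        mul_smul]
  obtain ⟨t, rfl⟩ : ∃ t, n = v.level + 2 * t := by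
    cases v with
    | prime =>
      obtain ⟨⟨s, h1⟩, h2⟩ := hv
      exact ⟨s - 1, by simp only [DVertex.level]; omega⟩
    | nat l =>
      obtain ⟨h1, h2⟩ := hv
      have h2 : l % 2 = n % 2 := h2
      exact ⟨(n - l) / 2, by simp only [DVertex.level]; omega⟩
  exact key t

/-- The diagram whose northern half is `x` and whose southern half is the reflection of `y`. -/
noncomputable def outer (x y : HalfDiagram n v) : DDiagram n :=
  ⟨concat x.1 (flip y.1), concat_isDiagram x.2.1 (flip_isDiagram y.2.1), by
    rw [even_numBlobs_iff, numBlobs_concat x.isPairing (flip_isDiagram y.2.1).isPairing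
      (numLoops_eq_zero_of_fst x.2.2.1).2, flip_numBlobs y.2.1, x.numBlobs_eq, y.numBlobs_eq]
    exact zmod_two_add_self _⟩

theorem outer_mat (x y : HalfDiagram n v) : (outer x y).1.mat = x.1.mat * y.1.mat.transpose := by
  have h1 := numLoops_eq_zero_of_fst (E := flip y.1) x.2.2.1
  have h2 := mat_mul x.isPairing (flip_isDiagram y.2.1).isPairing h1.2
  rw [h1.1, pow_zero, one_smul, flip_mat] at h2
  exact h2.symm

theorem concat_flip_numBlobs {y : HalfDiagram n v} {h : HalfDiagram n w}
    (ho : ¬ HasOddLoop (flip y.1) h.1) :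
    ((concat (flip y.1) h.1).numBlobs : ZMod 2) = v.parity + w.parity := by
  rw [numBlobs_concat (flip_isDiagram y.2.1).isPairing h.isPairing ho, flip_numBlobs y.2.1,
    y.numBlobs_eq, h.numBlobs_eq]

section Action

variable (k : Type u) [Field k] (δ : k)

/-- The action of `outer x y`: either zero or multiplication of `x` with a diagram. -/
theorem diag_outer_smul (x y : HalfDiagram n v) (h : HalfDiagram n w) :
    DAlg.diag k δ (outer x y) • StdCarrier.half k δ h = 0 ∨
    ∃ (s : ℕ) (P : RawDiagram v.lines w.lines) (g : HalfDiagram n w), P.IsDiagram ∧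
      P.AllPropagating ∧ (P.numBlobs : ZMod 2) = v.parity + w.parity ∧
      g.1 = concat x.1 P ∧ g.1.mat = x.1.mat * P.mat ∧
      DAlg.diag k δ (outer x y) • StdCarrier.half k δ h = δ ^ s • StdCarrier.half k δ g := by
  have hy := flip_isDiagram y.2.1
  by_cases ho : HasOddLoop (flip y.1) h.1
  · left
    refine diag_smul_half_of_mat_zero k δ ?_
    rw [outer_mat, Matrix.mul_assoc, ← flip_mat, mat_mul_of_odd hy.isPairing h.isPairing ho,
      Matrix.mul_zero]
  have hP := concat_isDiagram hy h.2.1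
  have hl := numLoops_eq_zero_of_fst (E := concat (flip y.1) h.1) x.2.2.1
  have hm := mat_mul x.isPairing hP.isPairing hl.2
  rw [hl.1, pow_zero, one_smul] at hm
  have hm2 : (outer x y).1.mat * h.1.mat = 2 ^ numLoops (flip y.1) h.1 •
      (concat x.1 (concat (flip y.1) h.1)).mat := by
    rw [outer_mat, Matrix.mul_assoc, ← flip_mat, mat_mul hy.isPairing h.isPairing ho,
      Matrix.mul_smul, hm]
  by_cases hp : (concat (flip y.1) h.1).AllPropagating
  · right
    refine ⟨_, _, ⟨concat x.1 (concat (flip y.1) h.1), concat_isDiagram x.2.1 hP,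
      concat_allPropagating x.isPairing hP.isPairing x.2.2.1 hp, of_numBlobs_eq _ ?_⟩, hP, hp,
      concat_flip_numBlobs ho, rfl, hm.symm, diag_smul_half_of_mat k δ hm2⟩
    rw [numBlobs_concat x.isPairing hP.isPairing hl.2, concat_flip_numBlobs ho, x.numBlobs_eq,
      ← add_assoc, zmod_two_add_self, zero_add]
  · exact Or.inl (diag_smul_half_of_mat_not k δ
      (concat_isPairing x.isPairing hP.isPairing)
      (fun h => hp (allPropagating_of_concat x.isPairing hP.isPairing h)) hm2)

/-- A nonzero product passes through a diagram `P` in which all lines of `w` propagate to lines of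
`v`, so `w` has at most as many lines. This leaves only `v = 0`, `w = 0'`, where the empty diagram
`P` would need an odd number of blobs. -/
theorem diag_outer_smul_of_rank_lt (x y : HalfDiagram n v) (h : HalfDiagram n w)
    (hr : v.rank < w.rank) : DAlg.diag k δ (outer x y) • StdCarrier.half k δ h = 0 := by
  refine (diag_outer_smul k δ x y h).resolve_right ?_
  rintro ⟨s, P, -, hP, hp, hb, -⟩
  rcases DVertex.lines_lt_of_rank_lt hr with hl | ⟨rfl, rfl⟩
  · exact absurd (hp.le hP.isPairing) (not_le.2 hl)
  · have : P.numBlobs = 0 := numBlobs_zero P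
    rw [this] at hb
    exact absurd hb (by decide)

/-- The diagram in the middle has only propagating lines and an even number of blobs, hence is the
identity. -/
theorem diag_outer_smul_self (x y h : HalfDiagram n v) :
    ∃ c : k, DAlg.diag k δ (outer x y) • StdCarrier.half k δ h = c • StdCarrier.half k δ x := by
  rcases diag_outer_smul k δ x y h with h1 | ⟨s, P, g, hP, hp, hb, -, hg, h1⟩
  · exact ⟨0, h1.trans (zero_smul ..).symm⟩
  · rw [zmod_two_add_self] at hb
    obtain rfl := hp.eq_idDiagram hP ((even_numBlobs_iff P).2 hb)
    rw [idDiagram_mat, Matrix.mul_one] at hg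
    obtain rfl : g = x := Subtype.ext (mat_injective g.isPairing x.isPairing hg)
    exact ⟨_, h1⟩

end Action

end HalfDiagram

namespace RawDiagram

theorem AllPropagating.flip {n : ℕ} {y : RawDiagram n n} (h : y.AllPropagating) (hy : y.IsDiagram) :
    (flip y).AllPropagating := fun j => ⟨j, by
  change (y.mate (.inl j)).swap = _
  rw [h.mate_inl hy]; rfl⟩

/-- A half diagram from an even diagram or from an odd one without lines. -/
theorem exists_halfDiagram_pair {n p : ℕ} {x y : RawDiagram n p} (hx : x.IsDiagram)
    (hx' : x.AllPropagating) (hy : y.IsDiagram) (hy' : y.AllPropagating)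
    (h : (x.numBlobs : ZMod 2) = y.numBlobs) : ∃ (j : DVertex) (x' y' : HalfDiagram n j),
      j.lines = p ∧ x.mat * y.mat.transpose = x'.1.mat * y'.1.mat.transpose := by
  obtain h0 | h1 : (x.numBlobs : ZMod 2) = 0 ∨ (x.numBlobs : ZMod 2) = 1 := by
    generalize (x.numBlobs : ZMod 2) = s
    revert s
    decide
  · exact ⟨.nat p, HalfDiagram.ofEven x hx hx' h0, HalfDiagram.ofEven y hy hy' (h ▸ h0), rfl, rfl⟩
  · cases p with
    | zero => exact ⟨.prime, HalfDiagram.ofOdd x hx h1, HalfDiagram.ofOdd y hy (h ▸ h1), rfl, rfl⟩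
    | succ p =>
      -- The twist `B` has one blob and `B Bᵀ = 1`. Inserting `B Bᵀ` between the halves makes the
      -- number of blobs on each of them even without changing the product.
      obtain ⟨B, b1, b2, b3, b4⟩ := exists_twist p
      have key : ∀ z : RawDiagram n (p + 1), z.IsDiagram → z.AllPropagating →
          (z.numBlobs : ZMod 2) = 1 → ∃ z' : HalfDiagram n (.nat (p + 1)),
            z'.natRaw.mat = z.mat * B.mat := by
        intro z hz hz' hz1
        have hl := numLoops_eq_zero_of_fst (E := B) hz'
        refine ⟨HalfDiagram.ofEven (concat z B) (concat_isDiagram hz b1)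
          (concat_allPropagating hz.isPairing b1.isPairing hz' b2) ?_, ?_⟩
        · rw [numBlobs_concat hz.isPairing b1.isPairing hl.2, hz1, b3]; rfl
        · rw [HalfDiagram.natRaw_ofEven, mat_mul hz.isPairing b1.isPairing hl.2, hl.1, pow_zero,
            one_smul]
      obtain ⟨x', hx'⟩ := key x hx hx' h1
      obtain ⟨y', hy'⟩ := key y hy hy' (h ▸ h1)
      refine ⟨_, x', y', rfl, ?_⟩
      change _ = x'.natRaw.mat * y'.natRaw.mat.transpose
      rw [hx', hy', Matrix.transpose_mul, Matrix.mul_assoc, ← Matrix.mul_assoc B.mat, b4,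
        Matrix.one_mul]

/-- A diagram not all of whose southern vertices are on propagating lines factors through fewer
lines. -/
theorem exists_outer_of_not_allPropagating {n : ℕ} {v : DVertex} {C : RawDiagram n v.lines}
    (hC : C.IsDiagram) (hp : ¬ C.AllPropagating) (hb : (C.numBlobs : ZMod 2) = v.parity)
    (a : HalfDiagram n v) : ∃ (j : DVertex) (x y : HalfDiagram n j), j.rank < v.rank ∧
      C.mat * a.1.mat.transpose = x.1.mat * y.1.mat.transpose := by
  obtain ⟨p, x, y, hx, hx', hy, hy', h⟩ := hC.exists_factorization
  have hl := numLoops_eq_zero_of_fst (E := flip y) hx'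
  have hc : C = concat x (flip y) := by
    refine mat_injective hC.isPairing
      (concat_isPairing hx.isPairing (flip_isDiagram hy).isPairing) ?_
    have := mat_mul hx.isPairing (flip_isDiagram hy).isPairing hl.2
    rw [hl.1, pow_zero, one_smul, flip_mat] at this
    exact h.trans this
  -- With `v.lines` lines through the middle the reflection of `y` would consist of propagating
  -- lines, and so would the southern vertices of `C`.
  have hlt : p < v.lines := by
    refine lt_of_le_of_ne (hy'.le hy.isPairing) ?_
    rintro rfl
    refine hp ?_
    rw [hc]
    exact concat_allPropagating hx.isPairing (flip_isDiagram hy).isPairing hx'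
      (hy'.flip hy)
  have hla := numLoops_eq_zero_of_fst (E := y) a.2.2.1
  have hay : (concat a.1 y).mat = a.1.mat * y.mat := by
    rw [mat_mul a.isPairing hy.isPairing hla.2, hla.1, pow_zero, one_smul]
  obtain ⟨j, x', y', hj, hj'⟩ := exists_halfDiagram_pair hx hx' (concat_isDiagram a.2.1 hy)
    (concat_allPropagating a.isPairing hy.isPairing a.2.2.1 hy') (by
      rw [numBlobs_concat a.isPairing hy.isPairing hla.2, a.numBlobs_eq, ← hb, hc,
        numBlobs_concat hx.isPairing (flip_isDiagram hy).isPairing hl.2, flip_numBlobs hy,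
        add_assoc, zmod_two_add_self, add_zero])
  refine ⟨j, x', y', DVertex.rank_lt_of_lines_lt (hj ▸ hlt), ?_⟩
  rw [← hj', hay, Matrix.transpose_mul, h, Matrix.mul_assoc]

end RawDiagram

/-! ### The idempotents of the vertices -/

section Core

variable {n : ℕ} (v : DVertex.layer n)

/-- A half diagram which is symmetric to its inverse up to loops. -/
noncomputable def core : HalfDiagram n v := (HalfDiagram.exists_core v.2).choose

/-- The number of loops of a `core` with its reflection. -/
noncomputable def coreLoops : ℕ := (HalfDiagram.exists_core v.2).choose_spec.choose

theorem core_transpose_mul : (core v).1.mat.transpose * (core v).1.mat = 2 ^ coreLoops v • 1 :=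
  (HalfDiagram.exists_core v.2).choose_spec.choose_spec

variable (k : Type u) [Field k] (δ : k)

/-- The idempotent of a vertex. -/
noncomputable def coreIdem : DAlg k δ n :=
  (δ ^ coreLoops v)⁻¹ • DAlg.diag k δ ((core v).outer (core v))

theorem diag_outer_core_mul (x y : HalfDiagram n v) :
    DAlg.diag k δ (x.outer (core v)) * DAlg.diag k δ ((core v).outer y) =
      δ ^ coreLoops v • DAlg.diag k δ (x.outer y) := by
  refine diag_mul_of_mat k δ ?_
  rw [HalfDiagram.outer_mat, HalfDiagram.outer_mat, HalfDiagram.outer_mat, Matrix.mul_assoc,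
    ← Matrix.mul_assoc _ (core v).1.mat, core_transpose_mul, Matrix.smul_mul, Matrix.one_mul,
    Matrix.mul_smul]

theorem diag_outer_core_smul (x : HalfDiagram n v) :
    DAlg.diag k δ (x.outer (core v)) • StdCarrier.half k δ (core v) =
      δ ^ coreLoops v • StdCarrier.half k δ x := by
  refine diag_smul_half_of_mat k δ ?_
  rw [HalfDiagram.outer_mat, Matrix.mul_assoc, core_transpose_mul, Matrix.mul_smul, Matrix.mul_one]

theorem coreIdem_smul_eq_zero {w : DVertex} (h : v.1.rank < w.rank) (x : StdCarrier k δ n w) :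
    coreIdem v k δ • x = 0 := by
  have := span_half k δ (Submodule.mem_top (x := x))
  induction this using Submodule.span_induction with
  | mem x hx =>
    obtain ⟨g, rfl⟩ := hx
    rw [coreIdem, smul_assoc, HalfDiagram.diag_outer_smul_of_rank_lt k δ _ _ _ h, smul_zero]
  | zero => rw [smul_zero]
  | add a b _ _ ha hb => rw [smul_add, ha, hb, add_zero]
  | smul c a _ ha => rw [smul_comm, ha, smul_zero]

theorem exists_coreIdem_smul (x : StdCarrier k δ n v) :
    ∃ c : k, coreIdem v k δ • x = c • StdCarrier.half k δ (core v) := by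
  have := span_half k δ (Submodule.mem_top (x := x))
  induction this using Submodule.span_induction with
  | mem x hx =>
    obtain ⟨g, rfl⟩ := hx
    obtain ⟨c, hc⟩ := HalfDiagram.diag_outer_smul_self k δ (core v) (core v) g
    exact ⟨_, by rw [coreIdem, smul_assoc, hc, smul_smul]⟩
  | zero => exact ⟨0, by rw [smul_zero, zero_smul]⟩
  | add a b _ _ ha hb =>
    obtain ⟨c, hc⟩ := ha
    obtain ⟨d, hd⟩ := hb
    exact ⟨c + d, by rw [smul_add, hc, hd, add_smul]⟩
  | smul r a _ ha =>
    obtain ⟨c, hc⟩ := ha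
    exact ⟨r * c, by rw [smul_comm, hc, smul_smul]⟩

theorem half_ne_zero {v : DVertex} (h : HalfDiagram n v) : StdCarrier.half k δ h ≠ 0 :=
  (linearIndependent_half k δ).ne_zero h

variable {δ}

theorem coreIdem_mul_self (hδ : δ ≠ 0) : coreIdem v k δ * coreIdem v k δ = coreIdem v k δ := by
  rw [coreIdem, smul_mul_smul_comm, diag_outer_core_mul, smul_smul, mul_assoc,
    inv_mul_cancel₀ (pow_ne_zero _ hδ), mul_one]

theorem coreIdem_smul_core (hδ : δ ≠ 0) :
    coreIdem v k δ • StdCarrier.half k δ (core v) = StdCarrier.half k δ (core v) := by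
  rw [coreIdem, smul_assoc, diag_outer_core_smul, smul_smul,
    inv_mul_cancel₀ (pow_ne_zero _ hδ), one_smul]

/-- A half diagram `x` equals `δ⁻ʳ (x a*) a`, where `a` is the core; so the core generates the
module. -/
theorem exists_smul_core (hδ : δ ≠ 0) (x : StdCarrier k δ n v) :
    ∃ a : DAlg k δ n, x = a • StdCarrier.half k δ (core v) := by
  have := span_half k δ (Submodule.mem_top (x := x))
  induction this using Submodule.span_induction with
  | mem x hx =>
    obtain ⟨g, rfl⟩ := hx
    exact ⟨(δ ^ coreLoops v)⁻¹ • DAlg.diag k δ (g.outer (core v)), by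
      rw [smul_assoc, diag_outer_core_smul, smul_smul, inv_mul_cancel₀ (pow_ne_zero _ hδ),
        one_smul]⟩
  | zero => exact ⟨0, by rw [zero_smul]⟩
  | add a b _ _ ha hb =>
    obtain ⟨c, rfl⟩ := ha
    obtain ⟨d, rfl⟩ := hb
    exact ⟨c + d, by rw [add_smul]⟩
  | smul r a _ ha =>
    obtain ⟨c, rfl⟩ := ha
    exact ⟨r • c, by rw [smul_assoc]⟩

/-- Diagrams which factor through a vertex are in the ideal of its idempotent. -/
theorem diag_outer_eq (hδ : δ ≠ 0) (x y : HalfDiagram n v) : DAlg.diag k δ (x.outer y) =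
    ((δ ^ coreLoops v)⁻¹ • DAlg.diag k δ (x.outer (core v))) *
      (coreIdem v k δ * DAlg.diag k δ ((core v).outer y)) := by
  have h := inv_mul_cancel₀ (pow_ne_zero (coreLoops v) hδ)
  have h1 : coreIdem v k δ * DAlg.diag k δ ((core v).outer y) =
      DAlg.diag k δ ((core v).outer y) := by
    rw [coreIdem, smul_mul_assoc, diag_outer_core_mul, smul_smul, h, one_smul]
  rw [h1, smul_mul_assoc, diag_outer_core_mul, smul_smul, h, one_smul]

/-- Elements which annihilate the generator of `Δ_n(v)` are, on the idempotent of `v`, in the left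
ideal belonging to the vertices of smaller rank. -/
theorem mul_coreIdem_mem (hδ : δ ≠ 0) {a : DAlg k δ n}
    (ha : a • StdCarrier.half k δ (core v) = 0) : a * coreIdem v k δ ∈
      Submodule.span (DAlg k δ n) {b | ∃ (w : DVertex.layer n) (c : DAlg k δ n),
        w.1.rank < v.1.rank ∧ b = coreIdem w k δ * c} := by
  set J := Submodule.span (DAlg k δ n) {b | ∃ (w : DVertex.layer n) (c : DAlg k δ n),
        w.1.rank < v.1.rank ∧ b = coreIdem w k δ * c} with hJ
  have h0 := inv_mul_cancel₀ (pow_ne_zero (coreLoops v) hδ)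
  -- A linear map back from `Δ_n(v)` to the algebra, putting the reflected core below a half
  -- diagram. Modulo `J` it inverts evaluation at the core.
  let s : StdCarrier k δ n v →ₗ[k] DAlg k δ n :=
    (halfBasis k δ n v).constr k fun h => (δ ^ coreLoops v)⁻¹ • DAlg.diag k δ (h.outer (core v))
  have hs : ∀ h : HalfDiagram n v, s (StdCarrier.half k δ h) =
      (δ ^ coreLoops v)⁻¹ • DAlg.diag k δ (h.outer (core v)) := fun h => by
    rw [← halfBasis_apply, Module.Basis.constr_basis]
  have key : ∀ a : DAlg k δ n,
      a * coreIdem v k δ - s (a • StdCarrier.half k δ (core v)) ∈ J := by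
    intro a
    have := span_diag k δ (Submodule.mem_top (x := a))
    induction this using Submodule.span_induction with
    | mem a ha =>
      obtain ⟨D, rfl⟩ := ha
      by_cases ho : HasOddLoop D.1 (core v).1
      · rw [diag_smul_half_zero k δ (Or.inl ho), map_zero, sub_zero, coreIdem, mul_smul_comm,
          diag_mul_of_mat_zero k δ, smul_zero]
        · exact J.zero_mem
        · rw [HalfDiagram.outer_mat, ← Matrix.mul_assoc,
            mat_mul_of_odd D.isPairing (core v).isPairing ho, Matrix.zero_mul]
      have hm := mat_mul D.isPairing (core v).isPairing ho
      by_cases hp : (concat D.1 (core v).1).AllPropagating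
      · rw [diag_smul_half k δ ho (h' := (core v).smul D ho hp) rfl, map_smul, hs, coreIdem,
          mul_smul_comm, diag_mul_of_mat k δ (r := numLoops D.1 (core v).1)
            (C := ((core v).smul D ho hp).outer (core v)), smul_comm, sub_self]
        · exact J.zero_mem
        · rw [HalfDiagram.outer_mat, HalfDiagram.outer_mat, ← Matrix.mul_assoc, hm, Matrix.smul_mul]
          rfl
      · rw [diag_smul_half_zero k δ (Or.inr hp), map_zero, sub_zero]
        -- A product that loses propagating lines factors through a vertex of smaller rank, hence
        -- through its idempotent.
        obtain ⟨j, x, y, hj, hxy⟩ := exists_outer_of_not_allPropagating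
          (concat_isDiagram D.2.1 (core v).2.1) hp (by
            rw [numBlobs_concat D.isPairing (core v).isPairing ho, (core v).numBlobs_eq,
              (even_numBlobs_iff _).1 D.2.2, zero_add]) (core v)
        rw [coreIdem, mul_smul_comm, diag_mul_of_mat k δ (r := numLoops D.1 (core v).1)
            (C := x.outer y), smul_smul, diag_outer_eq ⟨j, x.mem_layer⟩ k hδ]
        · rw [← algebraMap_smul (DAlg k δ n), smul_eq_mul, ← mul_assoc]
          exact J.smul_mem _ (Submodule.subset_span ⟨_, _, hj, rfl⟩)
        · rw [HalfDiagram.outer_mat, HalfDiagram.outer_mat, ← Matrix.mul_assoc, hm,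
            Matrix.smul_mul, hxy]
    | zero => rw [zero_mul, zero_smul, map_zero, sub_zero]; exact J.zero_mem
    | add a b _ _ ha hb =>
      rw [add_mul, add_smul, map_add, add_sub_add_comm]
      exact J.add_mem ha hb
    | smul c a _ ha =>
      rw [smul_mul_assoc, smul_assoc, map_smul, ← smul_sub, ← algebraMap_smul (DAlg k δ n)]
      exact J.smul_mem _ ha
  have := key a
  rwa [ha, map_zero, sub_zero] at this

theorem coreIdem_nat (hδ : δ ≠ 0) (n : ℕ) : coreIdem (n := n) ⟨.nat n, le_rfl, rfl⟩ k δ = 1 := by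
  set v : DVertex.layer n := ⟨.nat n, le_rfl, rfl⟩
  have h1 : (core v).natRaw = idDiagram n := (core v).natRaw_allPropagating.eq_idDiagram
    (core v).natRaw_isDiagram ((even_numBlobs_iff _).2 (core v).natRaw_numBlobs)
  have h2 : DAlg.diag k δ ((core v).outer (core v)) = 1 := by
    refine diag_id k δ (mat_injective (DDiagram.isPairing _) (idDiagram_isDiagram n).isPairing ?_)
    rw [HalfDiagram.outer_mat, idDiagram_mat]
    change (core v).natRaw.mat * (core v).natRaw.mat.transpose = 1
    rw [h1, idDiagram_mat, Matrix.transpose_one, Matrix.one_mul]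
  have h3 := coreIdem_smul_core v k hδ
  rw [coreIdem, h2, smul_assoc, one_smul] at h3
  -- Since `coreLoops` is a chosen number, the scalar is found from the fact that the idempotent
  -- fixes the core.
  have h4 : (δ ^ coreLoops v)⁻¹ = 1 := by
    by_contra hne
    refine half_ne_zero k δ (core v) ((smul_eq_zero.1 ?_).resolve_left (sub_ne_zero.2 hne))
    rw [sub_smul, one_smul, h3, sub_self]
  rw [coreIdem, h2, h4, one_smul]

/-- The blobbed cup is the only diagram with two northern vertices and an odd number of blobs. -/
theorem eq_bend_idDiagram {P : RawDiagram 2 0} (hP : P.IsDiagram) (h : (P.numBlobs : ZMod 2) = 1) :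
    P = bend true (idDiagram 1) := by
  have hQ := unbend_isDiagram hP (b := true) fun _ => rfl
  have hb := bend_numBlobs hQ (b := true) fun _ => rfl
  rw [bend_unbend, h] at hb
  have hp : (unbend true P).AllPropagating := by
    intro j
    rcases hz : (unbend true P).mate (.inr j) with i | j'
    · exact ⟨i, rfl⟩
    · obtain rfl : j = j' := Fin.ext (by omega)
      exact absurd hz (hQ.mate_ne _)
  rw [← bend_unbend true P]
  refine congrArg _ (hp.eq_idDiagram hQ ((even_numBlobs_iff _).2 ?_))
  have : bit true = 1 := rfl
  rw [this] at hb
  linear_combination -hb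

/-- The part of the standard module of `0'` fixed by the idempotent of `2` is separated from the
standard module of `2`. -/
theorem exists_separating (hδ : δ ≠ 0) (v₁ v₂ : DVertex.layer n) (h₁ : v₁.1 = .prime)
    (h₂ : v₂.1 = .nat 2) : ∃ (y : StdCarrier k δ n v₁) (f : DAlg k δ n),
      (∀ x : StdCarrier k δ n v₁, ∃ c : k, coreIdem v₂ k δ • x = c • y) ∧ f • y = y ∧
      ∀ x : StdCarrier k δ n v₂, f • x = 0 := by
  obtain ⟨v₁, hv₁⟩ := v₁
  obtain ⟨v₂, hv₂⟩ := v₂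
  obtain rfl : v₁ = _ := h₁
  obtain rfl : v₂ = _ := h₂
  set v : DVertex.layer n := ⟨.nat 2, hv₂⟩
  have hb := bend_isDiagram (idDiagram_isDiagram 1) (b := true) fun _ => rfl
  have hbb : ((bend true (idDiagram 1)).numBlobs : ZMod 2) = 1 := by
    rw [bend_numBlobs (idDiagram_isDiagram 1) fun _ => rfl, idDiagram_numBlobs]; rfl
  let a : RawDiagram n 2 := (core v).natRaw
  have ha : a.IsDiagram := (core v).natRaw_isDiagram
  have haa : a.mat.transpose * a.mat = 2 ^ coreLoops v • 1 := core_transpose_mul v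
  have hl := numLoops_eq_zero_of_fst (E := bend true (idDiagram 1)) (core v).natRaw_allPropagating
  -- The core of 2 with its two lines closed off by the blobbed arc.
  let y : HalfDiagram n .prime := HalfDiagram.ofOdd (concat a (bend true (idDiagram 1)))
    (concat_isDiagram ha hb) (by
      rw [numBlobs_concat ha.isPairing hb.isPairing hl.2, hbb]
      exact (congrArg (· + 1) (core v).natRaw_numBlobs).trans (zero_add 1))
  have hy : y.primeRaw.mat = a.mat * (bend true (idDiagram 1)).mat := by
    have := mat_mul ha.isPairing hb.isPairing hl.2
    rw [hl.1, pow_zero, one_smul] at this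
    exact this.symm
  have hyy : y.primeRaw.mat.transpose * y.primeRaw.mat = 2 ^ (coreLoops v + 1) • 1 := by
    rw [hy, Matrix.transpose_mul, Matrix.mul_assoc, ← Matrix.mul_assoc _ a.mat, haa,
      Matrix.smul_mul, Matrix.one_mul, Matrix.mul_smul, bend_idDiagram_transpose_mul, smul_smul,
      pow_succ]
  refine ⟨StdCarrier.half k δ y, (δ ^ (coreLoops v + 1))⁻¹ • DAlg.diag k δ (y.outer y), ?_, ?_, ?_⟩
  · intro x
    have := span_half k δ (Submodule.mem_top (x := x))
    induction this using Submodule.span_induction with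
    | mem x hx =>
      obtain ⟨g, rfl⟩ := hx
      rw [coreIdem, smul_assoc]
      rcases HalfDiagram.diag_outer_smul k δ (core v) (core v) g with
        h | ⟨s, P, g', hP, -, hP', hg', -, h⟩
      · exact ⟨0, by rw [h, smul_zero, zero_smul]⟩
      -- The product passes through a diagram from two lines to none with an odd number of blobs,
      -- which can only be the blobbed cup. So the idempotent of 2 maps `Δ(0')` into the line of
      -- `y`.
      · have hPb : P = bend true (idDiagram 1) :=
          eq_bend_idDiagram hP (hP'.trans (zero_add 1))
        subst hPb
        obtain rfl : g' = y := Subtype.ext hg'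
        exact ⟨_, by rw [h, smul_smul]⟩
    | zero => exact ⟨0, by rw [smul_zero, zero_smul]⟩
    | add a b _ _ ha hb =>
      obtain ⟨c, hc⟩ := ha
      obtain ⟨d, hd⟩ := hb
      exact ⟨c + d, by rw [smul_add, hc, hd, add_smul]⟩
    | smul r a _ ha =>
      obtain ⟨c, hc⟩ := ha
      exact ⟨r * c, by rw [smul_comm, hc, smul_smul]⟩
  · rw [smul_assoc, diag_smul_half_of_mat k δ (r := coreLoops v + 1) (h' := y), smul_smul,
      inv_mul_cancel₀ (pow_ne_zero _ hδ), one_smul]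
    have : y.primeRaw.mat * (y.primeRaw.mat.transpose * y.primeRaw.mat) =
        2 ^ (coreLoops v + 1) • y.primeRaw.mat := by
      rw [hyy, Matrix.mul_smul, Matrix.mul_one]
    rw [HalfDiagram.outer_mat, Matrix.mul_assoc]
    exact this
  · intro x
    have := span_half k δ (Submodule.mem_top (x := x))
    induction this using Submodule.span_induction with
    | mem x hx =>
      obtain ⟨g, rfl⟩ := hx
      rw [smul_assoc, HalfDiagram.diag_outer_smul_of_rank_lt k δ _ _ _
        (show DVertex.rank .prime < DVertex.rank (.nat 2) by decide), smul_zero]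
    | zero => rw [smul_zero]
    | add a b _ _ ha hb => rw [smul_add, ha, hb, add_zero]
    | smul c a _ ha => rw [smul_comm, ha, smul_zero]

end Core

/-! ### Simple sections and projective covers over Artinian rings -/

section ModuleTheory

variable {R : Type u} [Ring R]

/-- A nonzero cyclic submodule has a simple quotient, in which the generator does not vanish. -/
theorem exists_simple_section {M : Type*} [AddCommGroup M] [Module R M] {x : M} (hx : x ≠ 0) :
    ∃ N : Submodule R M, N ≤ R ∙ x ∧ x ∉ N ∧
      IsSimpleModule R (↥(R ∙ x) ⧸ N.submoduleOf (R ∙ x)) := by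
  have : Nontrivial (R ∙ x) := ⟨⟨⟨x, Submodule.mem_span_singleton_self x⟩, 0,
    fun h => hx (congrArg Subtype.val h)⟩⟩
  obtain ⟨m, hm, -⟩ :=
    (eq_top_or_exists_le_coatom (⊥ : Submodule R (R ∙ x))).resolve_left bot_ne_top
  have hN : (m.map (R ∙ x).subtype).submoduleOf (R ∙ x) = m :=
    Submodule.comap_map_eq_of_injective (Submodule.injective_subtype _) m
  refine ⟨m.map (R ∙ x).subtype, Submodule.map_subtype_le _ _, fun h => hm.1 ?_, ?_⟩
  · have h1 : (⟨x, Submodule.mem_span_singleton_self x⟩ : R ∙ x) ∈ m := by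
      rw [← hN]; exact h
    rw [eq_top_iff]
    rintro ⟨y, hy⟩ -
    obtain ⟨r, rfl⟩ := Submodule.mem_span_singleton.1 hy
    exact m.smul_mem r h1
  · rw [hN]
    exact isSimpleModule_iff_isCoatom.2 hm

/-- A finite projective module surjecting onto `L` which is minimal with this property among its
submodules is a projective cover of `L`. -/
theorem eq_top_of_minimal_projective [IsArtinianRing R] {P L : Type*} [AddCommGroup P] [Module R P]
    [AddCommGroup L] [Module R L] [Module.Projective R P] [Module.Finite R P] (q : P →ₗ[R] L)
    (hq : Function.Surjective q)
    (hmin : ∀ N : Submodule R P, Module.Projective R N → N.map q = ⊤ → N = ⊤)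
    (N : Submodule R P) (hN : N ⊔ LinearMap.ker q = ⊤) : N = ⊤ := by
  have hN' : Function.Surjective (q.comp N.subtype) := by
    intro y
    obtain ⟨x, rfl⟩ := hq y
    obtain ⟨x₁, h₁, x₂, h₂, rfl⟩ := Submodule.mem_sup.1 (hN ▸ Submodule.mem_top (x := x))
    exact ⟨⟨x₁, h₁⟩, by
      rw [map_add, LinearMap.mem_ker.1 h₂, add_zero]; rfl⟩
  obtain ⟨g, hg⟩ := Module.projective_lifting_property (q.comp N.subtype) q hN'
  -- Fitting's lemma for an endomorphism over `L` with image in `N`: the image of a high power is a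
  -- direct summand, so it is projective. It still maps onto `L`, so by minimality it is everything.
  let f : Module.End R P := N.subtype.comp g
  have hf : ∀ x, q (f x) = q x := fun x => LinearMap.congr_fun hg x
  have hfn : ∀ n x, q ((f ^ n) x) = q x := by
    intro n
    induction n with
    | zero => intro x; rfl
    | succ n ih => intro x; rw [pow_succ', Module.End.mul_apply, hf, ih]
  obtain ⟨n, hn, hn1⟩ := ((LinearMap.eventually_isCompl_ker_pow_range_pow f).and
    (Filter.eventually_ge_atTop 1)).exists
  have h1 : LinearMap.range (f ^ n) = ⊤ := by
    refine hmin _ ?_ ?_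
    · refine Module.Projective.of_split (LinearMap.range (f ^ n)).subtype
        (Submodule.projectionOnto _ _ hn.symm) ?_
      ext x
      simp
    · rw [eq_top_iff]
      rintro y -
      obtain ⟨x, rfl⟩ := hq y
      exact ⟨_, ⟨x, rfl⟩, hfn n x⟩
  rw [eq_top_iff, ← h1]
  rintro _ ⟨x, rfl⟩
  obtain ⟨m, rfl⟩ : ∃ m, n = m + 1 := ⟨n - 1, by omega⟩
  rw [pow_succ', Module.End.mul_apply]
  exact (g _).2

/-- Cyclic modules over an Artinian ring have projective covers. -/
theorem exists_projective_cover [IsArtinianRing R] (L : ModuleCat.{u} R) (z : L)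
    (hz : ∀ x : L, ∃ a : R, x = a • z) :
    ∃ (P : ModuleCat.{u} R) (q : P →ₗ[R] L), Module.Projective R P ∧ Module.Finite R P ∧
      Function.Surjective q ∧ ∀ N : Submodule R P, N ⊔ LinearMap.ker q = ⊤ → N = ⊤ := by
  let q : R →ₗ[R] L := LinearMap.toSpanSingleton R L z
  have hq : (⊤ : Submodule R R).map q = ⊤ := by
    rw [Submodule.map_top, LinearMap.range_eq_top]
    intro x
    obtain ⟨a, rfl⟩ := hz x
    exact ⟨a, rfl⟩
  -- The cover is a minimal projective left ideal still mapping onto `L`; it exists by the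
  -- descending chain condition.
  obtain ⟨P, ⟨hP, hPq⟩, hmin⟩ := (wellFounded_lt (α := Submodule R R)).has_min
    {N | Module.Projective R N ∧ N.map q = ⊤}
    ⟨⊤, Module.Projective.of_equiv Submodule.topEquiv.symm, hq⟩
  have hs : Function.Surjective (q.comp P.subtype) := by
    rw [← LinearMap.range_eq_top, LinearMap.range_comp, Submodule.range_subtype, hPq]
  refine ⟨ModuleCat.of R P, q.comp P.subtype, hP, inferInstanceAs (Module.Finite R P), hs, ?_⟩
  refine eq_top_of_minimal_projective (P := P) (q.comp P.subtype) hs fun N hN hNq => ?_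
  have h1 : N.map P.subtype = P := by
    by_contra hne
    refine hmin (N.map P.subtype) ⟨?_, ?_⟩
      (lt_of_le_of_ne (Submodule.map_subtype_le _ _) hne)
    · exact Module.Projective.of_equiv (Submodule.equivMapOfInjective _ P.injective_subtype N)
    · rw [← Submodule.map_comp]; exact hNq
  rw [eq_top_iff]
  rintro ⟨x, hx⟩ -
  rw [← h1] at hx
  obtain ⟨y, hy, rfl⟩ := hx
  exact hy

end ModuleTheory

/-! ### A criterion for standard modules from triangular idempotents -/

/-- Modules `Δ i` with generators `z i` and idempotents `e i` which are triangular with respect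
to `rank`. -/
structure IsCoreData (k : Type*) [Field k] {R : Type u} [Ring R] [Algebra k R] {I : Type*}
    (rank : I → ℕ) (Δ : I → ModuleCat.{u} R) (e : I → R) (z : ∀ i, Δ i) : Prop where
  idem : ∀ i, e i * e i = e i
  smul_gen : ∀ i, e i • z i = z i
  gen_ne_zero : ∀ i, z i ≠ 0
  exists_smul_gen : ∀ i (x : Δ i), ∃ a : R, x = a • z i
  exists_smul : ∀ i (x : Δ i), ∃ c : k, e i • x = algebraMap k R c • z i
  smul_eq_zero : ∀ i j, rank j < rank i → ∀ x : Δ i, e j • x = 0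
  mul_mem : ∀ i (a : R), a • z i = 0 →
    a * e i ∈ Submodule.span R {b | ∃ j c, rank j < rank i ∧ b = e j * c}
  exists_eq_one : ∃ i, e i = 1

namespace IsCoreData

variable {k : Type*} [Field k] {R : Type u} [Ring R] [Algebra k R] {I : Type*}
  {rank : I → ℕ} {Δ : I → ModuleCat.{u} R} {e : I → R} {z : ∀ i, Δ i}

/-- The largest proper submodule of `Δ i`. -/
def rad (Δ : I → ModuleCat.{u} R) (e : I → R) (i : I) : Submodule R (Δ i) where
  carrier := {x | ∀ a : R, e i • a • x = 0}
  add_mem' hx hy a := by rw [smul_add, smul_add, hx, hy, add_zero]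
  zero_mem' a := by rw [smul_zero, smul_zero]
  smul_mem' r x hx a := by rw [← mul_smul a r]; exact hx _

theorem eq_top_of_mem (h : IsCoreData k rank Δ e z) {i : I} {N : Submodule R (Δ i)} (hN : z i ∈ N) : N = ⊤ := by
  rw [eq_top_iff]
  rintro x -
  obtain ⟨a, rfl⟩ := h.exists_smul_gen i x
  exact N.smul_mem a hN

theorem gen_notMem_rad (h : IsCoreData k rank Δ e z) (i : I) : z i ∉ rad Δ e i := fun hz => h.gen_ne_zero i (by
  have := hz 1
  rwa [one_smul, h.smul_gen] at this)

/-- `e i` maps `N` into the line of `z i`. A nonzero image would put the generator into `N`. So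
`rad` contains all proper submodules. -/
theorem le_rad (h : IsCoreData k rank Δ e z) {i : I} {N : Submodule R (Δ i)} (hN : z i ∉ N) : N ≤ rad Δ e i := by
  intro x hx a
  obtain ⟨c, hc⟩ := h.exists_smul i (a • x)
  have h1 : algebraMap k R c • z i ∈ N := hc ▸ N.smul_mem _ (N.smul_mem _ hx)
  by_cases h0 : c = 0
  · rw [hc, h0, map_zero, zero_smul]
  · refine absurd ?_ hN
    have := N.smul_mem (algebraMap k R c⁻¹) h1
    rwa [← mul_smul, ← map_mul, inv_mul_cancel₀ h0, map_one, one_smul] at this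

theorem isCoatom_rad (h : IsCoreData k rank Δ e z) (i : I) : IsCoatom (rad Δ e i) := by
  refine ⟨fun ht => h.gen_notMem_rad i (ht ▸ Submodule.mem_top), fun N hN => ?_⟩
  by_contra hne
  exact hN.not_ge (h.le_rad fun hz => hne (h.eq_top_of_mem hz))

/-- If `w` is fixed by `e i` in a module on which the idempotents of smaller rank vanish, then
there is a map from `Δ i` which sends the generator to `w`. -/
theorem exists_hom (h : IsCoreData k rank Δ e z) {M : Type*} [AddCommGroup M] [Module R M] {i : I} {w : M}
    (hw : e i • w = w) (h0 : ∀ j, rank j < rank i → ∀ x : M, e j • x = 0) :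
    ∃ φ : Δ i →ₗ[R] M, φ (z i) = w := by
  have hs : Function.Surjective (LinearMap.toSpanSingleton R (Δ i) (z i)) := fun x => by
    obtain ⟨a, rfl⟩ := h.exists_smul_gen i x
    exact ⟨a, rfl⟩
  have hk : LinearMap.ker (LinearMap.toSpanSingleton R (Δ i) (z i)) ≤
      LinearMap.ker (LinearMap.toSpanSingleton R M w) := by
    intro a ha
    -- Relations of the generator lie, after multiplication by `e i`, in the left ideal of smaller
    -- ranks, which annihilates `w = e i • w`.
    have h1 := h.mul_mem i a ha
    have h2 : ∀ b ∈ Submodule.span R {b | ∃ j c, rank j < rank i ∧ b = e j * c}, b • w = 0 := by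
      intro b hb
      induction hb using Submodule.span_induction with
      | mem b hb =>
        obtain ⟨j, c, hj, rfl⟩ := hb
        rw [mul_smul, h0 j hj]
      | zero => exact zero_smul _ _
      | add b b' _ _ hb hb' => rw [add_smul, hb, hb', add_zero]
      | smul r b _ hb => rw [smul_eq_mul, mul_smul, hb, smul_zero]
    have h3 := h2 _ h1
    rw [mul_smul, hw] at h3
    exact h3
  refine ⟨(Submodule.liftQ _ _ hk).comp
    (LinearMap.quotKerEquivOfSurjective _ hs).symm.toLinearMap, ?_⟩
  have : (LinearMap.quotKerEquivOfSurjective _ hs).symm (z i) = Submodule.Quotient.mk (1 : R) := by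
    rw [LinearEquiv.symm_apply_eq]
    exact (one_smul R (z i)).symm
  rw [LinearMap.comp_apply, LinearEquiv.coe_coe, this]
  exact one_smul R w

/-- Every simple module is the head of some `Δ i`. -/
theorem exists_equiv_of_isSimpleModule (h : IsCoreData k rank Δ e z) (M : ModuleCat.{u} R) [IsSimpleModule R M] :
    ∃ i, Nonempty (M ≃ₗ[R] (Δ i ⧸ rad Δ e i)) := by
  classical
  -- Take the least rank whose idempotent acts nontrivially on `M`. There is one because some
  -- idempotent is 1.
  have hex : ∃ r, ∃ i, rank i = r ∧ ∃ x : M, e i • x ≠ 0 := by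
    obtain ⟨i, hi⟩ := h.exists_eq_one
    have := IsSimpleModule.nontrivial R M
    obtain ⟨x, hx⟩ := exists_ne (0 : M)
    exact ⟨_, i, rfl, x, by rwa [hi, one_smul]⟩
  obtain ⟨i, hi, x, hx⟩ := Nat.find_spec hex
  have h0 : ∀ j, rank j < rank i → ∀ x : M, e j • x = 0 := by
    intro j hj x
    by_contra hne
    exact Nat.find_min hex (hi ▸ hj) ⟨j, rfl, x, hne⟩
  obtain ⟨φ, hφ⟩ := h.exists_hom (w := e i • x) (by rw [← mul_smul, h.idem]) h0
  have hne : φ ≠ 0 := fun h0 => hx (by rw [← hφ, h0]; rfl)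
  have hs : Function.Surjective φ := φ.surjective_of_ne_zero hne
  have hk : LinearMap.ker φ = rad Δ e i := by
    have hle : LinearMap.ker φ ≤ rad Δ e i := h.le_rad fun hz => hx (hφ ▸ hz)
    have hc : IsCoatom (LinearMap.ker φ) := by
      rw [← isSimpleModule_iff_isCoatom]
      exact IsSimpleModule.congr (φ.quotKerEquivOfSurjective hs)
    exact (hc.le_iff.1 hle).resolve_left (h.isCoatom_rad i).1 |>.symm
  exact ⟨i, ⟨(φ.quotKerEquivOfSurjective hs).symm.trans (Submodule.quotEquivOfEq _ _ hk)⟩⟩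

/-- The modules `Δ i` are standard modules. -/
theorem isStandardFamily [Module.Finite k R] (h : IsCoreData k rank Δ e z)
    (hrank : Function.Injective rank) {le : I → I → Prop} (hrefl : ∀ i, le i i)
    (hle : ∀ i j, rank j < rank i → ¬ le j i)
    (hsep : ∀ i j, rank i < rank j → ¬ le j i → ∃ (y : Δ i) (f : R),
      (∀ x : Δ i, ∃ c : k, e j • x = algebraMap k R c • y) ∧ f • y = y ∧ ∀ x : Δ j, f • x = 0) :
    IsStandardFamily R le Δ := by
  have hart : IsArtinianRing R := IsArtinianRing.of_finite k R
  let L : I → ModuleCat.{u} R := fun i => ModuleCat.of R (Δ i ⧸ rad Δ e i)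
  have hL : ∀ i, IsSimpleModule R (L i) := fun i => isSimpleModule_iff_isCoatom.2 (h.isCoatom_rad i)
  have hL0 : ∀ i j, rank j < rank i → ∀ x : L i, e j • x = 0 := by
    intro i j hj x
    obtain ⟨x, rfl⟩ := Submodule.Quotient.mk_surjective _ x
    exact congrArg Submodule.Quotient.mk (h.smul_eq_zero i j hj x)
  have hL1 : ∀ i, ∃ x : L i, e i • x ≠ 0 := fun i => ⟨Submodule.Quotient.mk (z i), fun h0 =>
    h.gen_notMem_rad i ((Submodule.Quotient.mk_eq_zero _).1 (by
      refine Eq.trans ?_ h0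
      exact congrArg Submodule.Quotient.mk (h.smul_gen i).symm))⟩
  have hLiso : ∀ i j, rank j < rank i → IsEmpty (L i ≃ₗ[R] L j) := by
    refine fun i j hj => ⟨fun φ => ?_⟩
    obtain ⟨x, hx⟩ := hL1 j
    refine hx (φ.symm.injective ?_)
    rw [map_smul, hL0 i j hj, map_zero]
  refine ⟨L, hL, fun i j hij => ?_, fun M hM => h.exists_equiv_of_isSimpleModule M, fun i => ?_⟩
  · rcases lt_or_gt_of_ne (hrank.ne hij) with hlt | hlt
    · exact ⟨fun φ => (hLiso j i hlt).false φ.symm⟩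
    · exact hLiso i j hlt
  obtain ⟨P, q, hP, hPf, hq, hess⟩ := exists_projective_cover (L i) (Submodule.Quotient.mk (z i))
    fun x => by
      obtain ⟨x, rfl⟩ := Submodule.Quotient.mk_surjective _ x
      obtain ⟨a, rfl⟩ := h.exists_smul_gen i x
      exact ⟨a, rfl⟩
  -- The projective cover of the head lifts to `Δ i`. The lift is onto, as its image is not
  -- contained in the only maximal submodule.
  obtain ⟨g, hg⟩ := Module.projective_lifting_property (rad Δ e i).mkQ q
    (Submodule.mkQ_surjective _)
  have hg' : ∀ x, (rad Δ e i).mkQ (g x) = q x := fun x => LinearMap.congr_fun hg x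
  have hgs : Function.Surjective g := by
    rw [← LinearMap.range_eq_top]
    refine h.eq_top_of_mem ?_
    by_contra hz
    obtain ⟨x, hx⟩ := hq (Submodule.Quotient.mk (z i))
    have h1 : q x = 0 := by
      rw [← hg' x]
      exact (Submodule.Quotient.mk_eq_zero _).2 (h.le_rad hz ⟨x, rfl⟩)
    exact h.gen_notMem_rad i ((Submodule.Quotient.mk_eq_zero _).1 (hx.symm.trans h1))
  let θ := g.quotKerEquivOfSurjective hgs
  refine ⟨P, q, LinearMap.ker g, hP, hPf, hq, hess, ⟨?_, ?_⟩, ⟨θ⟩⟩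
  · intro N₁ N₂ h12 hsimple
    obtain ⟨j, ⟨φ⟩⟩ := h.exists_equiv_of_isSimpleModule
      (ModuleCat.of R (↥N₂ ⧸ N₁.submoduleOf N₂))
    refine ⟨j, ?_, ⟨φ⟩⟩
    by_contra hj
    obtain ⟨x, hx⟩ := hL1 j
    obtain ⟨⟨x', hx'⟩, hx2⟩ := Submodule.Quotient.mk_surjective _ (φ.symm x)
    have hx3 : e j • x' ∉ N₁ := fun h0 => hx (φ.symm.injective (by
      rw [map_smul, ← hx2, map_zero]
      exact (Submodule.Quotient.mk_eq_zero _).2 h0))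
    rcases lt_trichotomy (rank j) (rank i) with hlt | heq | hlt
    · refine hx3 ?_
      have : e j • x' = 0 := θ.injective (by
        rw [map_smul, map_zero]; exact h.smul_eq_zero i j hlt _)
      rw [this]
      exact N₁.zero_mem
    · exact hj (hrank heq ▸ hrefl j)
    -- For incomparable indices: `f` fixes `e j • x'`, a multiple of `y` under `θ`, but kills `L j`.
    -- So a section isomorphic to `L j` cannot see `e j • x'`.
    · obtain ⟨y, f, hy, hfy, hf⟩ := hsep i j hlt hj
      have hfL : ∀ x : L j, f • x = 0 := fun x => by
        obtain ⟨x, rfl⟩ := Submodule.Quotient.mk_surjective _ x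
        exact congrArg Submodule.Quotient.mk (hf x)
      obtain ⟨c, hc⟩ := hy (θ x')
      have hfx : f • e j • x' = e j • x' := θ.injective (by
        rw [map_smul, map_smul, hc, ← mul_smul, ← Algebra.commutes, mul_smul, hfy])
      have h1 : f • (φ.symm (e j • x)) = 0 := by
        rw [← map_smul, hfL, map_zero]
      rw [map_smul, ← hx2] at h1
      refine hx3 ?_
      rw [← hfx]
      exact (Submodule.Quotient.mk_eq_zero (N₁.submoduleOf N₂)
        (x := f • e j • (⟨x', hx'⟩ : N₂))).1 h1
  · intro K' hK' x hx
    -- In a quotient with admissible factors the idempotents of smaller rank vanish. Otherwise `e j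
    -- • y ≠ 0` generates a submodule with a simple quotient `L m` on which `e j` is nonzero, so
    -- `rank m ≤ rank j < rank i`, which excludes `m` from the admissible indices.
    have h0 : ∀ j, rank j < rank i → ∀ y : P ⧸ K', e j • y = 0 := by
      intro j hj y
      by_contra hne
      obtain ⟨N, hN, hyN, hs⟩ := exists_simple_section (R := R) hne
      obtain ⟨m, hm, ⟨φ⟩⟩ := hK' N _ hN hs
      have hjm : ¬ rank j < rank m := fun hlt => by
        let w : ↥(R ∙ (e j • y)) := ⟨e j • y, Submodule.mem_span_singleton_self _⟩
        have h1 : e j • (Submodule.Quotient.mk w : _ ⧸ N.submoduleOf (R ∙ (e j • y))) = 0 :=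
          φ.injective (by rw [map_smul, hL0 m j hlt, map_zero])
        have h2 : e j • e j • y ∈ N := (Submodule.Quotient.mk_eq_zero
          (N.submoduleOf (R ∙ (e j • y))) (x := e j • w)).1 h1
        rw [← mul_smul, h.idem] at h2
        exact hyN h2
      exact hle i m (lt_of_le_of_lt (not_lt.1 hjm) hj) hm
    obtain ⟨p, hp⟩ := hgs (z i)
    have hp' : g (e i • p) = z i := by rw [map_smul, hp, h.smul_gen]
    -- The lift of the generator generates `P`, because `ker q` is superfluous. An element `a • e i
    -- • p` of the kernel of `g` then has `a • z i = 0`, so `mul_mem` puts it into `K'`.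
    have htop : R ∙ (e i • p) = ⊤ := hess _ (by
      rw [eq_top_iff]
      rintro y -
      obtain ⟨a, ha⟩ := h.exists_smul_gen i (g y)
      rw [← sub_add_cancel y (a • e i • p), add_comm]
      refine Submodule.add_mem_sup (Submodule.smul_mem _ _ (Submodule.mem_span_singleton_self _)) ?_
      rw [LinearMap.mem_ker, map_sub, ← hg', ← hg', ha, map_smul g, hp', sub_self])
    obtain ⟨a, rfl⟩ := Submodule.mem_span_singleton.1 (htop ▸ Submodule.mem_top (x := x))
    have ha : a • z i = 0 := by
      rw [LinearMap.mem_ker, map_smul, hp'] at hx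
      exact hx
    have h1 : ∀ b ∈ Submodule.span R {b | ∃ j c, rank j < rank i ∧ b = e j * c}, b • p ∈ K' := by
      intro b hb
      induction hb using Submodule.span_induction with
      | mem b hb =>
        obtain ⟨j, c, hj, rfl⟩ := hb
        rw [mul_smul]
        exact (Submodule.Quotient.mk_eq_zero _).1 (h0 j hj (Submodule.Quotient.mk (c • p)))
      | zero => rw [zero_smul]; exact K'.zero_mem
      | add b b' _ _ hb hb' => rw [add_smul]; exact K'.add_mem hb hb'
      | smul r b _ hb => rw [smul_eq_mul, mul_smul]; exact K'.smul_mem _ hb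
    rw [← mul_smul]
    exact h1 _ (h.mul_mem i a ha)

end IsCoreData

/-! ### The standard modules of the diagram algebras -/

section Standard

variable (k : Type u) [Field k] {δ : k}

theorem isCoreData (hδ : δ ≠ 0) (n : ℕ) : IsCoreData k (fun v : DVertex.layer n => v.1.rank)
    (fun v => stdModule k δ n v) (fun v => coreIdem v k δ)
    (fun v => StdCarrier.half k δ (core v)) where
  idem v := coreIdem_mul_self v k hδ
  smul_gen v := coreIdem_smul_core v k hδ
  gen_ne_zero v := half_ne_zero k δ (core v)
  exists_smul_gen v x := exists_smul_core v k hδ x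
  exists_smul v x := by
    obtain ⟨c, hc⟩ := exists_coreIdem_smul v k δ x
    exact ⟨c, hc.trans (algebraMap_smul (DAlg k δ n) c (StdCarrier.half k δ (core v))).symm⟩
  smul_eq_zero v w h x := coreIdem_smul_eq_zero w k δ h x
  mul_mem v a h := mul_coreIdem_mem v k hδ h
  exists_eq_one := ⟨_, coreIdem_nat k hδ n⟩

/-- The modules `Δ_n(λ)` are the standard modules of `d_n`. -/
theorem isStandardFamily_stdModule (hδ : δ ≠ 0) (n : ℕ) : IsStandardFamily (DAlg k δ n)
    (fun a b : DVertex.layer n => DVertex.StdLe a b)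
    (fun v : DVertex.layer n => stdModule k δ n v) := by
  refine (isCoreData k hδ n).isStandardFamily
    (DVertex.rank_injective.comp Subtype.val_injective) (fun i => Or.inl rfl) ?_ ?_
  · rintro ⟨i, hi⟩ ⟨j, hj⟩ hr (h | h)
    · exact hr.ne (congrArg DVertex.rank h)
    · rcases i with _ | _ | i <;> rcases j with _ | _ | j <;>
        simp only [DVertex.rank, DVertex.level] at hr h <;> try omega
      -- Rank and level disagree only for 0' against 1, which never share a layer.
      have h1 : Even n ∧ 2 ≤ n := hj
      have h2 : _ ∧ (i + 1) % 2 = n % 2 := hi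
      have := Nat.even_iff.1 h1.1
      omega
  · rintro ⟨i, hi⟩ ⟨j, hj⟩ hr h
    have h' : ¬ i.level < j.level := fun h1 => h (Or.inr h1)
    -- Within a layer, 0' and 2 are the only indices compared by rank but not by the required order;
    -- they first occur in the same layer.
    have key : i = .prime ∧ j = .nat 2 := by
      rcases i with _ | _ | i <;> rcases j with _ | _ | j <;>
        simp only [DVertex.rank, DVertex.level] at hr h' <;> try omega
      have h1 : Even n ∧ 2 ≤ n := hi
      have h2 : _ ∧ (j + 1) % 2 = n % 2 := hj
      have := Nat.even_iff.1 h1.1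
      exact ⟨rfl, congrArg _ (by omega)⟩
    obtain ⟨y, f, h1, h2, h3⟩ := exists_separating k hδ ⟨i, hi⟩ ⟨j, hj⟩ key.1 key.2
    refine ⟨y, f, fun x => ?_, h2, h3⟩
    obtain ⟨c, hc⟩ := h1 x
    exact ⟨c, hc.trans (algebraMap_smul (DAlg k δ n) c y).symm⟩

end Standard

/-! ### Filtrations and uniqueness of multiplicities -/

section Filtration

variable {R : Type u} [Ring R] {I : Type*} (S : I → ModuleCat.{u} R) (M : ModuleCat.{u} R)

/-- `HasFiltration S M N c`: the submodule `N` of `M` has a filtration whose sections are the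
modules `S i`, `i ∈ c`. -/
inductive HasFiltration : Submodule R M → Multiset I → Prop
  | bot : HasFiltration ⊥ 0
  | cons {N N' : Submodule R M} {c : Multiset I} (i : I) (h : HasFiltration N c) (hN : N ≤ N')
      (hi : Nonempty ((↥N' ⧸ N.submoduleOf N') ≃ₗ[R] S i)) : HasFiltration N' (i ::ₘ c)

variable {S M}

theorem HasFiltration.nonempty {c : Multiset I} (h : HasFiltration S M ⊤ c) :
    Nonempty (DeltaFiltration S M) := by
  have key : ∀ {N c}, HasFiltration S M N c → ∃ (l : ℕ) (step : Fin (l + 1) → Submodule R M)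
      (label : Fin l → I), Monotone step ∧ step 0 = ⊥ ∧ step (Fin.last l) = N ∧
      ∀ i : Fin l, Nonempty ((↥(step i.succ) ⧸ (step i.castSucc).submoduleOf (step i.succ)) ≃ₗ[R]
        S (label i)) := by
    intro N c h
    induction h with
    | bot => exact ⟨0, fun _ => ⊥, Fin.elim0, fun _ _ _ => le_rfl, rfl, rfl, fun i => i.elim0⟩
    | @cons N N' c i h hN hi ih =>
      obtain ⟨l, step, label, h1, h2, h3, h4⟩ := ih
      refine ⟨l + 1, Fin.snoc step N', Fin.snoc label i, ?_, ?_, Fin.snoc_last .., ?_⟩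
      · intro a b hab
        induction b using Fin.lastCases with
        | last =>
          induction a using Fin.lastCases with
          | last => exact le_rfl
          | cast a =>
            rw [Fin.snoc_last, Fin.snoc_castSucc]
            exact ((h1 (Fin.le_last a)).trans h3.le).trans hN
        | cast b =>
          induction a using Fin.lastCases with
          | last => exact absurd hab (not_le.2 (Fin.castSucc_lt_last b))
          | cast a =>
            rw [Fin.snoc_castSucc, Fin.snoc_castSucc]
            exact h1 (Fin.castSucc_le_castSucc_iff.1 hab)
      · rw [← h2]
        exact Fin.snoc_castSucc (α := fun _ => Submodule R M) N' step 0
      · intro j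
        induction j using Fin.lastCases with
        | last =>
          rw [Fin.snoc_castSucc, Fin.snoc_last, Fin.succ_last, Fin.snoc_last, h3]
          exact hi
        | cast j =>
          rw [Fin.snoc_castSucc, Fin.snoc_castSucc, Fin.succ_castSucc, Fin.snoc_castSucc]
          exact h4 j
  obtain ⟨l, step, label, h1, h2, h3, h4⟩ := key h
  exact ⟨⟨l, step, h1, h2, h3, label, h4⟩⟩

/-- The labels of a filtration with their multiplicities. -/
def DeltaFiltration.labels (F : DeltaFiltration S M) : Multiset I :=
  (Finset.univ : Finset (Fin F.length)).val.map F.label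

theorem DeltaFiltration.count_labels [DecidableEq I] (F : DeltaFiltration S M) (l : I) :
    F.labels.count l = F.mult l := by
  rw [labels, Multiset.count_map, mult, Nat.card_eq_fintype_card, Fintype.card_subtype]
  simp only [eq_comm]
  rfl

theorem DeltaFiltration.hasFiltration (F : DeltaFiltration S M) :
    HasFiltration S M ⊤ F.labels := by
  classical
  have key : ∀ (j : ℕ) (hj : j < F.length + 1), HasFiltration S M (F.step ⟨j, hj⟩)
      (((Finset.univ : Finset (Fin F.length)).filter fun i => i.val < j).val.map F.label) := by
    intro j
    induction j with
    | zero =>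
      intro hj
      have : F.step ⟨0, hj⟩ = ⊥ := F.step_zero
      rw [this]
      simpa using HasFiltration.bot
    | succ j ih =>
      intro hj
      have hj' : j < F.length := by omega
      have h1 : (Finset.univ : Finset (Fin F.length)).filter (fun i => i.val < j + 1) =
          insert ⟨j, hj'⟩ (Finset.univ.filter fun i => i.val < j) := by
        ext i
        simp only [Finset.mem_filter, Finset.mem_univ, true_and, Finset.mem_insert, Fin.ext_iff]
        omega
      rw [h1, Finset.insert_val_of_notMem (by simp), Multiset.map_cons]
      exact .cons _ (ih (by omega)) (F.mono (Fin.mk_le_mk.2 (by omega))) (F.section_iso ⟨j, hj'⟩)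
  have h1 := key F.length (by omega)
  have h2 : (Finset.univ : Finset (Fin F.length)).filter (fun i => i.val < F.length) =
      Finset.univ := Finset.filter_true_of_mem fun i _ => i.2
  rw [h2] at h1
  have h3 : F.step ⟨F.length, by omega⟩ = ⊤ := F.step_last
  rw [h3] at h1
  exact h1

/-- An exact functor to vector spaces turns each step of the filtration into a short exact sequence,
along which dimensions add. -/
theorem HasFiltration.finrank_eq {k : Type u} [Field k] [IsNoetherianRing R] [Module.Finite R M]
    {G : ModuleCat.{u} R ⥤ ModuleCat.{u} k} (hG : IsExactFunctor G) {N : Submodule R M}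
    {c : Multiset I} (h : HasFiltration S M N c) :
    Module.finrank k (G.obj (ModuleCat.of R N)) =
      (c.map fun i => Module.finrank k (G.obj (S i))).sum := by
  have := hG.additive
  have := hG.left_exact
  have := hG.right_exact
  induction h with
  | bot =>
    have h1 : Limits.IsZero (ModuleCat.of R (⊥ : Submodule R M)) :=
      ModuleCat.isZero_of_subsingleton _
    have := ModuleCat.subsingleton_of_isZero (G.map_isZero h1)
    exact Module.finrank_zero_of_subsingleton
  | @cons N N' c i h hN hi ih =>
    obtain ⟨φ⟩ := hi
    let T : ShortComplex (ModuleCat.{u} R) := ShortComplex.mk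
      (ModuleCat.ofHom (Submodule.inclusion hN))
      (ModuleCat.ofHom (N.submoduleOf N').mkQ) (by
        ext x
        exact (Submodule.Quotient.mk_eq_zero _).2 x.2)
    have hT : T.ShortExact := by
      refine ModuleCat.shortComplex_shortExact T (fun x => ?_) (Submodule.inclusion_injective hN)
        (Submodule.mkQ_surjective _)
      constructor
      · intro hx
        exact ⟨⟨x.1, (Submodule.Quotient.mk_eq_zero
          (N.submoduleOf N') (x := x)).1 hx⟩, rfl⟩
      · rintro ⟨y, rfl⟩
        exact (Submodule.Quotient.mk_eq_zero _).2 y.2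
    have hGT := hT.map_of_exact G
    have f1 : Module.Finite k (T.map G).X₁ := hG.finite _ (inferInstanceAs (Module.Finite R N))
    have f2 : Module.Finite k (T.map G).X₃ := hG.finite _
      (inferInstanceAs (Module.Finite R (↥N' ⧸ N.submoduleOf N')))
    have h1 := ModuleCat.free_shortExact_finrank_add hGT rfl rfl
    have h2 : Module.finrank k (T.map G).X₃ = Module.finrank k (G.obj (S i)) :=
      (G.mapIso (φ.toModuleIso (X₂ := S i))).toLinearEquiv.finrank_eq
    rw [Multiset.map_cons, Multiset.sum_cons, ← ih, ← h2, add_comm]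
    exact h1

/-- Filtrations have the same sections if there are exact functors which separate them. -/
theorem HasFiltration.unique {k : Type u} [Field k] [IsNoetherianRing R] [Module.Finite R M]
    {G : I → ModuleCat.{u} R ⥤ ModuleCat.{u} k} (hG : ∀ i, IsExactFunctor (G i)) {rank : I → ℕ}
    (hrank : Function.Injective rank) (h1 : ∀ i, Module.finrank k ((G i).obj (S i)) = 1)
    (h0 : ∀ i j, rank i < rank j → Module.finrank k ((G i).obj (S j)) = 0)
    {N : Submodule R M} {c c' : Multiset I} (h : HasFiltration S M N c)
    (h' : HasFiltration S M N c') : c = c' := by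
  classical
  -- Unitriangularity: the `i`-th dimension is the multiplicity of `i` plus contributions of smaller
  -- rank, so the multiplicities follow by induction on the rank.
  have split : ∀ (c : Multiset I) (i : I), (c.map fun j => Module.finrank k ((G i).obj (S j))).sum =
      c.count i + ((c.filter fun j => rank j < rank i).map
        fun j => Module.finrank k ((G i).obj (S j))).sum := by
    intro c i
    induction c using Multiset.induction with
    | empty => simp
    | cons j c ih =>
      rw [Multiset.map_cons, Multiset.sum_cons, ih, Multiset.count_cons]
      rcases lt_trichotomy (rank j) (rank i) with hlt | heq | hlt
      · rw [if_neg (fun h => hlt.ne (congrArg rank h.symm)), Multiset.filter_cons_of_pos (p := fun j => rank j < rank i) _ hlt,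
          Multiset.map_cons, Multiset.sum_cons]
        omega
      · obtain rfl := hrank heq
        rw [if_pos rfl, Multiset.filter_cons_of_neg
          (p := fun i => rank i < rank j) _ (lt_irrefl _), h1]
        omega
      · rw [if_neg (fun h => hlt.ne (congrArg rank h)), Multiset.filter_cons_of_neg
          (p := fun j => rank j < rank i) _ hlt.not_gt, h0 i j hlt]
        omega
  have key : ∀ r i, rank i = r → c.count i = c'.count i := by
    intro r
    induction r using Nat.strong_induction_on with
    | _ r ih =>
      rintro i rfl
      have h2 : c.filter (fun j => rank j < rank i) = c'.filter fun j => rank j < rank i := by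
        ext j
        rw [Multiset.count_filter, Multiset.count_filter]
        split_ifs with hj
        · exact ih _ hj j rfl
        · rfl
      have h3 := (h.finrank_eq (hG i)).symm.trans (h'.finrank_eq (hG i))
      rw [split c i, split c' i, h2] at h3
      exact Nat.add_right_cancel h3
  exact Multiset.ext.2 fun i => key _ i rfl

end Filtration

/-! ### The filtration of the restricted modules by edges -/

namespace DEdge

variable {n m : ℕ}

/-- The operation on diagrams belonging to an edge. -/
def raw : ∀ {v w : DVertex}, DEdge v w → RawDiagram n v.lines → RawDiagram (n + 1) w.lines
  | _, _, up _, E => addLine false E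
  | _, _, down _, E => bend false E
  | _, _, upPrime, E => addLine true E
  | _, _, downPrime, E => bend true E

theorem map_val {v w : DVertex} (e : DEdge v w) (h : HalfDiagram n v) : (e.map h).1 = e.raw h.1 := by
  cases e <;> rfl

theorem raw_isDiagram {v w : DVertex} (e : DEdge v w) {E : RawDiagram n v.lines}
    (hE : E.IsDiagram) : (e.raw E).IsDiagram := by
  cases e
  · exact addLine_isDiagram hE (fun h => by cases h)
  · exact bend_isDiagram hE (fun h => by cases h)
  · exact addLine_isDiagram hE fun _ => rfl
  · exact bend_isDiagram hE fun _ => rfl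

theorem raw_allPropagating {v w : DVertex} {e : DEdge v w} (he : e.IsUp) {E : RawDiagram n v.lines} :
    (e.raw E).AllPropagating ↔ E.AllPropagating := by
  cases e with
  | up l => exact addLine_allPropagating
  | upPrime => exact addLine_allPropagating
  | down l => exact he.elim
  | downPrime => exact he.elim

theorem raw_injective {v w : DVertex} (e : DEdge v w) :
    Function.Injective (e.raw : RawDiagram n v.lines → _) := by
  intro x y h
  cases e with
  | up l => exact addLine_injective h
  | upPrime => exact addLine_injective h
  | down l => exact Function.LeftInverse.injective (unbend_bend false) h
  | downPrime => exact Function.LeftInverse.injective (unbend_bend true) h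

/-- The edge operations change only the eastern end, where the embedded algebra has a plain line. -/
theorem raw_mat_mul {v w : DVertex} (e : DEdge v w) {D : RawDiagram n m} {E : RawDiagram m v.lines}
    {C : RawDiagram n v.lines} (hE : E.IsPairing) (hC : C.IsPairing) {r : ℕ}
    (h : D.mat * E.mat = r • C.mat) :
    (addLine false D).mat * (e.raw E).mat = r • (e.raw C).mat := by
  cases e with
  | up l => exact addLine_mat_mul h false false
  | upPrime => exact addLine_mat_mul h false true
  | down l => exact addLine_mat_mul_bend hE hC h false
  | downPrime => exact addLine_mat_mul_bend hE hC h true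

/-- Every vertex is the target of at most one downward edge. -/
theorem eq_of_not_isUp {v v' w : DVertex} {e : DEdge v w} {e' : DEdge v' w} (h : ¬ e.IsUp)
    (h' : ¬ e'.IsUp) : v = v' := by
  cases e <;> cases e' <;> simp_all [IsUp]

end DEdge

section Sections

variable (k : Type u) [Field k] (δ : k) {n : ℕ} {w : DVertex}

/-- The span of a set of half diagrams is stable under the smaller algebra. -/
def IsLayerStable (Y : Set (HalfDiagram (n + 1) w)) : Prop :=
  ∀ (D : DDiagram n), ∀ y ∈ Y, DAlg.diag k δ D.addLine • StdCarrier.half k δ y ∈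
    Submodule.span k (StdCarrier.half k δ '' Y)

variable {k δ}

theorem IsLayerStable.smul_mem {Y : Set (HalfDiagram (n + 1) w)} (hY : IsLayerStable k δ Y)
    (a : DAlg k δ n) {x : StdCarrier k δ (n + 1) w}
    (hx : x ∈ Submodule.span k (StdCarrier.half k δ '' Y)) :
    towerMap k δ n a • x ∈ Submodule.span k (StdCarrier.half k δ '' Y) := by
  have := span_diag k δ (Submodule.mem_top (x := a))
  induction this using Submodule.span_induction with
  | mem a ha =>
    obtain ⟨D, rfl⟩ := ha
    rw [towerMap_diag]
    induction hx using Submodule.span_induction with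
    | mem x hx =>
      obtain ⟨y, hy, rfl⟩ := hx
      exact hY D y hy
    | zero => rw [smul_zero]; exact Submodule.zero_mem _
    | add x y _ _ hx hy => rw [smul_add]; exact Submodule.add_mem _ hx hy
    | smul c x _ hx => rw [smul_comm]; exact Submodule.smul_mem _ _ hx
  | zero => rw [map_zero, zero_smul]; exact Submodule.zero_mem _
  | add a b _ _ ha hb => rw [map_add, add_smul]; exact Submodule.add_mem _ ha hb
  | smul c a _ ha => rw [map_smul, smul_assoc]; exact Submodule.smul_mem _ _ ha

variable (k δ n w) in
/-- The restriction of `Δ_{n+1}(w)` to `d_n`. -/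
noncomputable abbrev resStd : ModuleCat.{u} (DAlg k δ n) :=
  (towerRes k (fun n => DAlg k δ n) (towerMap k δ) n).obj (stdModule k δ (n + 1) w)

/-- The submodule of the restriction spanned by a stable set of half diagrams. -/
noncomputable def IsLayerStable.submodule {Y : Set (HalfDiagram (n + 1) w)}
    (hY : IsLayerStable k δ Y) : Submodule (DAlg k δ n) (resStd k δ n w) where
  carrier := {x : StdCarrier k δ (n + 1) w | x ∈ Submodule.span k (StdCarrier.half k δ '' Y)}
  add_mem' := (Submodule.span k (StdCarrier.half k δ '' Y)).add_mem
  zero_mem' := (Submodule.span k (StdCarrier.half k δ '' Y)).zero_mem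
  smul_mem' a _ hx := hY.smul_mem a hx

/-- The products of a diagram with a half diagram and with its image under an edge map. -/
theorem diag_addLine_smul_half {v : DVertex} (e : DEdge v w) (D : DDiagram n)
    (h : HalfDiagram n v) : (∃ (r : ℕ) (h' : HalfDiagram n v),
      DAlg.diag k δ D • StdCarrier.half k δ h = δ ^ r • StdCarrier.half k δ h' ∧
      DAlg.diag k δ D.addLine • StdCarrier.half k δ (e.map h) =
        δ ^ r • StdCarrier.half k δ (e.map h')) ∨
    (DAlg.diag k δ D • StdCarrier.half k δ h = 0 ∧
      (DAlg.diag k δ D.addLine • StdCarrier.half k δ (e.map h) = 0 ∨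
      ¬ e.IsUp ∧ ∃ (v' : DVertex) (e' : DEdge v' w) (x : HalfDiagram n v') (r : ℕ), e'.IsUp ∧
        DAlg.diag k δ D.addLine • StdCarrier.half k δ (e.map h) =
        δ ^ r • StdCarrier.half k δ (e'.map x))) := by
  have hc := concat_isDiagram D.2.1 h.2.1
  by_cases ho : HasOddLoop D.1 h.1
  · right
    refine ⟨diag_smul_half_zero k δ (Or.inl ho), Or.inl (diag_smul_half_of_mat_zero k δ ?_)⟩
    have := e.raw_mat_mul h.isPairing hc.isPairing (r := 0)
      ((mat_mul_of_odd D.isPairing h.isPairing ho).trans (zero_smul ..).symm)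
    rw [zero_smul] at this
    rw [DEdge.map_val]
    exact this
  have hm := e.raw_mat_mul h.isPairing hc.isPairing (mat_mul D.isPairing h.isPairing ho)
  by_cases hp : (concat D.1 h.1).AllPropagating
  · left
    refine ⟨_, h.smul D ho hp, diag_smul_half k δ ho rfl, diag_smul_half_of_mat k δ ?_⟩
    rw [DEdge.map_val, DEdge.map_val]
    exact hm
  · right
    refine ⟨diag_smul_half_zero k δ (Or.inr hp), ?_⟩
    -- A propagating line lost before bending can become harmless afterwards, since bending removes
    -- a southern vertex. The result is then in the image of an upward edge: coming from `e` itself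
    -- would mean that no line was lost.
    by_cases hp' : (e.raw (concat D.1 h.1)).AllPropagating
    · right
      have he : ¬ e.IsUp := fun he => hp ((DEdge.raw_allPropagating he).1 hp')
      refine ⟨he, ?_⟩
      obtain ⟨ho', -, hg⟩ := concat_of_mat_mul D.addLine.isPairing (e.map h).isPairing
        (e.raw_isDiagram hc).isPairing ((congrArg _ (congrArg _ (e.map_val h))).trans hm)
      obtain ⟨v', e', x, hx⟩ := DEdge.exists_map_eq ((e.map h).smul D.addLine ho' (hg ▸ hp'))
      refine ⟨v', e', x, _, ?_, (diag_smul_half k δ ho' (h' := e'.map x) (by rw [hx]; rfl))⟩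
      by_contra he'
      obtain rfl := DEdge.eq_of_not_isUp he he'
      obtain rfl : e = e' := Subsingleton.elim _ _
      refine hp ?_
      have h1 : e.raw x.1 = e.raw (concat D.1 h.1) := by
        rw [← hg, ← e.map_val x, hx]
        rfl
      rw [← e.raw_injective h1]
      exact x.2.2.1
    · left
      refine diag_smul_half_of_mat_not k δ (e.raw_isDiagram hc).isPairing hp'
        (r := numLoops D.1 h.1) ?_
      rw [DEdge.map_val]
      exact hm

/-- Adding the image of an edge map to a stable set. -/
theorem IsLayerStable.union {Y : Set (HalfDiagram (n + 1) w)} (hY : IsLayerStable k δ Y)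
    {v : DVertex} (e : DEdge v w)
    (he : e.IsUp ∨ ∀ (v' : DVertex) (e' : DEdge v' w), e'.IsUp → Set.range (e'.map (n := n)) ⊆ Y) :
    IsLayerStable k δ (Y ∪ Set.range (e.map (n := n))) := by
  rintro D y (hy | ⟨h, rfl⟩)
  · exact Submodule.span_mono (Set.image_mono Set.subset_union_left) (hY D y hy)
  · rcases diag_addLine_smul_half (k := k) (δ := δ) e D h with
      ⟨r, h', -, h1⟩ | ⟨-, h1 | ⟨h0, v', e', x, r, hu, h1⟩⟩
    · rw [h1]
      exact Submodule.smul_mem _ _ (Submodule.subset_span ⟨_, Or.inr ⟨h', rfl⟩, rfl⟩)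
    · rw [h1]
      exact Submodule.zero_mem _
    · rw [h1]
      exact Submodule.smul_mem _ _ (Submodule.subset_span
        ⟨_, Or.inl (he.resolve_left h0 v' e' hu ⟨x, rfl⟩), rfl⟩)

open Classical in
/-- The section belonging to an edge. -/
theorem IsLayerStable.nonempty_section {Y : Set (HalfDiagram (n + 1) w)}
    (hY : IsLayerStable k δ Y) {v : DVertex} (e : DEdge v w)
    (he : e.IsUp ∨ ∀ (v' : DVertex) (e' : DEdge v' w), e'.IsUp → Set.range (e'.map (n := n)) ⊆ Y)
    (hdisj : ∀ h : HalfDiagram n v, e.map h ∉ Y) :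
    Nonempty ((↥(hY.union e he).submodule ⧸
      hY.submodule.submoduleOf (hY.union e he).submodule) ≃ₗ[DAlg k δ n] stdModule k δ n v) := by
  -- `p` reads off the coefficients of the image of the edge map and `q` is its section. `p` is
  -- linear over `d_n` on the larger submodule, because all error terms lie in the span of `Y`.
  let p : StdCarrier k δ (n + 1) w →ₗ[k] StdCarrier k δ n v :=
    (halfBasis k δ (n + 1) w).constr k fun y =>
      if hy : ∃ h : HalfDiagram n v, e.map h = y then StdCarrier.half k δ hy.choose else 0
  have p_map : ∀ h, p (StdCarrier.half k δ (e.map h)) = StdCarrier.half k δ h := fun h => by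
    have hy : ∃ h', e.map h' = e.map h := ⟨h, rfl⟩
    rw [← halfBasis_apply, Module.Basis.constr_basis, dif_pos hy, e.map_injective hy.choose_spec]
  have p_zero : ∀ x ∈ Submodule.span k (StdCarrier.half k δ '' Y), p x = 0 := fun x hx => by
    induction hx using Submodule.span_induction with
    | mem x hx =>
      obtain ⟨y, hy, rfl⟩ := hx
      rw [← halfBasis_apply, Module.Basis.constr_basis, dif_neg]
      rintro ⟨h, rfl⟩
      exact hdisj h hy
    | zero => exact map_zero _
    | add x y _ _ hx hy => rw [map_add, hx, hy, add_zero]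
    | smul c x _ hx => rw [map_smul, hx, smul_zero]
  let q : StdCarrier k δ n v →ₗ[k] StdCarrier k δ (n + 1) w :=
    (halfBasis k δ n v).constr k fun h => StdCarrier.half k δ (e.map h)
  have q_half : ∀ h, q (StdCarrier.half k δ h) = StdCarrier.half k δ (e.map h) := fun h => by
    rw [← halfBasis_apply, Module.Basis.constr_basis]
  set Y' := Y ∪ Set.range (e.map (n := n)) with hY'
  have q_mem : ∀ x, q x ∈ Submodule.span k (StdCarrier.half k δ '' Y') := fun x => by
    have := span_half k δ (Submodule.mem_top (x := x))
    induction this using Submodule.span_induction with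
    | mem x hx =>
      obtain ⟨h, rfl⟩ := hx
      rw [q_half]
      exact Submodule.subset_span ⟨_, Or.inr ⟨h, rfl⟩, rfl⟩
    | zero => rw [map_zero]; exact Submodule.zero_mem _
    | add x y _ _ hx hy => rw [map_add]; exact Submodule.add_mem _ hx hy
    | smul c x _ hx => rw [map_smul]; exact Submodule.smul_mem _ _ hx
  have p_q : ∀ x, p (q x) = x := fun x => by
    have := span_half k δ (Submodule.mem_top (x := x))
    induction this using Submodule.span_induction with
    | mem x hx =>
      obtain ⟨h, rfl⟩ := hx
      rw [q_half, p_map]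
    | zero => rw [map_zero, map_zero]
    | add x y _ _ hx hy => rw [map_add, map_add, hx, hy]
    | smul c x _ hx => rw [map_smul, map_smul, hx]
  have sub_mem : ∀ x ∈ Submodule.span k (StdCarrier.half k δ '' Y'),
      x - q (p x) ∈ Submodule.span k (StdCarrier.half k δ '' Y) := fun x hx => by
    induction hx using Submodule.span_induction with
    | mem x hx =>
      obtain ⟨y, hy | ⟨h, rfl⟩, rfl⟩ := hx
      · have hy : StdCarrier.half k δ y ∈ Submodule.span k (StdCarrier.half k δ '' Y) :=
          Submodule.subset_span ⟨y, hy, rfl⟩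
        rw [p_zero _ hy, map_zero, sub_zero]
        exact hy
      · rw [p_map, q_half, sub_self]
        exact Submodule.zero_mem _
    | zero => rw [map_zero, map_zero, sub_zero]; exact Submodule.zero_mem _
    | add x y _ _ hx hy => rw [map_add, map_add, add_sub_add_comm]; exact Submodule.add_mem _ hx hy
    | smul c x _ hx => rw [map_smul, map_smul, ← smul_sub]; exact Submodule.smul_mem _ _ hx
  have p_smul : ∀ (a : DAlg k δ n) (x : StdCarrier k δ n v), p (towerMap k δ n a • q x) = a • x := by
    intro a x
    have := span_diag k δ (Submodule.mem_top (x := a))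
    induction this using Submodule.span_induction with
    | mem a ha =>
      obtain ⟨D, rfl⟩ := ha
      rw [towerMap_diag]
      have := span_half k δ (Submodule.mem_top (x := x))
      induction this using Submodule.span_induction with
      | mem x hx =>
        obtain ⟨h, rfl⟩ := hx
        rw [q_half]
        rcases diag_addLine_smul_half (k := k) (δ := δ) e D h with
          ⟨r, h', h2, h1⟩ | ⟨h2, h1 | ⟨h0, v', e', x, r, hu, h1⟩⟩
        · rw [h1, h2, map_smul, p_map]
        · rw [h1, h2, map_zero]
        · rw [h1, h2, map_smul, p_zero, smul_zero]
          exact Submodule.subset_span ⟨_, he.resolve_left h0 v' e' hu ⟨x, rfl⟩, rfl⟩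
      | zero => simp only [map_zero, smul_zero]
      | add x y _ _ hx hy => rw [map_add, smul_add, map_add, hx, hy, smul_add]
      | smul c x _ hx => rw [map_smul q, smul_comm, map_smul p c, hx, smul_comm]
    | zero => rw [map_zero, zero_smul, zero_smul, map_zero]
    | add a b _ _ ha hb => rw [map_add, add_smul, map_add, ha, hb, add_smul]
    | smul c a _ ha => rw [map_smul (towerMap k δ n) c, smul_assoc, map_smul p c, ha, smul_assoc]
  have p_smul' : ∀ (a : DAlg k δ n), ∀ x ∈ Submodule.span k (StdCarrier.half k δ '' Y'),
      p (towerMap k δ n a • x) = a • p x := fun a x hx => by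
    have h1 := p_zero _ (hY.smul_mem a (sub_mem _ hx))
    rw [smul_sub, map_sub, p_smul] at h1
    exact sub_eq_zero.1 h1
  let N' := (hY.union e he).submodule
  let φ : N' →ₗ[DAlg k δ n] StdCarrier k δ n v :=
    { toFun := fun x => p (show StdCarrier k δ (n + 1) w from x.1)
      map_add' := fun x y => map_add p (show StdCarrier k δ (n + 1) w from x.1) _
      map_smul' := fun a x => p_smul' a _ x.2 }
  have hφ : Function.Surjective φ := fun x => ⟨⟨q x, q_mem x⟩, p_q x⟩
  have hk : LinearMap.ker φ = hY.submodule.submoduleOf N' := by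
    ext x
    constructor
    · intro hx
      have hx : p (show StdCarrier k δ (n + 1) w from x.1) = 0 := hx
      have h1 := sub_mem _ x.2
      change (show StdCarrier k δ (n + 1) w from x.1) -
        q (p (show StdCarrier k δ (n + 1) w from x.1)) ∈ _ at h1
      rw [hx, map_zero, sub_zero] at h1
      exact h1
    · intro hx
      exact p_zero _ hx
  exact ⟨(Submodule.quotEquivOfEq _ _ hk.symm).trans (φ.quotKerEquivOfSurjective hφ)⟩

variable (k δ n w) in
theorem isLayerStable_empty : IsLayerStable k δ (∅ : Set (HalfDiagram (n + 1) w)) :=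
  fun _ _ hy => hy.elim

variable (k δ n w) in
theorem isLayerStable_empty_submodule : (isLayerStable_empty k δ n w).submodule = ⊥ := by
  rw [eq_bot_iff]
  intro x hx
  have hx : (show StdCarrier k δ (n + 1) w from x) ∈
    Submodule.span k (StdCarrier.half k δ '' (∅ : Set (HalfDiagram (n + 1) w))) := hx
  rw [Set.image_empty, Submodule.span_empty] at hx
  exact hx

theorem IsLayerStable.submodule_eq_top {Y : Set (HalfDiagram (n + 1) w)}
    (hY : IsLayerStable k δ Y) (h : ∀ y, y ∈ Y) : hY.submodule = ⊤ := by
  rw [eq_top_iff]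
  rintro x -
  obtain rfl : Y = Set.univ := Set.eq_univ_of_forall h
  change (show StdCarrier k δ (n + 1) w from x) ∈
    Submodule.span k (StdCarrier.half k δ '' (Set.univ : Set (HalfDiagram (n + 1) w)))
  rw [Set.image_univ]
  exact span_half k δ Submodule.mem_top

variable (k δ n) in
/-- The modules of a layer. -/
noncomputable abbrev layerModule : DVertex.layer n → ModuleCat.{u} (DAlg k δ n) :=
  fun m => stdModule k δ n m

-- If `v` is not in the layer, there are no half diagrams for it, so nothing is added to the
-- filtration and no label is counted.
open Classical in
theorem IsLayerStable.exists_cons {Y : Set (HalfDiagram (n + 1) w)} (hY : IsLayerStable k δ Y)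
    {c : Multiset (DVertex.layer n)}
    (hc : HasFiltration (layerModule k δ n) (resStd k δ n w) hY.submodule c)
    {v : DVertex} (e : DEdge v w)
    (he : e.IsUp ∨ ∀ (v' : DVertex) (e' : DEdge v' w), e'.IsUp → Set.range (e'.map (n := n)) ⊆ Y)
    (hdisj : ∀ h : HalfDiagram n v, e.map h ∉ Y) :
    ∃ c', HasFiltration (layerModule k δ n) (resStd k δ n w) (hY.union e he).submodule c' ∧
      ∀ l, c'.count l = c.count l + if l.1 = v then 1 else 0 := by
  by_cases hv : v ∈ DVertex.layer n
  · have hmono : Submodule.span k (StdCarrier.half k δ '' Y) ≤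
        Submodule.span k (StdCarrier.half k δ '' (Y ∪ Set.range (e.map (n := n)))) :=
      Submodule.span_mono (Set.image_mono Set.subset_union_left)
    refine ⟨⟨v, hv⟩ ::ₘ c, .cons _ hc (fun x hx => hmono hx) (hY.nonempty_section e he hdisj),
      fun l => ?_⟩
    · rw [Multiset.count_cons]
      simp only [Subtype.ext_iff]
  · have hempty : IsEmpty (HalfDiagram n v) := ⟨fun h => hv h.mem_layer⟩
    have h1 : Y ∪ Set.range (e.map (n := n)) = Y := by
      rw [Set.range_eq_empty, Set.union_empty]
    refine ⟨c, ?_, fun l => ?_⟩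
    · have h2 : ∀ {Y' : Set (HalfDiagram (n + 1) w)} (hY' : IsLayerStable k δ Y'), Y' = Y →
          hY'.submodule = hY.submodule := by
        rintro _ _ rfl
        rfl
      rw [h2 _ h1]
      exact hc
    · rw [if_neg (fun h : l.1 = v => hv (h ▸ l.2)), add_zero]

variable (k δ n w) in
open Classical in
/-- The restriction of `Δ_{n+1}(w)` has a filtration with one section for every edge. -/
theorem exists_hasFiltration : ∃ c,
    HasFiltration (layerModule k δ n) (resStd k δ n w) ⊤ c ∧
      ∀ l, c.count l = if DInfinity.Adj l.1 w then 1 else 0 := by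
  have h0 := isLayerStable_empty k δ n w
  have hc0 : HasFiltration (layerModule k δ n) (resStd k δ n w) h0.submodule 0 := by
    rw [isLayerStable_empty_submodule]
    exact .bot
  have disj : ∀ {v v' : DVertex} (e : DEdge v w) (e' : DEdge v' w), v ≠ v' →
      ∀ h : HalfDiagram n v, e.map h ∉ Set.range (e'.map (n := n)) := by
    rintro v v' e e' hv h ⟨h', he⟩
    exact hv (DEdge.eq_of_map_eq e e' he.symm)
  have count : ∀ {w : DVertex} (l : DVertex) (P : Prop), (P ↔ Nonempty (DEdge l w)) →
      (if P then 1 else 0) = if DInfinity.Adj l w then 1 else 0 := fun l P hP =>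
    if_congr (hP.trans ⟨fun ⟨e⟩ => e.adj, DEdge.nonempty_of_adj⟩) rfl rfl
  -- The incoming edges depend on whether the vertex is 0', 0, 1 or at least 2. Upward edges are
  -- treated first, as products from a downward image may fall into their images.
  rcases w with _ | _ | _ | l
  · obtain ⟨c1, h1, e1⟩ := h0.exists_cons hc0 .downPrime
      (Or.inr fun v' e' he => by cases e'; exact he.elim) fun h => id
    refine ⟨c1, ?_, fun l => ?_⟩
    · rw [← IsLayerStable.submodule_eq_top _ fun y => ?_]
      · exact h1
      · obtain ⟨v, e, x, rfl⟩ := DEdge.exists_map_eq y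
        cases e
        exact Or.inr ⟨x, rfl⟩
    · rw [e1, Multiset.count_zero, zero_add]
      generalize l.1 = v
      exact count _ _ ⟨by rintro rfl; exact ⟨.downPrime⟩, by rintro ⟨e⟩; cases e; rfl⟩
  · obtain ⟨c1, h1, e1⟩ := h0.exists_cons hc0 (.down 0)
      (Or.inr fun v' e' he => by cases e'; exact he.elim) fun h => id
    refine ⟨c1, ?_, fun l => ?_⟩
    · rw [← IsLayerStable.submodule_eq_top _ fun y => ?_]
      · exact h1
      · obtain ⟨v, e, x, rfl⟩ := DEdge.exists_map_eq y
        cases e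
        exact Or.inr ⟨x, rfl⟩
    · rw [e1, Multiset.count_zero, zero_add]
      generalize l.1 = v
      exact count _ _ ⟨by rintro rfl; exact ⟨.down 0⟩, by rintro ⟨e⟩; cases e; rfl⟩
  · obtain ⟨c1, h1, e1⟩ := h0.exists_cons hc0 (.up 0) (Or.inl trivial) fun h => id
    obtain ⟨c2, h2, e2⟩ := IsLayerStable.exists_cons _ h1 .upPrime (Or.inl trivial) (by
      intro h hh
      rw [Set.empty_union] at hh
      exact disj .upPrime (.up 0) (by simp) h hh)
    obtain ⟨c3, h3, e3⟩ := IsLayerStable.exists_cons _ h2 (.down 1) (Or.inr fun v' e' he => by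
      rw [Set.empty_union]
      cases e' with
      | up => exact Set.subset_union_left
      | upPrime => exact Set.subset_union_right
      | down => exact he.elim) (by
      rintro h (hh | hh)
      · rw [Set.empty_union] at hh
        exact disj (.down 1) (.up 0) (by simp) h hh
      · exact disj (.down 1) .upPrime (by simp) h hh)
    refine ⟨c3, ?_, fun l => ?_⟩
    · rw [← IsLayerStable.submodule_eq_top _ fun y => ?_]
      · exact h3
      · obtain ⟨v, e, x, rfl⟩ := DEdge.exists_map_eq y
        cases e with
        | up => exact Or.inl (Or.inl (Or.inr ⟨x, rfl⟩))
        | upPrime => exact Or.inl (Or.inr ⟨x, rfl⟩)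
        | down => exact Or.inr ⟨x, rfl⟩
    · rw [e3, e2, e1, Multiset.count_zero, zero_add]
      generalize l.1 = v
      rw [← count v (v = .nat 0 ∨ v = .prime ∨ v = .nat 2)
        ⟨by rintro (rfl | rfl | rfl) <;> exact ⟨by constructor⟩,
        by rintro ⟨e⟩; cases e <;> simp⟩]
      rcases v with _ | _ | _ | _ | v <;> simp
  · obtain ⟨c1, h1, e1⟩ := h0.exists_cons hc0 (.up (l + 1)) (Or.inl trivial) fun h => id
    obtain ⟨c3, h3, e3⟩ := IsLayerStable.exists_cons _ h1 (.down (l + 2)) (Or.inr fun v' e' he => by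
      rw [Set.empty_union]
      cases e' with
      | up => exact subset_rfl
      | down => exact he.elim) (by
      intro h hh
      rw [Set.empty_union] at hh
      exact disj (.down (l + 2)) (.up (l + 1)) (by simp) h hh)
    refine ⟨c3, ?_, fun j => ?_⟩
    · rw [← IsLayerStable.submodule_eq_top _ fun y => ?_]
      · exact h3
      · obtain ⟨v, e, x, rfl⟩ := DEdge.exists_map_eq y
        cases e with
        | up => exact Or.inl (Or.inr ⟨x, rfl⟩)
        | down => exact Or.inr ⟨x, rfl⟩
    · rw [e3, e1, Multiset.count_zero, zero_add]
      generalize j.1 = v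
      rw [← count v (v = .nat (l + 1) ∨ v = .nat (l + 3))
        ⟨by
          rintro (rfl | rfl)
          · exact ⟨.up _⟩
          · exact ⟨.down _⟩,
        by rintro ⟨e⟩; cases e <;> simp⟩]
      by_cases h1 : v = .nat (l + 1)
      · subst h1; simp
      · simp [h1]

end Sections

/-! ### Multiplicities in restrictions -/

section Multiplicity

variable (k : Type u) [Field k] {δ : k} {n : ℕ}

instance (n : ℕ) : IsNoetherianRing (DAlg k δ n) := IsNoetherianRing.of_finite k _

instance (w : DVertex) : Module.Finite (DAlg k δ n) (resStd k δ n w) := by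
  let : Module k (resStd k δ n w) :=
    (inferInstance : Module k (StdCarrier k δ (n + 1) w))
  have : Module.Finite k (resStd k δ n w) :=
    inferInstanceAs (Module.Finite k (StdCarrier k δ (n + 1) w))
  have : IsScalarTower k (DAlg k δ n) (resStd k δ n w) := ⟨fun c a x => by
    change towerMap k δ n (c • a) • (show StdCarrier k δ (n + 1) w from x) =
      c • towerMap k δ n a • (show StdCarrier k δ (n + 1) w from x)
    rw [map_smul, smul_assoc]⟩
  exact Module.Finite.of_restrictScalars_finite k (DAlg k δ n) _

theorem ofId_comm (v : DVertex.layer n) (c : k) :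
    (Algebra.ofId k (DAlg k δ n)).toRingHom c * coreIdem v k δ =
      coreIdem v k δ * (Algebra.ofId k (DAlg k δ n)).toRingHom c := Algebra.commutes c _

/-- The functor which sends a module to its part fixed by the idempotent of a vertex. -/
noncomputable def coreFunctor (v : DVertex.layer n) : ModuleCat.{u} (DAlg k δ n) ⥤ ModuleCat.{u} k :=
  cornerFunctor (Algebra.ofId k (DAlg k δ n)).toRingHom (coreIdem v k δ) (ofId_comm k v)

theorem finrank_coreFunctor_self (hδ : δ ≠ 0) (v : DVertex.layer n) :
    Module.finrank k ((coreFunctor k (δ := δ) v).obj (layerModule k δ n v)) = 1 := by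
  refine finrank_eq_one
    (⟨StdCarrier.half k δ (core v), coreIdem_smul_core v k hδ⟩ : corner _ _ (ofId_comm k (δ := δ) v) (layerModule k δ n v))
    (fun h => half_ne_zero k δ (core v) (congrArg Subtype.val h)) ?_
  rintro ⟨x, hx⟩
  obtain ⟨c, hc⟩ := exists_coreIdem_smul v k δ x
  refine ⟨c, Subtype.ext ?_⟩
  change algebraMap k (DAlg k δ n) c • StdCarrier.half k δ (core v) = x
  rw [algebraMap_smul, ← hc]
  exact hx

theorem finrank_coreFunctor_eq_zero {v w : DVertex.layer n} (h : v.1.rank < w.1.rank) :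
    Module.finrank k ((coreFunctor k (δ := δ) v).obj (layerModule k δ n w)) = 0 := by
  have : Subsingleton (corner _ _ (ofId_comm k (δ := δ) v) (layerModule k δ n w)) := by
    refine ⟨fun x y => Subtype.ext ?_⟩
    have key : ∀ z : corner _ _ (ofId_comm k (δ := δ) v) (layerModule k δ n w), z.1 = 0 :=
      fun z => (z.2 : _ = _).symm.trans (coreIdem_smul_eq_zero v k δ h z.1)
    rw [key x, key y]
  exact Module.finrank_zero_of_subsingleton
    (M := corner _ _ (ofId_comm k (δ := δ) v) (layerModule k δ n w))

/-- The functors `M ↦ e_v M` are exact, of dimension 1 on `Δ(v)` and 0 on the modules of larger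
rank. -/
theorem hasFiltration_unique (hδ : δ ≠ 0) {w : DVertex} {c c' : Multiset (DVertex.layer n)}
    (h : HasFiltration (layerModule k δ n) (resStd k δ n w) ⊤ c)
    (h' : HasFiltration (layerModule k δ n) (resStd k δ n w) ⊤ c') : c = c' :=
  HasFiltration.unique (fun v => cornerFunctor_isExact _ (ofId_comm k v) (coreIdem_mul_self v k hδ))
    (rank := fun v => v.1.rank) (DVertex.rank_injective.comp Subtype.val_injective)
    (finrank_coreFunctor_self k hδ) (fun _ _ => finrank_coreFunctor_eq_zero k) h h'

theorem isDeltaGood_resStd (hδ : δ ≠ 0) (n : ℕ) (w : DVertex) :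
    IsDeltaGood (layerModule k δ n) (resStd k δ n w) := by
  classical
  obtain ⟨c, hc, -⟩ := exists_hasFiltration k δ n w
  refine ⟨hc.nonempty, fun F F' l => ?_⟩
  rw [← F.count_labels, ← F'.count_labels,
    hasFiltration_unique k hδ F.hasFiltration F'.hasFiltration]

theorem card_edges (l m : DVertex) [Decidable (DInfinity.Adj l m)] :
    ENat.card {e : DInfinity.toDirGraph.Edge // DInfinity.toDirGraph.src e = l ∧
      DInfinity.toDirGraph.tgt e = m} = if DInfinity.Adj l m then 1 else 0 := by
  split_ifs with h
  · have : Unique {e : DInfinity.toDirGraph.Edge // DInfinity.toDirGraph.src e = l ∧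
        DInfinity.toDirGraph.tgt e = m} :=
      { default := ⟨⟨(l, m), h⟩, rfl, rfl⟩
        uniq := by
          rintro ⟨⟨⟨a, b⟩, hab⟩, rfl, rfl⟩
          rfl }
    rw [ENat.card_eq_coe_fintype_card, Fintype.card_unique, Nat.cast_one]
  · rw [ENat.card_eq_zero_iff_empty]
    refine ⟨?_⟩
    rintro ⟨⟨⟨a, b⟩, hab⟩, rfl, rfl⟩
    exact h hab

theorem mult_eq_card_edges (hδ : δ ≠ 0) (n : ℕ) (l : DVertex.layer n) (w : DVertex)
    (Φ : DeltaFiltration (layerModule k δ n) (resStd k δ n w)) :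
    (Φ.mult l : ℕ∞) = ENat.card {e : DInfinity.toDirGraph.Edge //
      DInfinity.toDirGraph.src e = l ∧ DInfinity.toDirGraph.tgt e = w} := by
  classical
  obtain ⟨c, hc, hcount⟩ := exists_hasFiltration k δ n w
  rw [card_edges, ← Φ.count_labels, hasFiltration_unique k hδ Φ.hasFiltration hc, hcount]
  split_ifs <;> rfl

end Multiplicity

/-! ### The axioms of a tower -/

section Tower

namespace DVertex

theorem layer_subset (n : ℕ) : layer n ⊆ layer (2 + n) := by
  rintro (_ | l) h
  · exact ⟨even_two.add h.1, by omega⟩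
  · refine ⟨by have := h.1; omega, ?_⟩
    have h2 : l % 2 = n % 2 := h.2
    change l % 2 = (2 + n) % 2
    omega

theorem modEq_of_mem_layer {n m : ℕ} {v : DVertex} (hn : v ∈ layer n) (hm : v ∈ layer m) :
    n ≡ m [MOD 2] := by
  rcases v with _ | l
  · change n % 2 = m % 2
    rw [Nat.even_iff.1 hn.1, Nat.even_iff.1 hm.1]
  · exact hn.2.symm.trans hm.2

theorem layer_zero : layer 0 = {nat 0} := by
  ext v
  rcases v with _ | l
  · refine iff_of_false ?_ (by simp)
    rintro ⟨-, h⟩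
    omega
  · rw [Set.mem_singleton_iff, nat.injEq]
    exact ⟨fun h => Nat.le_zero.1 h.1, by rintro rfl; exact ⟨le_rfl, rfl⟩⟩

theorem exists_mem_layer (v : DVertex) : ∃ n, v ∈ layer n := by
  rcases v with _ | l
  · exact ⟨2, even_two, le_rfl⟩
  · exact ⟨l, le_rfl, rfl⟩

theorem mem_layer_succ {n : ℕ} {v w : DVertex} (h : DInfinity.Adj v w) (hv : v ∈ layer n) :
    w ∈ layer (n + 1) := by
  obtain ⟨e⟩ := DEdge.nonempty_of_adj h
  cases e with
  | up l =>
    obtain ⟨h1, h2⟩ := hv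
    exact ⟨by omega, h2.add_right 1⟩
  | down l =>
    obtain ⟨h1, h2⟩ := hv
    have h2 : (l + 1) % 2 = n % 2 := h2
    refine ⟨by omega, ?_⟩
    change l % 2 = (n + 1) % 2
    omega
  | upPrime =>
    have := Nat.even_iff.1 hv.1
    refine ⟨by omega, ?_⟩
    change 1 % 2 = (n + 1) % 2
    omega
  | downPrime =>
    obtain ⟨h1, h2⟩ := hv
    have h2 : 1 % 2 = n % 2 := h2
    exact ⟨Nat.even_iff.2 (by omega), by omega⟩

end DVertex

variable (k : Type u) [Field k] {δ : k}

/-- The idempotent of the vertex of smaller rank fixes the core of its own module and kills the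
other module. -/
theorem isEmpty_stdModule_iso (hδ : δ ≠ 0) (n : ℕ) {l m : DVertex} (hl : l ∈ DVertex.layer n)
    (hm : m ∈ DVertex.layer n) (hne : l ≠ m) : IsEmpty (stdModule k δ n l ≅ stdModule k δ n m) := by
  have key : ∀ {l m : DVertex} (hl : l ∈ DVertex.layer n), l.rank < m.rank →
      IsEmpty (StdCarrier k δ n l ≃ₗ[DAlg k δ n] StdCarrier k δ n m) := by
    refine fun {l m} hl h => ⟨fun φ => ?_⟩
    have h1 := coreIdem_smul_core ⟨l, hl⟩ k hδ
    refine half_ne_zero k δ (core ⟨l, hl⟩) (φ.injective ?_)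
    rw [← h1, map_smul, coreIdem_smul_eq_zero ⟨l, hl⟩ k δ h, map_zero]
  refine ⟨fun φ => ?_⟩
  rcases lt_or_gt_of_ne (DVertex.rank_injective.ne hne) with h | h
  · exact (key hl h).false φ.toLinearEquiv
  · exact (key hm h).false φ.symm.toLinearEquiv

theorem finrank_stdCarrier_zero : Module.finrank k (StdCarrier k δ 0 (.nat 0)) = 1 := by
  have : Unique (HalfDiagram 0 (.nat 0)) :=
    { default := HalfDiagram.ofEven (idDiagram 0) (idDiagram_isDiagram 0)
        (idDiagram_allPropagating 0) (by rw [idDiagram_numBlobs, Nat.cast_zero])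
      uniq := fun h => Subtype.ext (Subsingleton.elim (α := RawDiagram 0 0) _ _) }
  rw [Module.finrank_eq_card_basis (halfBasis k δ 0 (.nat 0)), Fintype.card_unique]

theorem isSimpleModule_stdCarrier_zero :
    IsSimpleModule (DAlg k δ 0) (StdCarrier k δ 0 (.nat 0)) := by
  have h1 := finrank_stdCarrier_zero k (δ := δ)
  have : Nontrivial (StdCarrier k δ 0 (.nat 0)) := Module.nontrivial_of_finrank_pos (R := k) (by omega)
  rw [isSimpleModule_iff]
  refine ⟨fun N => or_iff_not_imp_left.2 fun hN => ?_⟩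
  obtain ⟨x, hx, hx0⟩ := N.exists_mem_ne_zero_of_ne_bot hN
  refine eq_top_iff.2 fun y _ => ?_
  obtain ⟨c, rfl⟩ := (finrank_eq_one_iff_of_nonzero' x hx0).1 h1 y
  rw [← algebraMap_smul (DAlg k δ 0) c x]
  exact N.smul_mem _ hx

/-- The algebras `d_n` form a tower. -/
theorem isGraphTower (hδ : δ ≠ 0) : IsGraphTower k (fun n => DAlg k δ n) (towerMap k δ)
    DVertex.layer (stdModule k δ) 2 DInfinity.toDirGraph (DVertex.nat 0) where
  embedding := towerMap_injective k δ
  not_iso n _ hl _ hm := isEmpty_stdModule_iso k hδ n hl hm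
  index_subset := DVertex.layer_subset
  index_mod _ _ := fun ⟨_, hn, hm⟩ => DVertex.modEq_of_mem_layer hn hm
  res_good n l _ := isDeltaGood_resStd k hδ n l
  index_zero := DVertex.layer_zero
  simple_zero := isSimpleModule_stdCarrier_zero k
  finrank_zero := by
    let φ : (ModuleCat.restrictScalars (algebraMap k (DAlg k δ 0))).obj
        (stdModule k δ 0 (.nat 0)) ≃ₗ[k] StdCarrier k δ 0 (.nat 0) :=
      { AddEquiv.refl (StdCarrier k δ 0 (.nat 0)) with
        map_smul' := fun c x =>
          algebraMap_smul (DAlg k δ 0) c (show StdCarrier k δ 0 (.nat 0) from x) }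
    rw [φ.finrank_eq, finrank_stdCarrier_zero]
  functors := by
    refine ⟨fun n => capFunctor k δ (Nat.add_comm 2 n), fun n => capFunctor_isExact k hδ _,
      fun n l _ _ => capFunctor_stdModule k hδ _ l, fun n l _ hl => ?_,
      fun n l _ _ => capFunctor_towerRes k hδ (Nat.add_comm 2 n) (Nat.add_comm 2 (n + 1)) _⟩
    -- The functor gives `Δ_n(l)` in any case; outside the layer this has an empty basis.
    obtain ⟨φ⟩ := capFunctor_stdModule k hδ (Nat.add_comm 2 n) l
    refine Limits.IsZero.of_iso ?_ φ
    have : IsEmpty (HalfDiagram n l) := ⟨fun h => hl h.mem_layer⟩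
    have : Subsingleton (StdCarrier k δ n l) := (halfBasis k δ n l).repr.toEquiv.subsingleton
    exact ModuleCat.isZero_of_subsingleton (ModuleCat.of (DAlg k δ n) (StdCarrier k δ n l))
  vertices := DVertex.exists_mem_layer
  edge_index _ e := DVertex.mem_layer_succ e.adj
  edge_mult n l m _ Φ := mult_eq_card_edges k hδ n l m Φ

end Tower

theorem mainTheorem6 (k : Type u) [Field k] (δ : k) (hδ : δ ≠ 0) :
    -- the diagrams form a basis of the algebra
    (∀ n : ℕ, ∃ b : Module.Basis (DDiagram n) k (DAlg k δ n), ∀ D, b D = DAlg.diag k δ D) ∧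
    -- the half diagrams form a basis of the modules
    (∀ (n : ℕ) (v : DVertex), ∃ b : Module.Basis (HalfDiagram n v) k (StdCarrier k δ n v),
      ∀ h, b h = StdCarrier.half k δ h) ∧
    -- these modules are the standard modules
    (∀ n : ℕ, IsStandardFamily (DAlg k δ n)
      (fun a b : DVertex.layer n => DVertex.StdLe a b)
      (fun v : DVertex.layer n => stdModule k δ n v)) ∧
    -- the algebras, embedded by adding a line on the right, form a tower
    (∃ ι : ∀ n : ℕ, DAlg k δ n →ₐ[k] DAlg k δ (n + 1),
      (∀ (n : ℕ) (D : DDiagram n), ∃ D' : DDiagram (n + 1),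
        D'.1 = RawDiagram.addLine false D.1 ∧ ι n (DAlg.diag k δ D) = DAlg.diag k δ D') ∧
      IsGraphTower k (fun n => DAlg k δ n) ι DVertex.layer (stdModule k δ)
        2 DInfinity.toDirGraph (DVertex.nat 0)) ∧
    -- the half diagrams form a Pascal array with the given edge maps
    (∃ ψ : ∀ (n : ℕ) (e : DInfinity.toDirGraph.Edge),
        HalfDiagram n (DInfinity.toDirGraph.src e) → HalfDiagram (n + 1) (DInfinity.toDirGraph.tgt e),
      IsPascalArray DInfinity.toDirGraph (DVertex.nat 0) HalfDiagram ψ ∧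
      (∀ (n i : ℕ) (a : DInfinity.Adj (.nat i) (.nat (i + 1))) (h : HalfDiagram n (.nat i)),
        (ψ n ⟨(.nat i, .nat (i + 1)), a⟩ h).1 = RawDiagram.addLine false h.1) ∧
      (∀ (n i : ℕ) (a : DInfinity.Adj (.nat (i + 1)) (.nat i)) (h : HalfDiagram n (.nat (i + 1))),
        (ψ n ⟨(.nat (i + 1), .nat i), a⟩ h).1 = RawDiagram.bend false h.1) ∧
      (∀ (n : ℕ) (a : DInfinity.Adj .prime (.nat 1)) (h : HalfDiagram n .prime),
        (ψ n ⟨(.prime, .nat 1), a⟩ h).1 = RawDiagram.addLine true h.1) ∧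
      (∀ (n : ℕ) (a : DInfinity.Adj (.nat 1) .prime) (h : HalfDiagram n (.nat 1)),
        (ψ n ⟨(.nat 1, .prime), a⟩ h).1 = RawDiagram.bend true h.1)) := by
  exact ⟨fun n => ⟨diagBasis k δ n, diagBasis_apply k δ⟩,
    fun n v => ⟨halfBasis k δ n v, halfBasis_apply k δ⟩, isStandardFamily_stdModule k hδ,
    ⟨towerMap k δ, fun n D => ⟨D.addLine, rfl, towerMap_diag k δ D⟩, isGraphTower k hδ⟩,
    exists_pascalArray⟩
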